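/- Let $N\ge 1$ be an integer and let $n\ge N$, $L\ge 0$ be real. The $\beta=4$ induced spherical ensemble is the probability law on $N\times N$ real quaternion matrices $\mathbf G$ whose density with respect to Lebesgue measure in the $4N^2$ real coordinates of $\mathbf G$ is proportional to $$\frac{\det(\mathbf G\mathbf G^\dagger)^{2L}}{\det(\mathbf 1_N+\mathbf G\mathbf G^\dagger)^{2(n+N+L)}},$$ where $\dagger$ is the quaternion dual and $\det$ the quaternion determinant (for these positive semidefinite self-dual matrices, the square root of the determinant of the $2N\times 2N$ complex representative). Almost surely the $2N$ eigenvalues of the complex representative are $z_1,\bar z_1,\dots,z_N,\bar z_N$ with $z_j\in\mathbb C_+=\{z:\operatorname{Im} z>0\}$. The unordered eigenvalues $z_1,\dots,z_N$ have a continuous symmetric joint probability density $\mathcal Q$ on $\mathbb C_+^N$ with respect to Lebesgue measure (such a density is unique), and for $m\le N$ the $m$-point correlation function is $$\rho_{(m)}(r_1,\dots,r_m)=\frac{N(N-1)\cdots(N-m+1)}{\int_{\mathbb C_+^N}\mathcal Q}\int_{\mathbb C_+^{N-m}}\mathcal Q(r_1,\dots,r_m,w_{m+1},\dots,w_N)\,dw_{m+1}\cdots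 dw_N ,$$ where the last integral converges absolutely for all $r_1,\dots,r_m\in\mathbb C_+$. Let $h(z)=|z|^{2L}(z-\bar z)^{1/2}(1+|z|^2)^{-(n+L+1)}$ (principal square root) and define the skew-symmetric product $$\langle p,q\rangle=i\int_{\mathbb C_+}h(z)h(\bar z)\bigl(p(z)q(\bar z)-p(\bar z)q(z)\bigr)\,dx\,dy,\qquad z=x+iy .$$ Call polynomials $q_0,\dots,q_{2N-1}$, with $q_j$ monic of degree $j$, skew-orthogonal if for all $0\le j,k<N$ one has $\langle q_{2j},q_{2k}\rangle=\langle q_{2j+1},q_{2k+1}\rangle=0$ and $\langle q_{2j},q_{2k+1}\rangle=\delta_{j,k}\,g_j$, where $g_j:=\langle q_{2j},q_{2j+1}\rangle$. For such polynomials put \begin{align*} D(x,y)&=i\sum_{j=0}^{N-1}\frac{h(x)h(y)}{g_j}\bigl(q_{2j}(x)q_{2j+1}(y)-q_{2j+1}(x)q_{2j}(y)\bigr),\\ S(x,y)&=i\sum_{j=0}^{N-1}\frac{h(x)h(\bar y)}{g_j}\bigl(q_{2j}(x)q_{2j+1}(\bar y)-q_{2j+1}(x)q_{2j}(\bar y)\bigr),\\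 I(x,y)&=i\sum_{j=0}^{N-1}\frac{h(\bar x)h(\bar y)}{g_j}\bigl(q_{2j}(\bar x)q_{2j+1}(\bar y)-q_{2j+1}(\bar x)q_{2j}(\bar y)\bigr). \end{align*} (a) For every such family of skew-orthogonal polynomials, every $m\le N$ and all $z_1,\dots,z_m\in\mathbb C_+$, $$\rho_{(m)}(z_1,\dots,z_m)=\operatorname{Pf}\left[\begin{pmatrix}D(z_s,z_t)&S(z_s,z_t)\\-S(z_t,z_s)&I(z_s,z_t)\end{pmatrix}\right]_{s,t=1,\dots,m},$$ and $D(x,y)=S(x,\bar y)=I(\bar x,\bar y)$ for all $x,y\in\mathbb C$. (b) The polynomials $$q_{2k+1}(z)=z^{2k+1},\qquad q_{2k}(z)=\sum_{j=0}^k\frac{\Gamma(L+k+1)\,\Gamma(n-k+\frac12)}{\Gamma(L+j+1)\,\Gamma(n-j+\frac12)}\,z^{2j}$$ are skew-orthogonal, with $g_k=\pi\,\Gamma(2n-2k)\,\Gamma(2L+2k+2)/\Gamma(2n+2L+2)$ for $0\le k<N$. (c) With the polynomials of (b), for all $z\in\mathbb C_+$, $$\rho_{(1)}(z)=S(z,z)=\frac{i\,\Gamma(2n+2L+2)\,\operatorname{Im}(z)\,|z|^{4L}}{2^{2(L+n)-1}(1+|z|^2)^{2n+2L+2}}\sum_{k=0}^{N-1}\sum_{j=0}^{k}\frac{|z|^{4j}\bigl(\bar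 z^{\,2k-2j+1}-z^{2k-2j+1}\bigr)}{\Gamma(L+j+1)\,\Gamma(L+k+\frac32)\,\Gamma(n-j+\frac12)\,\Gamma(n-k)} .$$ -/

import Mathlib

open MeasureTheory
open scoped Quaternion ENNReal ComplexConjugate Matrix

noncomputable section

namespace InducedSpherical

/-! ## The matrix ensemble -/

/-- The `2 × 2` complex matrix `[[w, x], [-x̄, w̄]]`, with `w = q₀ + i q₁` and `x = q₂ + i q₃`,
that represents the real quaternion `q = q₀ + i q₁ + j q₂ + k q₃`. -/
def quatBlock (q : ℍ[ℝ]) : Matrix (Fin 2) (Fin 2) ℂ :=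
  !![(⟨q.re, q.imI⟩ : ℂ), ⟨q.imJ, q.imK⟩;
     -conj (⟨q.imJ, q.imK⟩ : ℂ), conj (⟨q.re, q.imI⟩ : ℂ)]

/-- The `2N × 2N` complex matrix that represents an `N × N` real quaternion matrix. -/
def complexRep {N : ℕ} (G : Matrix (Fin N) (Fin N) ℍ[ℝ]) :
    Matrix (Fin N × Fin 2) (Fin N × Fin 2) ℂ :=
  Matrix.of fun p q => quatBlock (G p.1 q.1) p.2 q.2

/-- The quaternion determinant of a positive semidefinite self-dual real quaternion matrix:
the square root of the (real, nonnegative) determinant of its complex representative. -/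
def qdet {N : ℕ} (A : Matrix (Fin N) (Fin N) ℍ[ℝ]) : ℝ :=
  Real.sqrt (complexRep A).det.re

/-- The quaternion matrix with the given `4 N²` real coordinates. -/
def quatMatrix {N : ℕ} (x : Fin N → Fin N → Fin 4 → ℝ) : Matrix (Fin N) (Fin N) ℍ[ℝ] :=
  Matrix.of fun a b => ⟨x a b 0, x a b 1, x a b 2, x a b 3⟩

/-- The unnormalised matrix density `det(G G†)^{2L} / det(1 + G G†)^{2(n+N+L)}`, where `†` is the
quaternion dual and `det` the quaternion determinant. -/
def matrixWeight (N : ℕ) (n L : ℝ) (G : Matrix (Fin N) (Fin N) ℍ[ℝ]) : ℝ :=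
  qdet (G * Gᴴ) ^ (2 * L) / qdet (1 + G * Gᴴ) ^ (2 * (n + N + L))

/-- The measure with density `matrixWeight` with respect to Lebesgue measure in the `4 N²` real
coordinates of the matrix. -/
def matrixMeasure (N : ℕ) (n L : ℝ) : Measure (Fin N → Fin N → Fin 4 → ℝ) :=
  volume.withDensity fun x => ENNReal.ofReal (matrixWeight N n L (quatMatrix x))

/-- The law of the `β = 4` induced spherical ensemble: `matrixMeasure` normalised to total
mass one. -/
def ensemble (N : ℕ) (n L : ℝ) : Measure (Fin N → Fin N → Fin 4 → ℝ) :=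
  (matrixMeasure N n L Set.univ)⁻¹ • matrixMeasure N n L

/-! ## Eigenvalues, their joint density and the correlation functions -/

/-- The eigenvalues of a quaternion matrix in the open upper half plane, with multiplicity.
(The eigenvalues of the complex representative come in complex-conjugate pairs, and off a null set
of matrices none is real.) -/
def upperEigenvalues {N : ℕ} (G : Matrix (Fin N) (Fin N) ℍ[ℝ]) : Multiset ℂ :=
  open Classical in (complexRep G).charpoly.roots.filter fun z => 0 < z.im

/-- The eigenvalues in the upper half plane, listed in an unspecified order; if there are fewer
than `N` of them (a null event) the list is filled up with zeros. Only permutation-invariant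
functions of this list are used. -/
def eigenvalueList {N : ℕ} (G : Matrix (Fin N) (Fin N) ℍ[ℝ]) : Fin N → ℂ :=
  fun i => (upperEigenvalues G).toList.getD i 0

/-- `ℂ₊ᵏ`, where `ℂ₊` is the open upper half plane. -/
def upperHalf (k : ℕ) : Set (Fin k → ℂ) := {z | ∀ i, 0 < (z i).im}

/-- `Q` is the joint probability density function on `ℂ₊ᴺ` of the `N` (unordered) eigenvalues of
the ensemble: the continuous symmetric function such that the expectation of each measurable
permutation-invariant statistic of the eigenvalues is its integral against `Q`. The values of `Q`
on `ℂ₊ᴺ` are determined by this; the values elsewhere are irrelevant. -/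
structure IsEigenvalueJpdf (N : ℕ) (n L : ℝ) (Q : (Fin N → ℂ) → ℝ) : Prop where
  nonneg : ∀ z ∈ upperHalf N, 0 ≤ Q z
  symm : ∀ z ∈ upperHalf N, ∀ σ : Equiv.Perm (Fin N), Q (z ∘ σ) = Q z
  continuousOn : ContinuousOn Q (upperHalf N)
  law : ∀ F : (Fin N → ℂ) → ℝ≥0∞, Measurable F →
    (∀ (σ : Equiv.Perm (Fin N)) (z : Fin N → ℂ), F (z ∘ σ) = F z) →
    ∫⁻ x, F (eigenvalueList (quatMatrix x)) ∂(ensemble N n L) =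
      ∫⁻ z in upperHalf N, F z * ENNReal.ofReal (Q z)

/-- The `N`-tuple `(r₁, …, r_m, w_{m+1}, …, w_N)`. -/
def glue {N m : ℕ} (r : Fin m → ℂ) (w : Fin (N - m) → ℂ) : Fin N → ℂ :=
  fun i => if h : (i : ℕ) < m then r ⟨i, h⟩ else w ⟨i - m, by omega⟩

/-- The `m`-point correlation function of a density `Q` in `N` variables in `ℂ₊`:
`N (N-1) ⋯ (N-m+1) / Z_N[1] · ∫ Q(r₁, …, r_m, w_{m+1}, …, w_N) dw_{m+1} ⋯ dw_N`, where
`Z_N[1] = ∫ Q`. -/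
def correlation {N : ℕ} (Q : (Fin N → ℂ) → ℝ) (m : ℕ) (r : Fin m → ℂ) : ℝ :=
  (N.descFactorial m : ℝ) / (∫ z in upperHalf N, Q z) *
    ∫ w in upperHalf (N - m), Q (glue r w)

/-! ## Skew-orthogonal polynomials and the Pfaffian kernel -/

/-- `h(z) = |z|^{2L} (z - z̄)^{1/2} / (1 + |z|²)^{n+L+1}`, with the principal square root. -/
def h (n L : ℝ) (z : ℂ) : ℂ :=
  ((‖z‖ ^ (2 * L) : ℝ) : ℂ) * (z - conj z) ^ (1 / 2 : ℂ) /
    (((1 + ‖z‖ ^ 2) ^ (n + L + 1) : ℝ) : ℂ)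

/-- The skew product
`⟨p, q⟩ = i ∫_{ℂ₊} h(z) h(z̄) (p(z) q(z̄) - p(z̄) q(z)) dx dy`, where `z = x + i y`. -/
def skewProduct (n L : ℝ) (p q : Polynomial ℂ) : ℂ :=
  Complex.I * ∫ z in {z : ℂ | 0 < z.im}, h n L z * h n L (conj z) *
    (p.eval z * q.eval (conj z) - p.eval (conj z) * q.eval z)

/-- `q₀, q₁, …, q_{2N-1}` are monic polynomials with `deg q_j = j` that are skew-orthogonal. -/
structure IsSkewOrthogonal (N : ℕ) (n L : ℝ) (q : ℕ → Polynomial ℂ) : Prop where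
  monic : ∀ j < 2 * N, (q j).Monic
  natDegree : ∀ j < 2 * N, (q j).natDegree = j
  even_even : ∀ j < N, ∀ k < N, skewProduct n L (q (2 * j)) (q (2 * k)) = 0
  odd_odd : ∀ j < N, ∀ k < N, skewProduct n L (q (2 * j + 1)) (q (2 * k + 1)) = 0
  even_odd : ∀ j < N, ∀ k < N, j ≠ k → skewProduct n L (q (2 * j)) (q (2 * k + 1)) = 0

/-- The normalisation `g_j = ⟨q_{2j}, q_{2j+1}⟩`. -/
def g (n L : ℝ) (q : ℕ → Polynomial ℂ) (j : ℕ) : ℂ :=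
  skewProduct n L (q (2 * j)) (q (2 * j + 1))

/-- The kernel element `D(x, y)`. -/
def kerD (N : ℕ) (n L : ℝ) (q : ℕ → Polynomial ℂ) (x y : ℂ) : ℂ :=
  Complex.I * ∑ j ∈ Finset.range N, h n L x * h n L y / g n L q j *
    ((q (2 * j)).eval x * (q (2 * j + 1)).eval y - (q (2 * j + 1)).eval x * (q (2 * j)).eval y)

/-- The kernel element `S(x, y)`. -/
def kerS (N : ℕ) (n L : ℝ) (q : ℕ → Polynomial ℂ) (x y : ℂ) : ℂ :=
  Complex.I * ∑ j ∈ Finset.range N, h n L x * h n L (conj y) / g n L q j *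
    ((q (2 * j)).eval x * (q (2 * j + 1)).eval (conj y) -
      (q (2 * j + 1)).eval x * (q (2 * j)).eval (conj y))

/-- The kernel element `I(x, y)`. -/
def kerI (N : ℕ) (n L : ℝ) (q : ℕ → Polynomial ℂ) (x y : ℂ) : ℂ :=
  Complex.I * ∑ j ∈ Finset.range N, h n L (conj x) * h n L (conj y) / g n L q j *
    ((q (2 * j)).eval (conj x) * (q (2 * j + 1)).eval (conj y) -
      (q (2 * j + 1)).eval (conj x) * (q (2 * j)).eval (conj y))

/-- The `2m × 2m` matrix with the `2 × 2` blocks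
`K(z_s, z_t) = [[D(z_s, z_t), S(z_s, z_t)], [-S(z_t, z_s), I(z_s, z_t)]]`. -/
def kernelMatrix (N : ℕ) (n L : ℝ) (q : ℕ → Polynomial ℂ) {m : ℕ} (z : Fin m → ℂ) :
    Matrix (Fin m × Fin 2) (Fin m × Fin 2) ℂ :=
  Matrix.of fun a b =>
    (!![kerD N n L q (z a.1) (z b.1), kerS N n L q (z a.1) (z b.1);
        -kerS N n L q (z b.1) (z a.1), kerI N n L q (z a.1) (z b.1)] :
      Matrix (Fin 2) (Fin 2) ℂ) a.2 b.2

/-- The Pfaffian `1 / (2^m m!) ∑_σ ε(σ) ∏_l X_{σ(2l-1), σ(2l)}` of an antisymmetric `2m × 2m`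
matrix, whose rows and columns are numbered by the pairs
`(1,1), (1,2), (2,1), (2,2), …, (m,1), (m,2)`. -/
def pfaffian {m : ℕ} (X : Matrix (Fin m × Fin 2) (Fin m × Fin 2) ℂ) : ℂ :=
  (∑ σ : Equiv.Perm (Fin m × Fin 2),
    ((Equiv.Perm.sign σ : ℤ) : ℂ) * ∏ l : Fin m, X (σ (l, 0)) (σ (l, 1))) /
      ((2 : ℂ) ^ m * (m.factorial : ℂ))

/-- The explicit polynomials: `z^{2k+1}` in degree `2k+1`, and in degree `2k`
`∑_{j ≤ k} Γ(L+k+1) Γ(n-k+1/2) / (Γ(L+j+1) Γ(n-j+1/2)) z^{2j}`.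
By the reflection formula
`Γ(n-k+1/2) / Γ(n-j+1/2) = (-1)^{k-j} Γ(j+1/2-n) / Γ(k+1/2-n)` whenever the right-hand side is
free of poles (in particular for integers `n`). -/
def explicitPoly (n L : ℝ) (l : ℕ) : Polynomial ℂ :=
  if l % 2 = 1 then Polynomial.X ^ l
  else ∑ j ∈ Finset.range (l / 2 + 1),
    Polynomial.C ((Real.Gamma (L + (l / 2 : ℕ) + 1) * Real.Gamma (n - (l / 2 : ℕ) + 1 / 2) /
      (Real.Gamma (L + j + 1) * Real.Gamma (n - j + 1 / 2)) : ℝ) : ℂ) * Polynomial.X ^ (2 * j)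

/-- The explicit normalisation `π Γ(2n-2k) Γ(2L+2k+2) / Γ(2n+2L+2)`. -/
def explicitNorm (n L : ℝ) (k : ℕ) : ℝ :=
  Real.pi * Real.Gamma (2 * n - 2 * k) * Real.Gamma (2 * L + 2 * k + 2) /
    Real.Gamma (2 * n + 2 * L + 2)

/-- The explicit double-sum formula for the density. -/
def explicitDensity (N : ℕ) (n L : ℝ) (z : ℂ) : ℂ :=
  Complex.I * ((Real.Gamma (2 * n + 2 * L + 2) * z.im * ‖z‖ ^ (4 * L) /
      (2 ^ (2 * (L + n) - 1) * (1 + ‖z‖ ^ 2) ^ (2 * n + 2 * L + 2)) : ℝ) : ℂ) *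
    ∑ k ∈ Finset.range N, ∑ j ∈ Finset.range (k + 1),
      ((‖z‖ ^ (4 * j) : ℝ) : ℂ) * (conj z ^ (2 * k - 2 * j + 1) - z ^ (2 * k - 2 * j + 1)) /
        ((Real.Gamma (L + j + 1) * Real.Gamma (L + k + 3 / 2) * Real.Gamma (n - j + 1 / 2) *
          Real.Gamma (n - k) : ℝ) : ℂ)

end InducedSpherical

end

/-! The eigenvalue density is found by splitting off one conjugate pair of eigenvalues at a time,
with the characteristic polynomial as the carrier of the law. Write a quaternion matrix of size k +
1 in blocks a, b, c, d. If (1, u) is an eigenvector with right eigenvalue q = a + b·u, then the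
column is c = u q - d u (`riccati`), and a shear brings the matrix to block triangular form with
corner q and deflated minor d - u b. Trading c for u is a (k + 1)-to-one change of variables off a
null set (`ncard_riccati`, `ae_simpleRoots_observable`). Its Jacobian is the determinant of a
Sylvester operator, that is |χ(λ)|² with χ the characteristic polynomial of the minor and λ the
eigenvalue (`det_sylvester`). An area formula for maps with fibres of constant size makes a choice
of branch unnecessary.

In the weight, the shear may be replaced by a triangular matrix with the same Gram matrix
(`wt_shear_conj`). Then the row b is integrated out by a Schur complement
(`exists_lintegral_wt_block`), the eigenvector u contributes only a constant
(`exists_lintegral_block`), and integrating q over its conjugacy class gives the factor (im λ)².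
Induction on the size yields the density ∏ w(z_i) ∏ |z_i - z_j|² |z_i - conj z_j|²
(`exists_lintegral_charStat`). Constants need only be nonzero and finite, since the law is
normalised. Symmetric functions of the eigenvalues are measurable functions of the coefficients
(`exists_measurable_of_symm`), and continuity makes the density unique
(`IsEigenvalueJpdf.eq_eigDensity`).

For the Pfaffian formula, the interaction times ∏ (conj z_i - z_i) is the Vandermonde determinant of
all z_i and conj z_i, hence a determinant in any monic polynomials (`eigWeight_eq_det`). Integrating
N - m of the pairs term by term, as in de Bruijn's formula, leaves an alternating sum that sees only
the antisymmetric part of the pairing. Skew-orthogonality puts that part into normal form with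
entries -i g_j. Both the integrated density and the Pfaffian of the kernel then become sums over
permutations of the same 2m × 2m minors (`altSum_eq_sum_perm`, `altSum_sum_eq_sum_perm`): one is
weighted by -i g_j over the indices left out, the other by the inverses i / g_j over the indices
chosen. The quotient is the full product of the -i g_j, which is the normalisation up to explicit
factors (`correlation_eq_pfaffian`).

For the explicit family, polar coordinates show that two monomials have nonzero skew product only if
their degrees differ by one, and the radial factor is a Beta integral. Orthogonality is then a
two-term recursion, solved by the given Gamma quotients (`explicitCoeff_mul_radialIntegral`). The
duplication formula for Gamma turns the kernel on the diagonal into the double sum. -/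

open scoped ComplexOrder

noncomputable section

namespace InducedSpherical

set_option linter.unusedSectionVars false
set_option linter.unusedSimpArgs false

section

/-! ## Linear algebra of the complex representation -/

/-- `quatBlock` as a homomorphism of real algebras. -/
def quatBlockHom : ℍ[ℝ] →ₐ[ℝ] Matrix (Fin 2) (Fin 2) ℂ where
  toFun := quatBlock
  map_one' := by
    ext i j; fin_cases i <;> fin_cases j <;> simp [quatBlock, Complex.ext_iff]
  map_zero' := by
    ext i j; fin_cases i <;> fin_cases j <;> simp [quatBlock, Complex.ext_iff]
  map_mul' p q := by
    ext i j
    fin_cases i <;> fin_cases j <;>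
      simp [quatBlock, Complex.ext_iff, Matrix.mul_apply, Fin.sum_univ_two] <;>
      constructor <;> ring
  map_add' p q := by
    ext i j
    fin_cases i <;> fin_cases j <;> simp [quatBlock, Complex.ext_iff] <;> ring
  commutes' r := by
    ext i j
    fin_cases i <;> fin_cases j <;>
      simp [quatBlock, Complex.ext_iff, Matrix.algebraMap_matrix_apply]

@[simp] lemma quatBlockHom_apply (q : ℍ[ℝ]) : quatBlockHom q = quatBlock q := rfl

lemma quatBlock_star (q : ℍ[ℝ]) : quatBlock (star q) = (quatBlock q)ᴴ := by
  ext i j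
  fin_cases i <;> fin_cases j <;> simp [quatBlock, Complex.ext_iff]

variable {l m n : Type*}

/-- The complex representative of a rectangular quaternion matrix. -/
def crep (A : Matrix m n ℍ[ℝ]) : Matrix (m × Fin 2) (n × Fin 2) ℂ :=
  Matrix.of fun p q => quatBlock (A p.1 q.1) p.2 q.2

lemma complexRep_eq_crep {N : ℕ} (G : Matrix (Fin N) (Fin N) ℍ[ℝ]) : complexRep G = crep G := rfl

lemma crep_apply (A : Matrix m n ℍ[ℝ]) (p : m × Fin 2) (q : n × Fin 2) :
    crep A p q = quatBlock (A p.1 q.1) p.2 q.2 := rfl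

lemma crep_mul [Fintype m] (A : Matrix l m ℍ[ℝ]) (B : Matrix m n ℍ[ℝ]) :
    crep (A * B) = crep A * crep B := by
  ext p q
  simp only [crep_apply, Matrix.mul_apply, Fintype.sum_prod_type]
  rw [← quatBlockHom_apply, map_sum, Matrix.sum_apply]
  refine Finset.sum_congr rfl fun k _ => ?_
  rw [map_mul, Matrix.mul_apply]
  rfl

lemma crep_add (A B : Matrix m n ℍ[ℝ]) : crep (A + B) = crep A + crep B := by
  ext p q
  simp only [crep_apply, Matrix.add_apply]
  rw [← quatBlockHom_apply, map_add]; rfl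

lemma crep_smul (r : ℝ) (A : Matrix m n ℍ[ℝ]) : crep (r • A) = r • crep A := by
  ext p q
  simp only [crep_apply, Matrix.smul_apply]
  rw [← quatBlockHom_apply, map_smul]; rfl

@[simp] lemma crep_zero : crep (0 : Matrix m n ℍ[ℝ]) = 0 := by
  ext p q
  simp only [crep_apply, Matrix.zero_apply]
  rw [← quatBlockHom_apply, map_zero]; rfl

lemma crep_conjTranspose (A : Matrix m n ℍ[ℝ]) : crep Aᴴ = (crep A)ᴴ := by
  ext p q
  simp only [crep_apply, Matrix.conjTranspose_apply]
  rw [quatBlock_star]; rfl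

@[simp] lemma crep_one [DecidableEq n] : crep (1 : Matrix n n ℍ[ℝ]) = 1 := by
  ext ⟨i, a⟩ ⟨j, b⟩
  simp only [crep_apply, Matrix.one_apply, Prod.mk.injEq]
  split_ifs with h1 h2 h2
  · rw [← quatBlockHom_apply, map_one, Matrix.one_apply, if_pos h2.2]
  · rw [← quatBlockHom_apply, map_one, Matrix.one_apply, if_neg fun h => h2 ⟨h1, h⟩]
  · exact absurd h2.1 h1
  · rw [← quatBlockHom_apply, map_zero]; rfl

/-- The complex representation as a homomorphism of real algebras. -/
def crepHom (n : Type*) [Fintype n] [DecidableEq n] :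
    Matrix n n ℍ[ℝ] →ₐ[ℝ] Matrix (n × Fin 2) (n × Fin 2) ℂ :=
  AlgHom.ofLinearMap ⟨⟨crep, crep_add⟩, fun r A => crep_smul r A⟩ crep_one crep_mul

@[simp] lemma crepHom_apply [Fintype n] [DecidableEq n] (A : Matrix n n ℍ[ℝ]) :
    crepHom n A = crep A := rfl

/-- The first columns of the blocks of a quaternion vector: a complex vector that determines it. -/
def ccol : (n → ℍ[ℝ]) ≃ₗ[ℝ] (n × Fin 2 → ℂ) where
  toFun v := fun p => quatBlock (v p.1) p.2 0
  map_add' v w := by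
    ext p
    simp only [Pi.add_apply]
    rw [← quatBlockHom_apply, map_add]; rfl
  map_smul' r v := by
    ext p
    simp only [Pi.smul_apply]
    rw [← quatBlockHom_apply, map_smul]; rfl
  invFun x := fun i => ⟨(x (i, 0)).re, (x (i, 0)).im, -(x (i, 1)).re, (x (i, 1)).im⟩
  left_inv v := by
    ext i <;> simp [quatBlock]
  right_inv x := by
    ext ⟨i, a⟩
    fin_cases a <;> simp [quatBlock, Complex.ext_iff]

lemma ccol_apply (v : n → ℍ[ℝ]) (p : n × Fin 2) : ccol v p = quatBlock (v p.1) p.2 0 := rfl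

/-- `quatBlock` is multiplicative, and the first column of a product of blocks is the left block
applied to the first column of the right one. So quaternion matrices act complex-linearly on
quaternion columns. -/
lemma ccol_mulVec [Fintype n] (A : Matrix m n ℍ[ℝ]) (v : n → ℍ[ℝ]) :
    ccol (A *ᵥ v) = crep A *ᵥ ccol v := by
  ext p
  simp only [ccol_apply, Matrix.mulVec, dotProduct, Fintype.sum_prod_type, crep_apply]
  rw [← quatBlockHom_apply, map_sum, Matrix.sum_apply]
  refine Finset.sum_congr rfl fun k _ => ?_
  rw [map_mul, Matrix.mul_apply]
  rfl

/-- The block of a complex number is diag(z, conj z), so right multiplication by it scales the first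
column by z. This is why right eigenvalues are eigenvalues of the complex representative. -/
lemma ccol_mul_complex (v : n → ℍ[ℝ]) (z : ℂ) :
    ccol (fun i => v i * (z : ℍ[ℝ])) = z • ccol v := by
  ext ⟨i, a⟩
  fin_cases a <;> simp [ccol_apply, quatBlock, Complex.ext_iff] <;>
      constructor <;> ring

/-! ### The complex number attached to a quaternion -/

/-- The point of the closed upper half plane that is conjugate to the quaternion `q`. -/
def lam (q : ℍ[ℝ]) : ℂ := ⟨q.re, Real.sqrt (q.imI ^ 2 + q.imJ ^ 2 + q.imK ^ 2)⟩

lemma lam_im_nonneg (q : ℍ[ℝ]) : 0 ≤ (lam q).im := Real.sqrt_nonneg _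

lemma lam_im_sq (q : ℍ[ℝ]) : (lam q).im ^ 2 = q.imI ^ 2 + q.imJ ^ 2 + q.imK ^ 2 :=
  Real.sq_sqrt (by positivity)

/-- The quaternion with given components. -/
def quat (a b c d : ℝ) : ℍ[ℝ] := ⟨a, b, c, d⟩

lemma quat_re (a b c d : ℝ) : (quat a b c d).re = a := rfl
lemma quat_imI (a b c d : ℝ) : (quat a b c d).imI = b := rfl
lemma quat_imJ (a b c d : ℝ) : (quat a b c d).imJ = c := rfl
lemma quat_imK (a b c d : ℝ) : (quat a b c d).imK = d := rfl

lemma quaternion_mul_eq_mul_iff (q p r s : ℍ[ℝ]) : q * p = r * s ↔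
    (q * p).re = (r * s).re ∧ (q * p).imI = (r * s).imI ∧ (q * p).imJ = (r * s).imJ ∧
      (q * p).imK = (r * s).imK :=
  ⟨fun h => by rw [h]; exact ⟨rfl, rfl, rfl, rfl⟩, fun h => Quaternion.ext _ _ h.1 h.2.1 h.2.2.1 h.2.2.2⟩

lemma exists_mul_eq_mul_lam (q : ℍ[ℝ]) : ∃ p : ℍ[ℝ], p ≠ 0 ∧ q * p = p * (lam q : ℍ[ℝ]) := by
  have hs := lam_im_sq q
  have hre : (lam q).re = q.re := rfl
  -- Let v be the imaginary part of q. Then p = v + |v| i intertwines, because v p = -|v|² + |v| v i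
  -- = p (|v| i). It vanishes exactly if v = -|v| i, and then j, which anticommutes with i, serves
  -- instead.
  by_cases h0 : q.imJ = 0 ∧ q.imK = 0 ∧ q.imI + (lam q).im = 0
  · obtain ⟨hj, hk, hi⟩ := h0
    refine ⟨quat 0 0 1 0, fun h => one_ne_zero (congrArg QuaternionAlgebra.imJ h), ?_⟩
    have : q.imI = -(lam q).im := by linarith
    refine (quaternion_mul_eq_mul_iff _ _ _ _).2 ?_
    simp only [quat_re, quat_imI, quat_imJ, quat_imK, Quaternion.re_mul, Quaternion.imI_mul, Quaternion.imJ_mul, Quaternion.imK_mul,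
      Quaternion.re_coeComplex, Quaternion.imI_coeComplex, Quaternion.imJ_coeComplex,
      Quaternion.imK_coeComplex, hj, hk, this, hre]
    refine ⟨?_, ?_, ?_, ?_⟩ <;> ring
  · refine ⟨quat 0 (q.imI + (lam q).im) q.imJ q.imK, fun h => h0 ⟨?_, ?_, ?_⟩, ?_⟩
    · exact congrArg QuaternionAlgebra.imJ h
    · exact congrArg QuaternionAlgebra.imK h
    · exact congrArg QuaternionAlgebra.imI h
    · refine (quaternion_mul_eq_mul_iff _ _ _ _).2 ?_
      simp only [quat_re, quat_imI, quat_imJ, quat_imK, Quaternion.re_mul, Quaternion.imI_mul, Quaternion.imJ_mul, Quaternion.imK_mul,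
        Quaternion.re_coeComplex, Quaternion.imI_coeComplex, Quaternion.imJ_coeComplex,
        Quaternion.imK_coeComplex, hre]
      refine ⟨?_, ?_, ?_, ?_⟩ <;> nlinarith

lemma normSq_lam (q : ℍ[ℝ]) : Complex.normSq (lam q) = Quaternion.normSq q := by
  have := lam_im_sq q
  rw [Complex.normSq_apply, Quaternion.normSq_def', show (lam q).re = q.re from rfl]
  linarith

lemma norm_lam (q : ℍ[ℝ]) : ‖lam q‖ = ‖q‖ := by
  have := normSq_lam q
  rw [Complex.normSq_eq_norm_sq, Quaternion.normSq_eq_norm_mul_self, ← sq] at this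
  exact (pow_left_inj₀ (norm_nonneg _) (norm_nonneg _) two_ne_zero).1 this

lemma lam_coeComplex {z : ℂ} (hz : 0 ≤ z.im) : lam (z : ℍ[ℝ]) = z := by
  apply Complex.ext
  · rfl
  · simp [lam, Real.sqrt_sq hz]

/-- Conjugation preserves the real part, as re (a b) = re (b a), and the norm; the two together
determine `lam`. -/
lemma lam_conj {p q r : ℍ[ℝ]} (hp : p ≠ 0) (h : q * p = p * r) : lam q = lam r := by
  have hq : q = p * r * p⁻¹ := by rw [← h, mul_assoc, mul_inv_cancel₀ hp, mul_one]
  have hre : q.re = r.re := by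
    have key : ∀ a b : ℍ[ℝ], (a * b).re = (b * a).re := fun a b => by
      simp only [Quaternion.re_mul]; ring
    rw [hq, key, ← mul_assoc, inv_mul_cancel₀ hp, one_mul]
  have hn : Quaternion.normSq q = Quaternion.normSq r := by
    have h1 := congrArg Quaternion.normSq h
    rw [map_mul, map_mul, mul_comm] at h1
    exact mul_left_cancel₀ (Quaternion.normSq_ne_zero.2 hp) h1
  rw [Quaternion.normSq_def', Quaternion.normSq_def', hre] at hn
  simp only [lam, hre]
  congr 2
  linarith

/-! ### Real determinants -/

variable [Fintype n]

/-- Left multiplication of quaternion vectors by a matrix, as a real-linear map. -/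
def mulVecR (A : Matrix n n ℍ[ℝ]) : (n → ℍ[ℝ]) →ₗ[ℝ] (n → ℍ[ℝ]) where
  toFun v := A *ᵥ v
  map_add' v w := Matrix.mulVec_add A v w
  map_smul' r v := Matrix.mulVec_smul A r v

/-- Right multiplication of quaternion vectors by a quaternion, as a real-linear map. -/
def mulRightR (n : Type*) (q : ℍ[ℝ]) : (n → ℍ[ℝ]) →ₗ[ℝ] (n → ℍ[ℝ]) where
  toFun v := fun i => v i * q
  map_add' v w := by ext1 i; exact add_mul _ _ _
  map_smul' r v := by ext1 i; exact smul_mul_assoc r (v i) q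

@[simp] lemma mulRightR_apply {n : Type*} (q : ℍ[ℝ]) (v : n → ℍ[ℝ]) (i : n) :
    mulRightR n q v i = v i * q := rfl

variable [DecidableEq n]

/-- Through `ccol` the map is complex-linear, and the real determinant of a complex-linear map is
the squared modulus of its complex determinant. -/
lemma det_of_ccol_conj (f : (n → ℍ[ℝ]) →ₗ[ℝ] (n → ℍ[ℝ]))
    (M : Matrix (n × Fin 2) (n × Fin 2) ℂ) (h : ∀ v, ccol (f v) = M *ᵥ ccol v) :
    LinearMap.det f = ‖M.det‖ ^ 2 := by
  have h1 : ((Matrix.toLin' M).restrictScalars ℝ) =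
      (ccol : (n → ℍ[ℝ]) ≃ₗ[ℝ] _).toLinearMap ∘ₗ f ∘ₗ ccol.symm.toLinearMap := by
    refine LinearMap.ext fun v => ?_
    simp [h]
  rw [← LinearMap.det_conj f ccol, ← h1, LinearMap.det_restrictScalars, LinearMap.det_toLin',
    Algebra.norm_complex_apply, Complex.normSq_eq_norm_sq]

lemma det_mulVecR (A : Matrix n n ℍ[ℝ]) : LinearMap.det (mulVecR A) = ‖(crep A).det‖ ^ 2 :=
  det_of_ccol_conj _ _ fun v => ccol_mulVec A v

/-- The map v ↦ v q - A v is not complex-linear as it stands. Conjugating it by right multiplication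
with p, where q p = p λ, replaces q by the complex number λ = `lam q`, and the map becomes λ - `crep
A`. Later this determinant is the Jacobian of the passage to eigenvectors. -/
lemma det_sylvester (A : Matrix n n ℍ[ℝ]) (q : ℍ[ℝ]) :
    LinearMap.det (mulRightR n q - mulVecR A) = ‖(crep A).charpoly.eval (lam q)‖ ^ 2 := by
  obtain ⟨p, hp, hq⟩ := exists_mul_eq_mul_lam q
  let e : (n → ℍ[ℝ]) ≃ₗ[ℝ] (n → ℍ[ℝ]) :=
    LinearEquiv.ofLinearMap (mulRightR n p) (mulRightR n p⁻¹)
      (LinearMap.ext fun v => by ext1 i; simp [hp])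
      (LinearMap.ext fun v => by ext1 i; simp [hp])
  rw [← LinearMap.det_conj _ e, Matrix.eval_charpoly]
  have hq' : p⁻¹ * (q * p) = lam q := by rw [hq, ← mul_assoc, inv_mul_cancel₀ hp, one_mul]
  have key : ∀ v, (e.toLinearMap ∘ₗ (mulRightR n q - mulVecR A) ∘ₗ e.symm.toLinearMap) v =
      (fun i => v i * (lam q : ℍ[ℝ])) - A *ᵥ v := by
    intro v
    ext1 i
    have h2 : (A *ᵥ fun i => v i * p⁻¹) i * p = (A *ᵥ v) i := by
      simp only [Matrix.mulVec, dotProduct, Finset.sum_mul]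
      exact Finset.sum_congr rfl fun j _ => by
        rw [mul_assoc, mul_assoc, inv_mul_cancel₀ hp, mul_one]
    change ((v i * p⁻¹) * q - (A *ᵥ fun i => v i * p⁻¹) i) * p = _
    rw [sub_mul, h2, mul_assoc, mul_assoc, hq']
    rfl
  refine det_of_ccol_conj _ _ fun v => ?_
  rw [key, map_sub, ccol_mul_complex, ccol_mulVec, Matrix.sub_mulVec]
  congr 1
  ext p
  simp [Matrix.scalar_apply, Matrix.mulVec_diagonal]

/-- Right multiplication of quaternion row vectors by a matrix, as a real-linear map. -/
def vecMulR {n : Type*} [Fintype n] (A : Matrix n n ℍ[ℝ]) : (n → ℍ[ℝ]) →ₗ[ℝ] (n → ℍ[ℝ]) where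
  toFun v := v ᵥ* A
  map_add' v w := Matrix.add_vecMul A v w
  map_smul' r v := Matrix.smul_vecMul r v A

/-- Entrywise quaternion conjugation as a real-linear equivalence. -/
def starVec (n : Type*) : (n → ℍ[ℝ]) ≃ₗ[ℝ] (n → ℍ[ℝ]) where
  toFun v := star v
  map_add' v w := star_add v w
  map_smul' r v := by ext1 i; simp
  invFun v := star v
  left_inv v := star_star v
  right_inv v := star_star v

lemma det_vecMulR (A : Matrix n n ℍ[ℝ]) : LinearMap.det (vecMulR A) = ‖(crep A).det‖ ^ 2 := by
  have h1 : (starVec n).toLinearMap ∘ₗ vecMulR A ∘ₗ (starVec n).symm.toLinearMap = mulVecR Aᴴ := by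
    refine LinearMap.ext fun v => ?_
    change star (star v ᵥ* A) = Aᴴ *ᵥ v
    rw [Matrix.star_vecMul, star_star]
  rw [← LinearMap.det_conj _ (starVec n), h1, det_mulVecR, crep_conjTranspose,
    Matrix.det_conjTranspose, norm_star]

end

section

/-! ## Change of variables -/

section Haar

variable {E F : Type*} [NormedAddCommGroup E] [NormedSpace ℝ E] [FiniteDimensional ℝ E]
  [MeasurableSpace E] [BorelSpace E] [NormedAddCommGroup F] [NormedSpace ℝ F]
  [FiniteDimensional ℝ F] [MeasurableSpace F] [BorelSpace F]

/-- Linear isomorphisms preserve Haar measures up to a constant. -/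
lemma exists_lintegral_comp_linearEquiv (μ : Measure E) [μ.IsAddHaarMeasure] (ν : Measure F)
    [ν.IsAddHaarMeasure] (e : E ≃ₗ[ℝ] F) : ∃ C : ℝ≥0∞, C ≠ 0 ∧ C ≠ ⊤ ∧
      ∀ f : F → ℝ≥0∞, ∫⁻ x, f (e x) ∂μ = C * ∫⁻ y, f y ∂ν := by
  let e' : E ≃L[ℝ] F := e.toContinuousLinearEquiv
  have h1 : (μ.map e').IsAddHaarMeasure := e'.isAddHaarMeasure_map μ
  obtain hc := Measure.isAddLeftInvariant_eq_smul (μ.map e') ν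
  refine ⟨Measure.addHaarScalarFactor (μ.map e') ν, ?_, ENNReal.coe_ne_top, fun f => ?_⟩
  · exact ENNReal.coe_ne_zero.2 (Measure.addHaarScalarFactor_pos_of_isAddHaarMeasure _ _).ne'
  · have h2 : ∫⁻ x, f (e x) ∂μ = ∫⁻ y, f y ∂(μ.map e') :=
      (e'.toHomeomorph.toMeasurableEquiv.measurableEmbedding.lintegral_map f).symm
    rw [h2]
    conv_lhs => rw [hc]
    rw [lintegral_smul_measure]
    rfl

lemma lintegral_comp_linearMap (μ : Measure E) [μ.IsAddHaarMeasure] (A : E →ₗ[ℝ] E)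
    (hA : LinearMap.det A ≠ 0) (f : E → ℝ≥0∞) :
    ∫⁻ x, f (A x) ∂μ = ENNReal.ofReal |LinearMap.det A|⁻¹ * ∫⁻ y, f y ∂μ := by
  have h1 := Measure.map_linearMap_addHaar_eq_smul_addHaar μ hA
  let e : E ≃ₗ[ℝ] E := LinearEquiv.ofIsUnitDet (f := A) (v := Module.finBasis ℝ E)
    (v' := Module.finBasis ℝ E) (by rwa [LinearMap.det_toMatrix, isUnit_iff_ne_zero])
  let e' : E ≃L[ℝ] E := e.toContinuousLinearEquiv
  have h2 : ∫⁻ x, f (A x) ∂μ = ∫⁻ y, f y ∂(μ.map A) :=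
    (e'.toHomeomorph.toMeasurableEquiv.measurableEmbedding.lintegral_map f).symm
  rw [h2, h1, lintegral_smul_measure, abs_inv, smul_eq_mul]

/-- The area formula for a continuously differentiable map almost all of whose fibres have
`k` points. -/
lemma lintegral_comp_mul_abs_det_of_ncard (μ : Measure E) [μ.IsAddHaarMeasure]
    (f : E → E) (f' : E → E →L[ℝ] E) (hf : ∀ x, HasFDerivAt f (f' x) x) (hf' : Continuous f')
    (k : ℕ) (hk : ∀ᵐ y ∂μ, (f ⁻¹' {y}).Finite ∧ (f ⁻¹' {y}).ncard = k)
    (g : E → ℝ≥0∞) (hg : Measurable g) :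
    ∫⁻ x, ENNReal.ofReal |(f' x).det| * g (f x) ∂μ = k * ∫⁻ y, g y ∂μ := by
  classical
  -- Only regular points matter: the integrand vanishes at critical points, and the critical values
  -- form a null set by Sard.
  set S : Set E := {x | (f' x).det ≠ 0} with hS
  have hdet : Continuous fun x => (f' x).det := ContinuousLinearMap.continuous_det.comp hf'
  have hSm : MeasurableSet S := (isOpen_ne_fun hdet continuous_const).measurableSet
  -- A map within δ of an invertible A is injective as soon as δ < ‖A⁻¹‖⁻¹. The value 1 for singular
  -- A is a dummy, since only regular points are partitioned.
  have hinj : ∀ A : E →L[ℝ] E, ∃ δ : NNReal, δ ≠ 0 ∧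
      (A.det ≠ 0 → ∀ (s : Set E), ApproximatesLinearOn f A s δ → Set.InjOn f s) := by
    intro A
    by_cases hA : A.det = 0
    · exact ⟨1, one_ne_zero, fun h => absurd hA h⟩
    let B := A.toContinuousLinearEquivOfDetNeZero hA
    have hB : (B : E →L[ℝ] E) = A := A.coe_toContinuousLinearEquivOfDetNeZero hA
    by_cases h0 : Subsingleton E
    · exact ⟨1, one_ne_zero, fun _ s _ => Set.injOn_of_subsingleton f s⟩
    have hpos : 0 < ‖(B.symm : E →L[ℝ] E)‖₊ := by
      have := not_subsingleton_iff_nontrivial.1 h0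
      exact B.nnnorm_symm_pos
    refine ⟨‖(B.symm : E →L[ℝ] E)‖₊⁻¹ / 2, by positivity, fun _ s hs => ?_⟩
    rw [← hB] at hs
    exact hs.injOn (Or.inr (half_lt_self (inv_pos.2 hpos)))
  choose r hr0 hr using hinj
  obtain ⟨t, A, ht, htm, hSt, happ, hA⟩ :=
    exists_partition_approximatesLinearOn_of_hasFDerivWithinAt f S f'
      (fun x _ => (hf x).hasFDerivWithinAt) r hr0
  have hinj' : ∀ n, Set.InjOn f (S ∩ t n) := by
    intro n
    by_cases hne : S.Nonempty
    · obtain ⟨y, hy, hAy⟩ := hA hne n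
      exact hr _ (by rw [hAy]; exact hy) _ (happ n)
    · rw [Set.not_nonempty_iff_eq_empty.1 hne, Set.empty_inter]
      exact Set.injOn_empty f
  have himm : ∀ n, MeasurableSet (f '' (S ∩ t n)) := fun n =>
    measurable_image_of_fderivWithin (hSm.inter (htm n))
      (fun x _ => (hf x).hasFDerivWithinAt) (hinj' n)
  have hsard : μ (f '' Sᶜ) = 0 :=
    addHaar_image_eq_zero_of_det_fderivWithin_eq_zero μ
      (fun x _ => (hf x).hasFDerivWithinAt) fun x hx => not_not.1 hx
  -- For almost every y all preimages are regular, and each lies in exactly one piece of the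
  -- partition. Since f is injective on pieces, the number of pieces whose image contains y is the
  -- size of the fibre.
  have hcount : ∀ᵐ y ∂μ, ∑' n, (f '' (S ∩ t n)).indicator g y = k * g y := by
    filter_upwards [hk, measure_eq_zero_iff_ae_notMem.1 hsard] with y hy hyS
    obtain ⟨hfin, hcard⟩ := hy
    have hfS : ∀ x ∈ hfin.toFinset, x ∈ S := by
      intro x hx
      by_contra hxS
      exact hyS ⟨x, hxS, by simpa using hx⟩
    have h1 : ∀ n, (f '' (S ∩ t n)).indicator g y =
        ∑ x ∈ hfin.toFinset, (t n).indicator (fun _ => g y) x := by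
      intro n
      by_cases hyn : y ∈ f '' (S ∩ t n)
      · rw [Set.indicator_of_mem hyn]
        obtain ⟨x, hx, hxy⟩ := hyn
        rw [Finset.sum_eq_single x, Set.indicator_of_mem hx.2]
        · intro z hz hzx
          refine Set.indicator_of_notMem (fun hzt => hzx ?_) _
          refine hinj' n ⟨hfS z hz, hzt⟩ hx ?_
          rw [hxy]; simpa using hz
        · intro hx'; exact absurd (by simpa using hxy) hx'
      · rw [Set.indicator_of_notMem hyn, Finset.sum_eq_zero]
        intro x hx
        refine Set.indicator_of_notMem (fun hxt => hyn ⟨x, ⟨hfS x hx, hxt⟩, by simpa using hx⟩) _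
    simp_rw [h1]
    rw [Summable.tsum_finsetSum fun _ _ => ENNReal.summable]
    have h2 : ∀ x ∈ hfin.toFinset, ∑' n, (t n).indicator (fun _ => g y) x = g y := by
      intro x hx
      obtain ⟨n, hn⟩ := Set.mem_iUnion.1 (hSt (hfS x hx))
      rw [tsum_eq_single n, Set.indicator_of_mem hn]
      intro m hm
      exact Set.indicator_of_notMem (fun hxm => Set.disjoint_left.1 (ht hm) hxm hn) _
    rw [Finset.sum_congr rfl h2, Finset.sum_const, nsmul_eq_mul,
      ← Set.ncard_eq_toFinset_card _ hfin, hcard]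
  have hcompl : ∫⁻ x in Sᶜ, ENNReal.ofReal |(f' x).det| * g (f x) ∂μ = 0 := by
    rw [setLIntegral_congr_fun (g := fun _ => 0) hSm.compl, lintegral_zero]
    intro x hx
    have : (f' x).det = 0 := not_not.1 hx
    simp [this]
  have hS' : S = ⋃ n, S ∩ t n := by rw [← Set.inter_iUnion, Set.inter_eq_left.2 hSt]
  calc ∫⁻ x, ENNReal.ofReal |(f' x).det| * g (f x) ∂μ
      = ∫⁻ x in S, ENNReal.ofReal |(f' x).det| * g (f x) ∂μ := by
        rw [← lintegral_add_compl _ hSm, hcompl, add_zero]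
    _ = ∑' n, ∫⁻ x in S ∩ t n, ENNReal.ofReal |(f' x).det| * g (f x) ∂μ := by
        conv_lhs => rw [hS']
        exact lintegral_iUnion (fun n => hSm.inter (htm n))
          (fun i j hij => (ht hij).mono Set.inter_subset_right Set.inter_subset_right) _
    _ = ∑' n, ∫⁻ y in f '' (S ∩ t n), g y ∂μ := by
        congr 1; ext1 n
        exact (lintegral_image_eq_lintegral_abs_det_fderiv_mul μ (hSm.inter (htm n))
          (fun x _ => (hf x).hasFDerivWithinAt) (hinj' n) g).symm
    _ = ∑' n, ∫⁻ y, (f '' (S ∩ t n)).indicator g y ∂μ := by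
        congr 1; ext1 n
        exact (lintegral_indicator (himm n) g).symm
    _ = ∫⁻ y, ∑' n, (f '' (S ∩ t n)).indicator g y ∂μ :=
        (lintegral_tsum fun n => (hg.indicator (himm n)).aemeasurable).symm
    _ = ∫⁻ y, k * g y ∂μ := lintegral_congr_ae hcount
    _ = k * ∫⁻ y, g y ∂μ := lintegral_const_mul _ hg

/-- The zero set of an analytic function that does not vanish identically is a null set. -/
lemma measure_zeros_of_analytic (μ : Measure E) [μ.IsAddHaarMeasure]
    {G : Type*} [NormedAddCommGroup G] [NormedSpace ℝ G] (p : E → G)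
    (hp : AnalyticOnNhd ℝ p Set.univ) (v : E) (hv : p v ≠ 0) : μ {x | p x = 0} = 0 := by
  set Z : Set E := {x | p x = 0} with hZ
  have hpc : Continuous p := continuousOn_univ.1 hp.continuousOn
  have hZm : MeasurableSet Z := (isClosed_singleton.preimage hpc).measurableSet
  -- On every line through v the function is analytic in one variable and nonzero at parameter 0, so
  -- its zeros there are isolated.
  have hline : ∀ x : E, volume {s : ℝ | v + s • x ∈ Z} = 0 := by
    intro x
    have ha : AnalyticOnNhd ℝ (fun s : ℝ => p (v + s • x)) Set.univ := by
      intro s _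
      exact AnalyticAt.fun_comp (hp _ trivial)
        (analyticAt_const.add (analyticAt_id.smul analyticAt_const))
    have h0 : (fun s : ℝ => p (v + s • x)) 0 ≠ 0 := by simpa using hv
    have h1 := ha.preimage_zero_mem_codiscrete h0
    have h2 := ae_restrict_le_codiscreteWithin (μ := (volume : Measure ℝ)) MeasurableSet.univ h1
    rw [Measure.restrict_univ, mem_ae_iff] at h2
    convert h2 using 2
    ext s
    simp [hZ]
  have hmeas : MeasurableSet {q : ℝ × E | v + q.1 • q.2 ∈ Z} :=
    hZm.preimage (by fun_prop)
  have hprod : ((volume : Measure ℝ).prod μ) {q : ℝ × E | v + q.1 • q.2 ∈ Z} = 0 := by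
    rw [Measure.prod_apply_symm hmeas]
    exact (lintegral_congr fun x => hline x).trans lintegral_zero
  have hae := (ae_iff.1 (Measure.measure_ae_null_of_prod_null hprod))
  -- By Fubini almost every slice at a fixed parameter s is null. A single s ≠ 0 is enough, since
  -- that slice is the zero set translated and rescaled.
  obtain ⟨s, hs⟩ : ∃ s : ℝ, s ≠ 0 ∧ μ {x | v + s • x ∈ Z} = 0 := by
    by_contra! hcon
    have hsub : Set.Ioo (0 : ℝ) 1 ⊆
        {s : ℝ | ¬ μ (Prod.mk s ⁻¹' {q : ℝ × E | v + q.1 • q.2 ∈ Z}) = (0 : ℝ → ℝ≥0∞) s} :=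
      fun s hs => hcon s hs.1.ne'
    have := measure_mono_null hsub hae
    simp at this
  have h3 : {x | v + s • x ∈ Z} = (s • ·) ⁻¹' ((v + ·) ⁻¹' Z) := rfl
  rw [h3, Measure.addHaar_preimage_smul μ hs.1, measure_preimage_add] at hs
  refine (mul_eq_zero.1 hs.2).resolve_left ?_
  rw [ENNReal.ofReal_eq_zero, not_le, abs_pos]
  exact inv_ne_zero (pow_ne_zero _ hs.1)

/-- Polar coordinates for radial functions. -/
lemma exists_lintegral_norm [Nontrivial E] (μ : Measure E) [μ.IsAddHaarMeasure] :
    ∃ C : ℝ≥0∞, C ≠ 0 ∧ C ≠ ⊤ ∧ ∀ f : ℝ → ℝ≥0∞, Measurable f →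
      ∫⁻ x, f ‖x‖ ∂μ =
        C * ∫⁻ r in Set.Ioi (0 : ℝ), ENNReal.ofReal (r ^ (Module.finrank ℝ E - 1)) * f r := by
  refine ⟨μ.toSphere Set.univ, ?_, measure_ne_top _ _, fun f hf => ?_⟩
  · rw [Measure.measure_univ_ne_zero]
    exact Measure.toSphere_ne_zero μ
  have hf' : Measurable fun r : Set.Ioi (0 : ℝ) => f r := hf.comp measurable_subtype_coe
  calc ∫⁻ x, f ‖x‖ ∂μ = ∫⁻ x : ({(0 : E)}ᶜ : Set E), f ‖x.1‖ ∂(μ.comap (↑)) := by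
        rw [lintegral_subtype_comap (measurableSet_singleton _).compl fun x : E => f ‖x‖,
          restrict_compl_singleton]
    _ = ∫⁻ x, f x.2 ∂μ.toSphere.prod (.volumeIoiPow (Module.finrank ℝ E - 1)) := by
        simpa using (μ.measurePreserving_homeomorphUnitSphereProd).lintegral_comp_emb
          (Homeomorph.measurableEmbedding _) (f ∘ Subtype.val ∘ Prod.snd)
    _ = μ.toSphere Set.univ *
          ∫⁻ r : Set.Ioi (0 : ℝ), f r ∂.volumeIoiPow (Module.finrank ℝ E - 1) := by
        rw [lintegral_prod _ (by fun_prop)]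
        simp [mul_comm]
    _ = _ := by
        rw [Measure.volumeIoiPow, lintegral_withDensity_eq_lintegral_mul _ (by fun_prop) hf',
          ← lintegral_subtype_comap measurableSet_Ioi]
        rfl

end Haar

/-! ### The measure on the quaternions -/

instance : MeasurableSpace ℍ[ℝ] := borel _

instance : BorelSpace ℍ[ℝ] := ⟨rfl⟩

instance : MeasureSpace ℍ[ℝ] := ⟨Measure.addHaar⟩

instance : (volume : Measure ℍ[ℝ]).IsAddHaarMeasure :=
  inferInstanceAs (Measure.addHaar (G := ℍ[ℝ])).IsAddHaarMeasure

lemma measurable_lam : Measurable lam := by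
  have : Continuous lam := by
    have h1 : Continuous fun q : ℍ[ℝ] => Complex.equivRealProdCLM.symm
        (q.re, Real.sqrt (q.imI ^ 2 + q.imJ ^ 2 + q.imK ^ 2)) := by
      have := Quaternion.continuous_re
      have := Quaternion.continuous_imI
      have := Quaternion.continuous_imJ
      have := Quaternion.continuous_imK
      fun_prop
    exact h1
  exact this.measurable

instance {E F : Type*} [NormedAddCommGroup E] [NormedSpace ℝ E] [FiniteDimensional ℝ E]
    [MeasureSpace E] [BorelSpace E] [NormedAddCommGroup F] [NormedSpace ℝ F]
    [FiniteDimensional ℝ F] [MeasureSpace F] [BorelSpace F]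
    [(volume : Measure E).IsAddHaarMeasure] [(volume : Measure F).IsAddHaarMeasure] :
    (volume : Measure (E × F)).IsAddHaarMeasure :=
  inferInstanceAs ((volume : Measure E).prod (volume : Measure F)).IsAddHaarMeasure

/-- The coordinates of a quaternion, as real part and imaginary vector. -/
def quatReIm : ℍ[ℝ] ≃ₗ[ℝ] ℝ × EuclideanSpace ℝ (Fin 3) where
  toFun q := (q.re, !₂[q.imI, q.imJ, q.imK])
  map_add' p q := by ext i <;> [skip; fin_cases i] <;> simp
  map_smul' r q := by ext i <;> [skip; fin_cases i] <;> simp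
  invFun x := quat x.1 (x.2 0) (x.2 1) (x.2 2)
  left_inv q := by simp [quat]; rfl
  right_inv x := by ext i <;> [skip; fin_cases i] <;> simp [quat]

lemma lam_eq_quatReIm (q : ℍ[ℝ]) : lam q = ⟨(quatReIm q).1, ‖(quatReIm q).2‖⟩ := by
  simp [lam, quatReIm, EuclideanSpace.norm_eq, Fin.sum_univ_three]

/-- Integration of a function of the conjugacy class of a quaternion. -/
lemma exists_lintegral_lam : ∃ C : ℝ≥0∞, C ≠ 0 ∧ C ≠ ⊤ ∧ ∀ f : ℂ → ℝ≥0∞, Measurable f →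
    ∫⁻ q : ℍ[ℝ], f (lam q) =
      C * ∫⁻ z in {z : ℂ | 0 < z.im}, ENNReal.ofReal (z.im ^ 2) * f z := by
  obtain ⟨C₁, h1, h1', H1⟩ := exists_lintegral_comp_linearEquiv (volume : Measure ℍ[ℝ])
    (volume : Measure (ℝ × EuclideanSpace ℝ (Fin 3))) quatReIm
  obtain ⟨C₂, h2, h2', H2⟩ := exists_lintegral_norm (volume : Measure (EuclideanSpace ℝ (Fin 3)))
  refine ⟨C₁ * C₂, mul_ne_zero h1 h2, ENNReal.mul_ne_top h1' h2', fun f hf => ?_⟩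
  have hf2 : Measurable fun p : ℝ × ℝ => f ⟨p.1, p.2⟩ :=
    hf.comp Complex.measurableEquivRealProd.symm.measurable
  simp_rw [lam_eq_quatReIm]
  rw [H1 fun x => f ⟨x.1, ‖x.2‖⟩, mul_assoc]
  congr 1
  have hf3 : Measurable fun y : ℝ × EuclideanSpace ℝ (Fin 3) => f ⟨y.1, ‖y.2‖⟩ :=
    hf2.comp (measurable_fst.prodMk measurable_snd.norm)
  rw [Measure.volume_eq_prod, lintegral_prod _ hf3.aemeasurable]
  -- The imaginary part of a quaternion is a vector in dimension three, so its length has density r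
  -- ^ (3 - 1).
  have h3 : ∀ x : ℝ, ∫⁻ y : EuclideanSpace ℝ (Fin 3), f ⟨x, ‖y‖⟩ =
      C₂ * ∫⁻ r in Set.Ioi (0 : ℝ), ENNReal.ofReal (r ^ 2) * f ⟨x, r⟩ := by
    intro x
    rw [H2 (fun r => f ⟨x, r⟩) (hf2.comp (measurable_const.prodMk measurable_id))]
    simp
  simp_rw [h3]
  have hm : Measurable fun p : ℝ × ℝ => ENNReal.ofReal (p.2 ^ 2) * f ⟨p.1, p.2⟩ :=
    (by fun_prop : Measurable fun p : ℝ × ℝ => ENNReal.ofReal (p.2 ^ 2)).mul hf2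
  rw [lintegral_const_mul _ hm.lintegral_prod_right']
  congr 1
  have hset : {z : ℂ | 0 < z.im} =
      Complex.measurableEquivRealProd ⁻¹' (Set.univ ×ˢ Set.Ioi 0) := by
    ext z; simp [Complex.measurableEquivRealProd_apply]
  rw [hset, ← (Complex.volume_preserving_equiv_real_prod.symm _).setLIntegral_comp_preimage_emb
    (MeasurableEquiv.measurableEmbedding _), ← Set.preimage_comp]
  simp only [MeasurableEquiv.self_comp_symm, Set.preimage_id]
  rw [Measure.volume_eq_prod, ← Measure.prod_restrict, Measure.restrict_univ,
    lintegral_prod _ (by exact hm.aemeasurable)]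
  rfl

end

section

/-! ## Block matrices -/

variable {n : Type*}

/-- A quaternion matrix with a distinguished first row and column. -/
def block (a : ℍ[ℝ]) (b c : n → ℍ[ℝ]) (d : Matrix n n ℍ[ℝ]) :
    Matrix (Unit ⊕ n) (Unit ⊕ n) ℍ[ℝ] :=
  Matrix.fromBlocks (Matrix.of fun _ _ => a) (Matrix.replicateRow Unit b)
    (Matrix.replicateCol Unit c) d

lemma crep_fromBlocks {l m o p : Type*} (A : Matrix l o ℍ[ℝ]) (B : Matrix l p ℍ[ℝ])
    (C : Matrix m o ℍ[ℝ]) (D : Matrix m p ℍ[ℝ]) :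
    crep (Matrix.fromBlocks A B C D) =
      (Matrix.fromBlocks (crep A) (crep B) (crep C) (crep D)).submatrix
        (Equiv.sumProdDistrib l m (Fin 2)) (Equiv.sumProdDistrib o p (Fin 2)) := by
  ext ⟨i, a⟩ ⟨j, b⟩
  rcases i with i | i <;> rcases j with j | j <;> rfl

variable [Fintype n] [DecidableEq n]

lemma crep_unit (q : ℍ[ℝ]) : crep (Matrix.of fun _ _ : Unit => q) =
    (quatBlock q).submatrix (Equiv.punitProd (Fin 2)) (Equiv.punitProd (Fin 2)) := by
  ext ⟨i, a⟩ ⟨j, b⟩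
  rfl

lemma det_quatBlock (q : ℍ[ℝ]) : (quatBlock q).det = ((‖q‖ ^ 2 : ℝ) : ℂ) := by
  have : ‖q‖ ^ 2 = q.re ^ 2 + q.imI ^ 2 + q.imJ ^ 2 + q.imK ^ 2 := by
    rw [sq, ← Quaternion.normSq_eq_norm_mul_self, Quaternion.normSq_def']
  rw [this, Matrix.det_fin_two]
  simp [quatBlock, Complex.ext_iff, sq]
  constructor <;> ring

/-- The characteristic polynomial of the block of a quaternion. -/
def quatCharpoly (q : ℍ[ℝ]) : Polynomial ℂ :=
  (Polynomial.X - Polynomial.C (lam q)) * (Polynomial.X - Polynomial.C (conj (lam q)))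

/-- The block of q has trace 2 re q and determinant ‖q‖², which are the sum and the product of `lam
q` and its conjugate. -/
lemma charpoly_crep_unit (q : ℍ[ℝ]) :
    (crep (Matrix.of fun _ _ : Unit => q)).charpoly = quatCharpoly q := by
  have h1 : (crep (Matrix.of fun _ _ : Unit => q)) =
      Matrix.reindex (Equiv.punitProd (Fin 2)).symm (Equiv.punitProd (Fin 2)).symm
        (quatBlock q) := crep_unit q
  have h2 : lam q + conj (lam q) = (quatBlock q).trace := by
    simp [Matrix.trace_fin_two, quatBlock, Complex.ext_iff, lam]
  have h3 : lam q * conj (lam q) = (quatBlock q).det := by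
    rw [det_quatBlock, Complex.mul_conj, Complex.normSq_eq_norm_sq, norm_lam]
  rw [h1, Matrix.charpoly_reindex, Matrix.charpoly_fin_two, ← h2, ← h3, quatCharpoly]
  simp only [map_add, map_mul]
  ring

lemma charpoly_crep_block_zero (q : ℍ[ℝ]) (b : n → ℍ[ℝ]) (G : Matrix n n ℍ[ℝ]) :
    (crep (block q b 0 G)).charpoly = quatCharpoly q * (crep G).charpoly := by
  have h0 : crep (Matrix.replicateCol Unit (0 : n → ℍ[ℝ])) = 0 := crep_zero
  have : crep (block q b 0 G) = Matrix.reindex (Equiv.sumProdDistrib Unit n (Fin 2)).symm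
      (Equiv.sumProdDistrib Unit n (Fin 2)).symm
        (Matrix.fromBlocks (crep (Matrix.of fun _ _ : Unit => q)) (crep (Matrix.replicateRow Unit b))
          0 (crep G)) := by
    rw [block, crep_fromBlocks, h0]; rfl
  rw [this, Matrix.charpoly_reindex, Matrix.charpoly_fromBlocks_zero₂₁, charpoly_crep_unit]

lemma det_crep_block_zero (q : ℍ[ℝ]) (b : n → ℍ[ℝ]) (G : Matrix n n ℍ[ℝ]) :
    (crep (block q b 0 G)).det = ((‖q‖ ^ 2 : ℝ) : ℂ) * (crep G).det := by
  have h0 : crep (Matrix.replicateCol Unit (0 : n → ℍ[ℝ])) = 0 := crep_zero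
  rw [block, crep_fromBlocks, h0, Matrix.det_submatrix_equiv_self,
    Matrix.det_fromBlocks_zero₂₁, crep_unit, Matrix.det_submatrix_equiv_self, det_quatBlock]

/-! ### The weight -/

/-- The matrix weight in terms of the complex representative. -/
def wt (L s : ℝ) (A : Matrix n n ℍ[ℝ]) : ℝ :=
  ‖(crep A).det‖ ^ (2 * L) / ‖(1 + crep A * (crep A)ᴴ).det‖ ^ s

lemma posDef_one_add_mul_conjTranspose {m : Type*} [Fintype m] [DecidableEq m]
    (A : Matrix m m ℂ) : (1 + A * Aᴴ).PosDef :=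
  Matrix.PosDef.one.add_posSemidef (Matrix.posSemidef_self_mul_conjTranspose A)

lemma det_one_add_mul_conjTranspose_ne_zero {m : Type*} [Fintype m] [DecidableEq m]
    (A : Matrix m m ℂ) : (1 + A * Aᴴ).det ≠ 0 :=
  (posDef_one_add_mul_conjTranspose A).det_pos.ne'

lemma wt_nonneg (L s : ℝ) (A : Matrix n n ℍ[ℝ]) : 0 ≤ wt L s A := by
  unfold wt; positivity

lemma matrixWeight_eq_wt (N : ℕ) (n L : ℝ) (G : Matrix (Fin N) (Fin N) ℍ[ℝ]) :
    matrixWeight N n L G = wt L (n + N + L) G := by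
  have h1 : (complexRep (G * Gᴴ)).det.re = ‖(crep G).det‖ ^ 2 := by
    rw [complexRep_eq_crep, crep_mul, crep_conjTranspose, Matrix.det_mul,
      Matrix.det_conjTranspose, Complex.star_def, Complex.mul_conj, Complex.normSq_eq_norm_sq,
      Complex.ofReal_re]
  have h2 : (complexRep (1 + G * Gᴴ)).det.re = ‖(1 + crep G * (crep G)ᴴ).det‖ := by
    rw [complexRep_eq_crep, crep_add, crep_mul, crep_conjTranspose, crep_one]
    have := (posDef_one_add_mul_conjTranspose (crep G)).det_pos
    exact (Complex.re_eq_norm.2 this.le)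
  rw [matrixWeight, qdet, qdet, h1, h2, Real.sqrt_sq (norm_nonneg _), wt, Real.sqrt_eq_rpow,
    ← Real.rpow_mul (norm_nonneg _)]
  congr 2
  ring

/-- If `X = V X' V⁻¹` then the weight of `X` is found from `V⁻¹ V⁻¹ᴴ` and `X'`. -/
lemma wt_conj_congr (L s : ℝ) (S S' R R' T : Matrix n n ℍ[ℝ]) (hS : S * S' = 1)
    (hR : R * R' = 1) (h : S' * S'ᴴ = R' * R'ᴴ) :
    wt L s (S * T * S') = wt L s (R * T * R') := by
  -- With X = S T S' and P = S' S'†, one has 1 + X X† = S (P + T P T†) S†. Hence S' enters only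
  -- through its Gram matrix P, apart from |det (S S†)| = 1 / |det P|.
  have key : ∀ S S' : Matrix n n ℍ[ℝ], S * S' = 1 →
      ‖(1 + crep (S * T * S') * (crep (S * T * S'))ᴴ).det‖ = ‖(crep (S * Sᴴ)).det‖ *
        ‖(crep (S' * S'ᴴ + T * (S' * S'ᴴ) * Tᴴ)).det‖ := by
    intro S S' h
    have h1 : 1 + crep (S * T * S') * (crep (S * T * S'))ᴴ =
        crep S * crep (S' * S'ᴴ + T * (S' * S'ᴴ) * Tᴴ) * (crep S)ᴴ := by
      rw [← crep_conjTranspose, ← crep_conjTranspose, ← crep_mul, ← crep_mul, ← crep_mul,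
        ← crep_one, ← crep_add]
      congr 1
      have h2 : S'ᴴ * Sᴴ = 1 := by rw [← Matrix.conjTranspose_mul, h, Matrix.conjTranspose_one]
      rw [Matrix.mul_add, Matrix.add_mul]
      congr 1
      · rw [← Matrix.mul_assoc, h, Matrix.one_mul, h2]
      · simp only [Matrix.conjTranspose_mul, Matrix.mul_assoc]
    rw [h1, Matrix.det_mul, Matrix.det_mul, crep_mul, Matrix.det_mul, crep_conjTranspose]
    simp only [norm_mul]; ring
  have hdet : ∀ S S' : Matrix n n ℍ[ℝ], S * S' = 1 →
      ‖(crep (S * Sᴴ)).det‖ * ‖(crep (S' * S'ᴴ)).det‖ = 1 ∧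
      (crep (S * T * S')).det = (crep T).det := by
    intro S S' h
    have h3 : (crep S).det * (crep S').det = 1 := by
      rw [← Matrix.det_mul, ← crep_mul, h, crep_one, Matrix.det_one]
    constructor
    · have h4 : ‖(crep S).det‖ * ‖(crep S').det‖ = 1 := by rw [← norm_mul, h3, norm_one]
      simp only [crep_mul, crep_conjTranspose, Matrix.det_mul, Matrix.det_conjTranspose, norm_mul,
        norm_star]
      linear_combination (‖(crep S).det‖ * ‖(crep S').det‖ + 1) * h4
    · rw [crep_mul, crep_mul, Matrix.det_mul, Matrix.det_mul]
      linear_combination (crep T).det * h3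
  have h5 : ‖(crep (S * Sᴴ)).det‖ = ‖(crep (R * Rᴴ)).det‖ := by
    have e1 := (hdet S S' hS).1
    have e2 := (hdet R R' hR).1
    rw [← h] at e2
    have : ‖(crep (S' * S'ᴴ)).det‖ ≠ 0 := fun h0 => by simp [h0] at e1
    exact mul_right_cancel₀ this (e1.trans e2.symm)
  rw [wt, wt, key S S' hS, key R R' hR, h, h5, (hdet S S' hS).2, (hdet R R' hR).2]

/-! ### Reduction of a matrix with a given eigenvector -/

/-- The unipotent matrix with first column `(1, u)`. -/
def shear (u : n → ℍ[ℝ]) : Matrix (Unit ⊕ n) (Unit ⊕ n) ℍ[ℝ] := block 1 0 u 1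

lemma of_const_one : (Matrix.of fun _ _ : Unit => (1 : ℍ[ℝ])) = 1 :=
  Matrix.ext fun i j => by simp

lemma shear_mul_shear_neg (u : n → ℍ[ℝ]) : shear u * shear (-u) = 1 := by
  simp only [shear, block, of_const_one, Matrix.fromBlocks_multiply]
  have h0 : Matrix.replicateRow Unit (0 : n → ℍ[ℝ]) = 0 := rfl
  have hneg : Matrix.replicateCol Unit (-u) = - Matrix.replicateCol Unit u := rfl
  simp [h0, hneg]

/-- Conjugating a block upper triangular matrix by a shear. -/
lemma shear_conj (q : ℍ[ℝ]) (b u : n → ℍ[ℝ]) (G : Matrix n n ℍ[ℝ]) :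
    shear u * block q b 0 G * shear (-u) =
      block (q - b ⬝ᵥ u) b (fun i => u i * (q - b ⬝ᵥ u) - (G *ᵥ u) i)
        (Matrix.vecMulVec u b + G) := by
  simp only [shear, block, of_const_one, Matrix.fromBlocks_multiply]
  have h0 : Matrix.replicateRow Unit (0 : n → ℍ[ℝ]) = 0 := rfl
  have h0' : Matrix.replicateCol Unit (0 : n → ℍ[ℝ]) = 0 := rfl
  have hneg : Matrix.replicateCol Unit (-u) = - Matrix.replicateCol Unit u := rfl
  have h1 : Matrix.replicateRow Unit b * Matrix.replicateCol Unit u =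
      Matrix.of fun _ _ => b ⬝ᵥ u := rfl
  have h2 : Matrix.replicateCol Unit u * Matrix.replicateRow Unit b = Matrix.vecMulVec u b :=
    Matrix.ext fun i j => by simp [Matrix.mul_apply, Matrix.vecMulVec]
  have h3 : ∀ a : ℍ[ℝ], (Matrix.replicateCol Unit u * Matrix.of fun _ _ : Unit => a) =
      Matrix.replicateCol Unit fun i => u i * a := fun a =>
    Matrix.ext fun i j => by
      change ∑ k : Unit, u i * a = u i * a
      simp
  have h4 : G * Matrix.replicateCol Unit u = Matrix.replicateCol Unit (G *ᵥ u) := rfl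
  simp only [h0, h0', hneg, Matrix.one_mul, Matrix.mul_one, Matrix.zero_mul, Matrix.mul_zero,
    add_zero, zero_add, Matrix.mul_neg, Matrix.add_mul]
  rw [Matrix.mul_assoc (Matrix.replicateCol Unit u), h1, h2, h3, h3, h4]
  congr 1
  exact Matrix.ext fun i j => by
    simp only [Matrix.add_apply, Matrix.neg_apply, Matrix.replicateCol_apply, mul_sub]; abel

/-- The shear is a similarity to the block triangular matrix, so q contributes its pair of
eigenvalues and G the remaining ones. -/
lemma charpoly_crep_shear_conj (q : ℍ[ℝ]) (b u : n → ℍ[ℝ]) (G : Matrix n n ℍ[ℝ]) :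
    (crep (block (q - b ⬝ᵥ u) b (fun i => u i * (q - b ⬝ᵥ u) - (G *ᵥ u) i)
        (Matrix.vecMulVec u b + G))).charpoly = quatCharpoly q * (crep G).charpoly := by
  rw [← charpoly_crep_block_zero q b G, ← shear_conj, crep_mul, crep_mul]
  have h1 : crep (shear u) * crep (shear (-u)) = 1 := by
    rw [← crep_mul, shear_mul_shear_neg, crep_one]
  have h2 : crep (shear (-u)) * crep (shear u) = 1 := mul_eq_one_comm.1 h1
  rw [Matrix.charpoly_mul_comm, ← Matrix.mul_assoc, h2, Matrix.one_mul]

lemma conjTranspose_real_smul {l m : Type*} (r : ℝ) (A : Matrix l m ℍ[ℝ]) :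
    (r • A)ᴴ = r • Aᴴ :=
  Matrix.ext fun i j => by simp

/-! ### The square root of 1 + u u† and the triangular form of the weight -/

section Triangular

variable (u : n → ℍ[ℝ])

/-- The length of the vector `(1, u)`. -/
def rho : ℝ := Real.sqrt (1 + ∑ i, ‖u i‖ ^ 2)

lemma rho_sq : rho u ^ 2 = 1 + ∑ i, ‖u i‖ ^ 2 := Real.sq_sqrt (by positivity)

lemma one_le_rho : 1 ≤ rho u := by
  rw [rho, Real.one_le_sqrt]
  have : 0 ≤ ∑ i, ‖u i‖ ^ 2 := by positivity
  linarith

lemma rho_pos : 0 < rho u := zero_lt_one.trans_le (one_le_rho u)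

/-- The projection `u u†`, not normalised. -/
def outer : Matrix n n ℍ[ℝ] := Matrix.replicateCol Unit u * (Matrix.replicateCol Unit u)ᴴ

/-- The square root of `1 + u u†`. -/
def sqrtOuter : Matrix n n ℍ[ℝ] := 1 + (1 + rho u)⁻¹ • outer u

/-- The inverse square root of `1 + u u†`. -/
def invSqrtOuter : Matrix n n ℍ[ℝ] := 1 - (rho u * (1 + rho u))⁻¹ • outer u

lemma conjTranspose_mul_self_replicateCol :
    (Matrix.replicateCol Unit u)ᴴ * Matrix.replicateCol Unit u =
      (rho u ^ 2 - 1) • (1 : Matrix Unit Unit ℍ[ℝ]) := by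
  refine Matrix.ext fun i j => ?_
  have h1 : ∀ q : ℍ[ℝ], star q * q = ((‖q‖ ^ 2 : ℝ) : ℍ[ℝ]) := fun q => by
    rw [Quaternion.star_mul_self, Quaternion.normSq_eq_norm_mul_self, sq]
  have h2 : ∀ r : ℝ, r • (1 : ℍ[ℝ]) = (r : ℍ[ℝ]) := fun r => by
    rw [← Quaternion.coe_mul_eq_smul, mul_one]
  rw [rho_sq]
  simp only [Matrix.mul_apply, Matrix.conjTranspose_apply, Matrix.replicateCol_apply, h1,
    Matrix.smul_apply, Matrix.one_apply, Subsingleton.elim i j, if_true, h2,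
    add_sub_cancel_left]
  exact (map_sum (algebraMap ℝ ℍ[ℝ]) _ _).symm

lemma outer_mul_replicateCol :
    outer u * Matrix.replicateCol Unit u = (rho u ^ 2 - 1) • Matrix.replicateCol Unit u := by
  rw [outer, Matrix.mul_assoc, conjTranspose_mul_self_replicateCol, Matrix.mul_smul, Matrix.mul_one]

lemma outer_mul_outer : outer u * outer u = (rho u ^ 2 - 1) • outer u := by
  conv_lhs => rw [outer, ← Matrix.mul_assoc, ← outer, outer_mul_replicateCol, Matrix.smul_mul]
  rfl

lemma outer_conjTranspose : (outer u)ᴴ = outer u := by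
  rw [outer, Matrix.conjTranspose_mul, Matrix.conjTranspose_conjTranspose]

lemma sqrtOuter_conjTranspose : (sqrtOuter u)ᴴ = sqrtOuter u := by
  rw [sqrtOuter, Matrix.conjTranspose_add, Matrix.conjTranspose_one, conjTranspose_real_smul,
    outer_conjTranspose]

/-- As u u† squares to (ρ² - 1) u u†, the matrices 1 + s u u† are closed under multiplication. Both
the square root and its inverse are found by solving for s. -/
lemma add_smul_outer_mul (s t : ℝ) : (1 + s • outer u) * (1 + t • outer u) =
    1 + (s + t + s * t * (rho u ^ 2 - 1)) • outer u := by
  simp only [Matrix.add_mul, Matrix.mul_add, Matrix.one_mul, Matrix.mul_one, Matrix.smul_mul,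
    Matrix.mul_smul, outer_mul_outer]
  module

lemma sqrtOuter_mul_sqrtOuter : sqrtOuter u * sqrtOuter u = 1 + outer u := by
  have := rho_pos u
  rw [sqrtOuter, add_smul_outer_mul]
  conv_rhs => rw [← one_smul ℝ (outer u)]
  congr 2
  field_simp
  ring

lemma invSqrtOuter_mul_sqrtOuter : invSqrtOuter u * sqrtOuter u = 1 := by
  have := rho_pos u
  rw [invSqrtOuter, sub_eq_add_neg, ← neg_smul, sqrtOuter, add_smul_outer_mul]
  have h0 : -(rho u * (1 + rho u))⁻¹ + (1 + rho u)⁻¹ +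
      -(rho u * (1 + rho u))⁻¹ * (1 + rho u)⁻¹ * (rho u ^ 2 - 1) = 0 := by
    field_simp
    ring
  rw [h0, zero_smul, add_zero]

lemma sqrtOuter_mul_invSqrtOuter : sqrtOuter u * invSqrtOuter u = 1 := by
  have := rho_pos u
  rw [invSqrtOuter, sub_eq_add_neg, ← neg_smul, sqrtOuter, add_smul_outer_mul]
  have h0 : (1 + rho u)⁻¹ + -(rho u * (1 + rho u))⁻¹ +
      (1 + rho u)⁻¹ * -(rho u * (1 + rho u))⁻¹ * (rho u ^ 2 - 1) = 0 := by
    field_simp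
    ring
  rw [h0, zero_smul, add_zero]

lemma sqrtOuter_mul_replicateCol :
    sqrtOuter u * Matrix.replicateCol Unit u = rho u • Matrix.replicateCol Unit u := by
  have := rho_pos u
  rw [sqrtOuter, Matrix.add_mul, Matrix.one_mul, Matrix.smul_mul, outer_mul_replicateCol,
    smul_smul]
  nth_rewrite 1 [← one_smul ℝ (Matrix.replicateCol Unit u)]
  rw [← add_smul]
  congr 1
  field_simp
  ring

/-- By det (1 + A B) = det (1 + B A) the determinant reduces to that of a scalar on the
two-dimensional space of one quaternion; the scalar is 1 + (ρ² - 1) / (1 + ρ) = ρ. -/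
lemma norm_det_sqrtOuter : ‖(crep (sqrtOuter u)).det‖ = rho u ^ 2 := by
  have hr := rho_pos u
  have h1 : crep (sqrtOuter u) = 1 + ((1 + rho u)⁻¹ • crep (Matrix.replicateCol Unit u)) *
      (crep (Matrix.replicateCol Unit u))ᴴ := by
    rw [sqrtOuter, outer, crep_add, crep_one, crep_smul, crep_mul, crep_conjTranspose,
      Matrix.smul_mul]
  have h2 : (1 + (crep (Matrix.replicateCol Unit u))ᴴ *
      ((1 + rho u)⁻¹ • crep (Matrix.replicateCol Unit u))) =
      (rho u : ℂ) • (1 : Matrix (Unit × Fin 2) (Unit × Fin 2) ℂ) := by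
    rw [Matrix.mul_smul, ← crep_conjTranspose, ← crep_mul, conjTranspose_mul_self_replicateCol,
      crep_smul, crep_one, smul_smul]
    have h3 : (1 + rho u)⁻¹ * (rho u ^ 2 - 1) = rho u - 1 := by field_simp; ring
    rw [h3, sub_smul, one_smul, add_sub_cancel]
    ext i j
    simp
  rw [h1, Matrix.det_one_add_mul_comm, h2, Matrix.det_smul, Matrix.det_one, mul_one, norm_pow]
  simp [abs_of_pos hr]

/-- The weight of a matrix with eigenvector `(1, u)`, in block triangular form. -/
lemma wt_shear_conj (L s : ℝ) (q : ℍ[ℝ]) (G : Matrix n n ℍ[ℝ]) :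
    ∃ v : n → ℍ[ℝ], ∀ b : n → ℍ[ℝ],
      wt L s (block (q - b ⬝ᵥ u) b (fun i => u i * (q - b ⬝ᵥ u) - (G *ᵥ u) i)
        (Matrix.vecMulVec u b + G)) =
      wt L s (block q (b ᵥ* (rho u • sqrtOuter u) + v) 0
        (invSqrtOuter u * G * sqrtOuter u)) := by
  have hr := rho_pos u
  have hr0 := hr.ne'
  set c := Matrix.replicateCol Unit u with hc
  set K := sqrtOuter u with hK
  set K' := invSqrtOuter u with hK'
  let q₁ : Matrix Unit Unit ℍ[ℝ] := Matrix.of fun _ _ => q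
  -- The part of the off-diagonal row of R T R' that does not involve b. In the integral over b it
  -- is a mere translation.
  let V : Matrix Unit n ℍ[ℝ] := (rho u)⁻¹ • (cᴴ * G * K) - (rho u)⁻¹ • (q₁ * cᴴ * K)
  refine ⟨fun i => V () i, fun b => ?_⟩
  -- R' is the block upper triangular matrix with the same Gram matrix as `shear (-u)`, so
  -- `wt_conj_congr` allows the exchange, and R T R' stays block upper triangular.
  let R : Matrix (Unit ⊕ n) (Unit ⊕ n) ℍ[ℝ] :=
    Matrix.fromBlocks (rho u • 1) ((rho u)⁻¹ • cᴴ) 0 K'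
  let R' : Matrix (Unit ⊕ n) (Unit ⊕ n) ℍ[ℝ] :=
    Matrix.fromBlocks ((rho u)⁻¹ • 1) (-((rho u)⁻¹ ^ 2 • (cᴴ * K))) 0 K
  have hcK : cᴴ * K = rho u • cᴴ := by
    have := congrArg Matrix.conjTranspose (sqrtOuter_mul_replicateCol u)
    rwa [Matrix.conjTranspose_mul, sqrtOuter_conjTranspose, conjTranspose_real_smul] at this
  have hRR : R * R' = 1 := by
    simp only [R, R', Matrix.fromBlocks_multiply, Matrix.zero_mul, Matrix.mul_zero, add_zero,
      zero_add, Matrix.mul_neg, Matrix.smul_mul, Matrix.mul_smul, Matrix.one_mul, smul_smul,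
      hK, hK', invSqrtOuter_mul_sqrtOuter, smul_zero, neg_zero]
    rw [inv_mul_cancel₀ hr0, one_smul]
    have : (rho u)⁻¹ ^ 2 * rho u = (rho u)⁻¹ := by field_simp
    rw [this, neg_add_cancel, Matrix.fromBlocks_one]
  have hneg : shear (-u) = Matrix.fromBlocks 1 0 (-c) 1 := by
    rw [shear, block, of_const_one]; rfl
  have hgram : shear (-u) * (shear (-u))ᴴ = R' * R'ᴴ := by
    have hKt : Kᴴ = K := sqrtOuter_conjTranspose u
    rw [hneg]
    simp only [R', Matrix.fromBlocks_conjTranspose, Matrix.fromBlocks_multiply, Matrix.zero_mul,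
      Matrix.mul_zero, add_zero, zero_add, Matrix.conjTranspose_one, Matrix.conjTranspose_zero,
      Matrix.conjTranspose_neg, conjTranspose_real_smul, Matrix.conjTranspose_mul, hKt,
      Matrix.conjTranspose_conjTranspose, star_trivial, Matrix.mul_one, Matrix.one_mul,
      Matrix.mul_neg, Matrix.neg_mul, neg_neg, Matrix.smul_mul, Matrix.mul_smul, smul_smul]
    have e1 : cᴴ * K * (K * c) = (rho u ^ 2 * (rho u ^ 2 - 1)) • (1 : Matrix Unit Unit ℍ[ℝ]) := by
      rw [hcK, sqrtOuter_mul_replicateCol, Matrix.smul_mul, Matrix.mul_smul,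
        conjTranspose_mul_self_replicateCol, smul_smul, smul_smul]
      congr 1; ring
    have e2 : K * (K * c) = rho u ^ 2 • c := by
      rw [sqrtOuter_mul_replicateCol, Matrix.mul_smul, sqrtOuter_mul_replicateCol, smul_smul, sq]
    have e3 : cᴴ * K * K = rho u ^ 2 • cᴴ := by
      rw [hcK, Matrix.smul_mul, hcK, smul_smul, sq]
    rw [e1, e2, e3, hK, sqrtOuter_mul_sqrtOuter, smul_smul, smul_smul, smul_smul]
    congr 1
    · rw [smul_neg, neg_neg, smul_smul, ← add_smul]
      conv_lhs => rw [← one_smul ℝ (1 : Matrix Unit Unit ℍ[ℝ])]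
      congr 1
      field_simp
      ring
    · have : (rho u)⁻¹ ^ 2 * rho u ^ 2 = 1 := by field_simp
      rw [this, one_smul]
    · have : (rho u)⁻¹ ^ 2 * rho u ^ 2 = 1 := by field_simp
      rw [this, one_smul, smul_zero, zero_add]
    · rw [add_comm]; rfl
  rw [← shear_conj, wt_conj_congr L s (shear u) (shear (-u)) R R' _ (shear_mul_shear_neg u) hRR
    hgram]
  congr 1
  have h0 : Matrix.replicateCol Unit (0 : n → ℍ[ℝ]) = 0 := rfl
  simp only [block, h0, R, R', Matrix.fromBlocks_multiply, Matrix.zero_mul, Matrix.mul_zero,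
    add_zero, zero_add, Matrix.smul_mul, Matrix.mul_smul, Matrix.one_mul, Matrix.mul_one,
    smul_smul, Matrix.mul_neg, smul_zero, neg_zero]
  rw [inv_mul_cancel₀ hr0, one_smul]
  congr 1
  have hb : Matrix.replicateRow Unit (b ᵥ* (rho u • K) + fun i => V () i) =
      rho u • (Matrix.replicateRow Unit b * K) + V := by
    refine Matrix.ext fun i j => ?_
    simp [Matrix.mul_apply, Matrix.vecMul, dotProduct, Finset.smul_sum]
  rw [hb]
  simp only [V, Matrix.add_mul, Matrix.smul_mul, smul_neg, smul_smul, Matrix.mul_assoc]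
  have : rho u * (rho u)⁻¹ ^ 2 = (rho u)⁻¹ := by field_simp
  rw [mul_comm, this]
  abel

end Triangular

end

section

/-! ## Integration over the off-diagonal row -/

variable {n : Type*} [Fintype n] [DecidableEq n]

section
open scoped MatrixOrder Matrix.Norms.L2Operator

lemma exists_conjTranspose_mul_self_of_posSemidef {m : Type*} [Fintype m] [DecidableEq m]
    {A : Matrix m m ℂ} (hA : A.PosSemidef) : ∃ B : Matrix m m ℂ, A = Bᴴ * B := by
  obtain ⟨B, hB⟩ := CStarAlgebra.nonneg_iff_eq_star_mul_self.mp hA.nonneg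
  exact ⟨B, hB⟩

end

/-- Left multiplication by M is a real-linear map with nonzero determinant, hence surjective; the
columns of the right inverse are preimages of the unit vectors. -/
lemma exists_inverse_of_det_crep_ne_zero (M : Matrix n n ℍ[ℝ]) (hM : (crep M).det ≠ 0) :
    ∃ W : Matrix n n ℍ[ℝ], M * W = 1 := by
  have hdet : LinearMap.det (mulVecR M) ≠ 0 := by
    rw [det_mulVecR]
    exact pow_ne_zero _ (norm_ne_zero_iff.2 hM)
  have hsurj : Function.Surjective (mulVecR M) :=
    (LinearMap.equivOfDetNeZero _ hdet).surjective
  choose w hw using fun j => hsurj (fun i => (1 : Matrix n n ℍ[ℝ]) i j)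
  refine ⟨Matrix.of fun i j => w j i, Matrix.ext fun i j => ?_⟩
  exact congrFun (hw j) i

lemma quatBlock_coe (r : ℝ) : quatBlock (r : ℍ[ℝ]) = (r : ℂ) • (1 : Matrix (Fin 2) (Fin 2) ℂ) := by
  ext i j
  fin_cases i <;> fin_cases j <;> simp [quatBlock, Complex.ext_iff]

lemma crep_unit_coe (r : ℝ) : crep (Matrix.of fun _ _ : Unit => (r : ℍ[ℝ])) =
    (r : ℂ) • (1 : Matrix (Unit × Fin 2) (Unit × Fin 2) ℂ) := by
  ext ⟨i, a⟩ ⟨j, b⟩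
  rw [crep_unit, quatBlock_coe]
  simp [Matrix.one_apply]

lemma eq_coe_re_of_star_eq {q : ℍ[ℝ]} (h : star q = q) : q = (q.re : ℍ[ℝ]) := by
  rwa [Quaternion.star_eq_self] at h

/-- This is the Schur complement with respect to the lower right block 1 + D D†. What remains is 1 +
‖q‖² + b W b† with W = (1 + G†G)⁻¹. It is a self-dual 1 × 1 quaternion matrix, hence real, so its
complex block is scalar and its determinant is a square. Factoring W as C†C turns b W b† into a sum
of squares. -/
lemma det_one_add_crep_block (G : Matrix n n ℍ[ℝ]) :
    ∃ C : Matrix (n × Fin 2) (n × Fin 2) ℂ,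
      ‖C.det‖ ^ 2 = ‖(1 + crep G * (crep G)ᴴ).det‖⁻¹ ∧ ∀ (q : ℍ[ℝ]) (b : n → ℍ[ℝ]),
        (1 + crep (block q b 0 G) * (crep (block q b 0 G))ᴴ).det =
          (1 + crep G * (crep G)ᴴ).det *
            ((1 + ‖q‖ ^ 2 + ∑ p, ‖(C *ᵥ ccol (star b)) p‖ ^ 2 : ℝ) : ℂ) ^ 2 := by
  set D := crep G with hD
  have hdet' : (1 + Dᴴ * D).det = (1 + D * Dᴴ).det := Matrix.det_one_add_mul_comm _ _
  have hne := det_one_add_mul_conjTranspose_ne_zero D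
  have hM : crep (1 + Gᴴ * G) = 1 + Dᴴ * D := by
    rw [crep_add, crep_one, crep_mul, crep_conjTranspose]
  obtain ⟨W, hW⟩ := exists_inverse_of_det_crep_ne_zero (1 + Gᴴ * G) (by rw [hM, hdet']; exact hne)
  have hW1 : (1 + Dᴴ * D) * crep W = 1 := by rw [← hM, ← crep_mul, hW, crep_one]
  have hW2 : crep W * (1 + Dᴴ * D) = 1 := mul_eq_one_comm.1 hW1
  have hWinv : (1 + Dᴴ * D)⁻¹ = crep W := Matrix.inv_eq_right_inv hW1
  have hpos : (1 + Dᴴ * D).PosDef := by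
    simpa using posDef_one_add_mul_conjTranspose Dᴴ
  obtain ⟨C, hC⟩ := exists_conjTranspose_mul_self_of_posSemidef hpos.inv.posSemidef
  rw [hWinv] at hC
  refine ⟨C, ?_, fun q b => ?_⟩
  · have h1 := congrArg Matrix.det hW1
    rw [Matrix.det_mul, Matrix.det_one, hdet', hC, Matrix.det_mul, Matrix.det_conjTranspose] at h1
    have h2 := congrArg norm h1
    rw [norm_mul, norm_mul, norm_star, norm_one] at h2
    exact eq_inv_of_mul_eq_one_right (by rw [sq]; exact h2)
  -- the Hermitian `1 × 1` block
  set B := crep (Matrix.replicateRow Unit b) with hB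
  set A := crep (Matrix.of fun _ _ : Unit => q) with hA
  have hWstar : Wᴴ = W := by
    have h1 : (1 + Gᴴ * G)ᴴ = 1 + Gᴴ * G := by
      rw [Matrix.conjTranspose_add, Matrix.conjTranspose_one, Matrix.conjTranspose_mul,
        Matrix.conjTranspose_conjTranspose]
    have h2 : Wᴴ * (1 + Gᴴ * G) = 1 := by
      rw [← h1, ← Matrix.conjTranspose_mul, hW, Matrix.conjTranspose_one]
    calc Wᴴ = Wᴴ * ((1 + Gᴴ * G) * W) := by rw [hW, Matrix.mul_one]
      _ = W := by rw [← Matrix.mul_assoc, h2, Matrix.one_mul]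
  have hx : ∀ p, Bᴴ p ((), 0) = ccol (star b) p := by
    intro p
    rw [hB, ← crep_conjTranspose]; rfl
  have hBWB : B * crep W * Bᴴ =
      ((∑ p, ‖(C *ᵥ ccol (star b)) p‖ ^ 2 : ℝ) : ℂ) •
        (1 : Matrix (Unit × Fin 2) (Unit × Fin 2) ℂ) := by
    obtain ⟨w, hw⟩ : ∃ w : ℍ[ℝ], Matrix.replicateRow Unit b * W * (Matrix.replicateRow Unit b)ᴴ =
      Matrix.of fun _ _ : Unit => w :=
      ⟨(Matrix.replicateRow Unit b * W * (Matrix.replicateRow Unit b)ᴴ) () (),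
        Matrix.ext fun _ _ => rfl⟩
    have hwstar : star w = w := by
      have h1 : (Matrix.replicateRow Unit b * W * (Matrix.replicateRow Unit b)ᴴ)ᴴ =
          Matrix.replicateRow Unit b * W * (Matrix.replicateRow Unit b)ᴴ := by
        rw [Matrix.conjTranspose_mul, Matrix.conjTranspose_mul, Matrix.conjTranspose_conjTranspose,
          hWstar, Matrix.mul_assoc]
      rw [hw] at h1
      exact congrFun (congrFun h1 ()) ()
    have h2 : B * crep W * Bᴴ = (w.re : ℂ) • (1 : Matrix (Unit × Fin 2) (Unit × Fin 2) ℂ) := by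
      rw [hB, ← crep_conjTranspose, ← crep_mul, ← crep_mul, hw, eq_coe_re_of_star_eq hwstar,
        crep_unit_coe, Quaternion.re_coe]
    have h3 : (B * crep W * Bᴴ) ((), 0) ((), 0) =
        ((∑ p, ‖(C *ᵥ ccol (star b)) p‖ ^ 2 : ℝ) : ℂ) := by
      have h4 : B * crep W * Bᴴ = (C * Bᴴ)ᴴ * (C * Bᴴ) := by
        rw [hC, Matrix.conjTranspose_mul, Matrix.conjTranspose_conjTranspose]
        simp only [Matrix.mul_assoc]
      have h5 : ∀ p, (C * Bᴴ) p ((), 0) = (C *ᵥ ccol (star b)) p := by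
        intro p
        rw [Matrix.mul_apply, Matrix.mulVec, dotProduct]
        simp_rw [hx]
      rw [h4, Matrix.mul_apply]
      push_cast
      refine Finset.sum_congr rfl fun p _ => ?_
      rw [Matrix.conjTranspose_apply, h5, Complex.star_def, mul_comm, Complex.mul_conj,
        Complex.normSq_eq_norm_sq]
      push_cast; rfl
    rw [h2] at h3 ⊢
    have h6 : ((w.re : ℂ) • (1 : Matrix (Unit × Fin 2) (Unit × Fin 2) ℂ)) ((), 0) ((), 0) =
        (w.re : ℂ) := by simp
    rw [← h3, h6]
  have hAA : A * Aᴴ = ((‖q‖ ^ 2 : ℝ) : ℂ) • (1 : Matrix (Unit × Fin 2) (Unit × Fin 2) ℂ) := by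
    rw [hA, ← crep_conjTranspose, ← crep_mul, ← crep_unit_coe]
    congr 1
    refine Matrix.ext fun i j => ?_
    change ∑ k : Unit, q * star q = _
    simp only [Finset.univ_unique, Finset.sum_const, Finset.card_singleton, one_smul]
    rw [Quaternion.self_mul_star, Quaternion.normSq_eq_norm_mul_self, sq]
    rfl
  have h0 : crep (Matrix.replicateCol Unit (0 : n → ℍ[ℝ])) = 0 := crep_zero
  let e := Equiv.sumProdDistrib Unit n (Fin 2)
  have hT : crep (block q b 0 G) = (Matrix.fromBlocks A B 0 D).submatrix e e := by
    rw [block, crep_fromBlocks, h0]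
  have hexp : 1 + crep (block q b 0 G) * (crep (block q b 0 G))ᴴ =
      (Matrix.fromBlocks (1 + A * Aᴴ + B * Bᴴ) (B * Dᴴ) (D * Bᴴ) (1 + D * Dᴴ)).submatrix e e := by
    rw [hT, Matrix.conjTranspose_submatrix, Matrix.submatrix_mul_equiv,
      Matrix.fromBlocks_conjTranspose, Matrix.fromBlocks_multiply,
      ← Matrix.submatrix_one_equiv e, ← Matrix.fromBlocks_one]
    simp only [Matrix.conjTranspose_zero, Matrix.mul_zero, Matrix.zero_mul, zero_add]
    refine (congrFun (congrFun (Matrix.submatrix_add _ _) e) e).symm.trans ?_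
    rw [Matrix.fromBlocks_add]
    simp only [zero_add, add_assoc]
  let _ := Matrix.invertibleOfIsUnitDet (1 + D * Dᴴ) (isUnit_iff_ne_zero.2 hne)
  have hschur : 1 + A * Aᴴ + B * Bᴴ - B * Dᴴ * ⅟(1 + D * Dᴴ) * (D * Bᴴ) =
      ((1 + ‖q‖ ^ 2 + ∑ p, ‖(C *ᵥ ccol (star b)) p‖ ^ 2 : ℝ) : ℂ) •
        (1 : Matrix (Unit × Fin 2) (Unit × Fin 2) ℂ) := by
    -- Woodbury's identity, from D (1 + D†D) = (1 + D D†) D.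
    have h1 : 1 - Dᴴ * ⅟(1 + D * Dᴴ) * D = crep W := by
      have h2 : (1 - Dᴴ * ⅟(1 + D * Dᴴ) * D) * (1 + Dᴴ * D) = 1 := by
        have h3 : D * (1 + Dᴴ * D) = (1 + D * Dᴴ) * D := by
          simp only [Matrix.mul_add, Matrix.add_mul, Matrix.mul_one, Matrix.one_mul,
            Matrix.mul_assoc]
        rw [Matrix.sub_mul, Matrix.one_mul, Matrix.mul_assoc _ D, h3, Matrix.mul_assoc Dᴴ,
          ← Matrix.mul_assoc (⅟(1 + D * Dᴴ)), invOf_mul_self, Matrix.one_mul]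
        abel
      calc 1 - Dᴴ * ⅟(1 + D * Dᴴ) * D
          = (1 - Dᴴ * ⅟(1 + D * Dᴴ) * D) * ((1 + Dᴴ * D) * crep W) := by
            rw [hW1, Matrix.mul_one]
        _ = crep W := by rw [← Matrix.mul_assoc, h2, Matrix.one_mul]
    have h4 : B * Bᴴ - B * Dᴴ * ⅟(1 + D * Dᴴ) * (D * Bᴴ) = B * crep W * Bᴴ := by
      rw [← h1]
      simp only [Matrix.mul_sub, Matrix.sub_mul, Matrix.mul_one, Matrix.mul_assoc]
    rw [add_sub_assoc, h4, hBWB, hAA]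
    push_cast
    rw [add_smul, add_smul, one_smul]
  rw [hexp, Matrix.det_submatrix_equiv_self, Matrix.det_fromBlocks₂₂, hschur, Matrix.det_smul,
    Matrix.det_one, mul_one]
  rfl

lemma exists_wt_block (L s : ℝ) (G : Matrix n n ℍ[ℝ]) :
    ∃ C : Matrix (n × Fin 2) (n × Fin 2) ℂ,
      ‖C.det‖ ^ 2 = ‖(1 + crep G * (crep G)ᴴ).det‖⁻¹ ∧ ∀ (q : ℍ[ℝ]) (b : n → ℍ[ℝ]),
        wt L s (block q b 0 G) = ‖q‖ ^ (4 * L) * wt L s G *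
          (1 + ‖q‖ ^ 2 + ∑ p, ‖(C *ᵥ ccol (star b)) p‖ ^ 2) ^ (-(2 * s)) := by
  obtain ⟨C, hC, h⟩ := det_one_add_crep_block G
  refine ⟨C, hC, fun q b => ?_⟩
  have hpos : 0 < 1 + ‖q‖ ^ 2 + ∑ p, ‖(C *ᵥ ccol (star b)) p‖ ^ 2 := by positivity
  rw [wt, wt, h, det_crep_block_zero, norm_mul, norm_mul, norm_pow, Complex.norm_real,
    Complex.norm_real, Real.norm_of_nonneg hpos.le, Real.norm_of_nonneg (by positivity)]
  set X := 1 + ‖q‖ ^ 2 + ∑ p, ‖(C *ᵥ ccol (star b)) p‖ ^ 2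
  clear_value X
  rw [Real.mul_rpow (by positivity) (norm_nonneg _), Real.mul_rpow (norm_nonneg _) (by positivity),
    ← Real.rpow_natCast ‖q‖, ← Real.rpow_natCast X, ← Real.rpow_mul (norm_nonneg _),
    ← Real.rpow_mul hpos.le, Real.rpow_neg hpos.le]
  have e1 : ((2 : ℕ) : ℝ) * (2 * L) = 4 * L := by push_cast; ring
  have e2 : ((2 : ℕ) : ℝ) * s = 2 * s := by push_cast; ring
  rw [e1, e2, mul_div_mul_comm]
  ring

lemma continuous_crep_entry {m : Type*} (i : m × Fin 2) (j : m × Fin 2) :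
    Continuous fun A : m → m → ℍ[ℝ] => crep (Matrix.of A) i j := by
  have h1 : ∀ a b : Fin 2, Continuous fun q : ℍ[ℝ] => quatBlock q a b := fun a b =>
    ((quatBlockHom.toLinearMap).continuous_of_finiteDimensional).matrix_elem a b
  exact (h1 _ _).comp ((continuous_apply _).comp (continuous_apply _))

/-- The integral of a Japanese bracket over the complex coordinates is positive and finite. -/
lemma lintegral_bracket_pos_finite {m E : Type*} [Fintype m] [NormedAddCommGroup E]
    [NormedSpace ℝ E] [FiniteDimensional ℝ E] [MeasureSpace E] [BorelSpace E]
    [(volume : Measure E).IsAddHaarMeasure] (r : ℝ)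
    (hr : (Module.finrank ℝ (m → E) : ℝ) < 2 * r) :
    (∫⁻ x : m → E, ENNReal.ofReal ((1 + ∑ p, ‖x p‖ ^ 2) ^ (-r))) ≠ 0 ∧
      (∫⁻ x : m → E, ENNReal.ofReal ((1 + ∑ p, ‖x p‖ ^ 2) ^ (-r))) ≠ ⊤ := by
  have hmeas : Measurable fun x : m → E => ENNReal.ofReal ((1 + ∑ p, ‖x p‖ ^ 2) ^ (-r)) := by
    fun_prop
  have hpos : ∀ x : m → E, 0 < 1 + ∑ p, ‖x p‖ ^ 2 := fun x => by positivity
  have hr0 : 0 < r := by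
    have : (0 : ℝ) ≤ Module.finrank ℝ (m → E) := Nat.cast_nonneg _
    linarith
  constructor
  · rw [ne_eq, lintegral_eq_zero_iff hmeas]
    intro h0
    have h1 : ∀ᵐ x : m → E, False := by
      filter_upwards [h0] with x hx
      exact (ENNReal.ofReal_pos.2 (Real.rpow_pos_of_pos (hpos x) _)).ne' hx
    rw [Filter.eventually_false_iff_eq_bot, ae_eq_bot] at h1
    exact IsOpen.measure_ne_zero (volume : Measure (m → E)) isOpen_univ Set.univ_nonempty
      (by rw [h1]; rfl)
  · have h1 := integrable_rpow_neg_one_add_norm_sq (E := m → E) (μ := volume) hr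
    refine ne_top_of_le_ne_top h1.lintegral_lt_top.ne (lintegral_mono fun x => ?_)
    refine ENNReal.ofReal_le_ofReal ?_
    rw [show -(2 * r) / 2 = -r by ring]
    refine Real.rpow_le_rpow_of_nonpos (by positivity) ?_ (by linarith)
    have h2 : ‖x‖ ≤ Real.sqrt (∑ p, ‖x p‖ ^ 2) := by
      refine (pi_norm_le_iff_of_nonneg (Real.sqrt_nonneg _)).2 fun p => ?_
      refine Real.le_sqrt_of_sq_le ?_
      exact Finset.single_le_sum (f := fun p => ‖x p‖ ^ 2) (fun _ _ => by positivity)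
        (Finset.mem_univ p)
    have h3 := pow_le_pow_left₀ (norm_nonneg x) h2 2
    rw [Real.sq_sqrt (by positivity)] at h3
    linarith

/-- Integration of the weight over the off-diagonal row. -/
lemma exists_lintegral_wt_block (s : ℝ) (hs : (Fintype.card n : ℝ) < s + 1) :
    ∃ c : ℝ≥0∞, c ≠ 0 ∧ c ≠ ⊤ ∧ ∀ (L : ℝ) (q : ℍ[ℝ]) (G : Matrix n n ℍ[ℝ]),
      ∫⁻ b : n → ℍ[ℝ], ENNReal.ofReal (wt L (s + 1) (block q b 0 G)) =
        c * (ENNReal.ofReal (‖q‖ ^ (4 * L) *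
          (1 + ‖q‖ ^ 2) ^ (-(2 * (s + 1 - Fintype.card n)))) * ENNReal.ofReal (wt L s G)) := by
  obtain ⟨C₁, h1, h1', H1⟩ := exists_lintegral_comp_linearEquiv
    (volume : Measure (n → ℍ[ℝ])) (volume : Measure (n × Fin 2 → ℂ)) ((starVec n).trans ccol)
  have hfr : Module.finrank ℝ (n × Fin 2 → ℂ) = 4 * Fintype.card n := by
    rw [Module.finrank_pi_fintype]
    simp [Complex.finrank_real_complex]
    ring
  obtain ⟨h2, h2'⟩ := lintegral_bracket_pos_finite (m := n × Fin 2) (E := ℂ) (2 * (s + 1))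
    (by rw [hfr]; push_cast; linarith)
  set I := ∫⁻ x : n × Fin 2 → ℂ, ENNReal.ofReal ((1 + ∑ p, ‖x p‖ ^ 2) ^ (-(2 * (s + 1)))) with hI
  refine ⟨C₁ * I, mul_ne_zero h1 h2, ENNReal.mul_ne_top h1' h2', fun L q G => ?_⟩
  obtain ⟨C, hC, H⟩ := exists_wt_block L (s + 1) G
  simp_rw [H]
  set a : ℝ := 1 + ‖q‖ ^ 2 with ha
  have ha0 : 0 < a := by positivity
  have hDpos : 0 < ‖(1 + crep G * (crep G)ᴴ).det‖ :=
    norm_pos_iff.2 (det_one_add_mul_conjTranspose_ne_zero _)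
  have hCdet : C.det ≠ 0 := by
    intro h0
    rw [h0, norm_zero, zero_pow two_ne_zero, eq_comm, inv_eq_zero] at hC
    exact hDpos.ne' hC
  have e1 := H1 fun x => ENNReal.ofReal (‖q‖ ^ (4 * L) * wt L (s + 1) G *
    (a + ∑ p, ‖(C *ᵥ x) p‖ ^ 2) ^ (-(2 * (s + 1))))
  have e1' : ∀ b : n → ℍ[ℝ], ((starVec n).trans ccol) b = ccol (star b) := fun b => rfl
  simp_rw [e1'] at e1
  rw [e1]
  -- The substitution x ↦ C x has Jacobian ‖det C‖² = ‖det (1 + D D†)‖⁻¹. Its inverse in the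
  -- integral lowers the exponent of G in the weight from s + 1 to s.
  let A : (n × Fin 2 → ℂ) →ₗ[ℝ] (n × Fin 2 → ℂ) := (Matrix.toLin' C).restrictScalars ℝ
  have hA : LinearMap.det A = ‖C.det‖ ^ 2 := by
    rw [LinearMap.det_restrictScalars, LinearMap.det_toLin', Algebra.norm_complex_apply,
      Complex.normSq_eq_norm_sq]
  have hA0 : LinearMap.det A ≠ 0 := by
    rw [hA]; exact pow_ne_zero _ (norm_ne_zero_iff.2 hCdet)
  have e2 := lintegral_comp_linearMap (volume : Measure (n × Fin 2 → ℂ)) A hA0 fun x =>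
    ENNReal.ofReal (‖q‖ ^ (4 * L) * wt L (s + 1) G *
      (a + ∑ p, ‖x p‖ ^ 2) ^ (-(2 * (s + 1))))
  have e2' : ∀ x, A x = C *ᵥ x := fun x => rfl
  simp_rw [e2'] at e2
  rw [e2]
  -- Scaling by √a with a = 1 + ‖q‖² pulls the q-dependence out of the bracket; the Jacobian a ^ (2
  -- · card n) accounts for the shift in the exponent of 1 + ‖q‖².
  let B : (n × Fin 2 → ℂ) →ₗ[ℝ] (n × Fin 2 → ℂ) := Real.sqrt a • LinearMap.id
  have hB : LinearMap.det B = a ^ (2 * Fintype.card n) := by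
    rw [LinearMap.det_smul, LinearMap.det_id, mul_one, hfr,
      show 4 * Fintype.card n = 2 * (2 * Fintype.card n) by ring, pow_mul, Real.sq_sqrt ha0.le]
  have hB0 : LinearMap.det B ≠ 0 := by rw [hB]; positivity
  have e3 := lintegral_comp_linearMap (volume : Measure (n × Fin 2 → ℂ)) B hB0 fun x =>
    ENNReal.ofReal (‖q‖ ^ (4 * L) * wt L (s + 1) G *
      (a + ∑ p, ‖x p‖ ^ 2) ^ (-(2 * (s + 1))))
  have e4 : ∀ x : n × Fin 2 → ℂ, ENNReal.ofReal (‖q‖ ^ (4 * L) * wt L (s + 1) G *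
      (a + ∑ p, ‖(B x) p‖ ^ 2) ^ (-(2 * (s + 1)))) =
      ENNReal.ofReal (‖q‖ ^ (4 * L) * wt L (s + 1) G * a ^ (-(2 * (s + 1)))) *
        ENNReal.ofReal ((1 + ∑ p, ‖x p‖ ^ 2) ^ (-(2 * (s + 1)))) := by
    intro x
    have h5 : a + ∑ p, ‖(B x) p‖ ^ 2 = a * (1 + ∑ p, ‖x p‖ ^ 2) := by
      rw [mul_add, mul_one, Finset.mul_sum]
      congr 1
      refine Finset.sum_congr rfl fun p _ => ?_
      change ‖Real.sqrt a • x p‖ ^ 2 = _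
      rw [norm_smul, mul_pow, Real.norm_of_nonneg (Real.sqrt_nonneg _), Real.sq_sqrt ha0.le]
    have := wt_nonneg L (s + 1) G
    rw [h5, Real.mul_rpow ha0.le (by positivity), ← ENNReal.ofReal_mul (by positivity), mul_assoc]
    ring_nf
  simp_rw [e4] at e3
  rw [lintegral_const_mul _ (by fun_prop), ← hI, hB, abs_of_pos (by positivity)] at e3
  have e5 : ∫⁻ x : n × Fin 2 → ℂ, ENNReal.ofReal (‖q‖ ^ (4 * L) * wt L (s + 1) G *
      (a + ∑ p, ‖x p‖ ^ 2) ^ (-(2 * (s + 1)))) = ENNReal.ofReal (a ^ (2 * Fintype.card n)) *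
      (ENNReal.ofReal (‖q‖ ^ (4 * L) * wt L (s + 1) G * a ^ (-(2 * (s + 1)))) * I) := by
    rw [e3, ← mul_assoc, ← ENNReal.ofReal_mul (by positivity), mul_inv_cancel₀ (by positivity),
      ENNReal.ofReal_one, one_mul]
  have hw : wt L (s + 1) G = wt L s G * ‖(1 + crep G * (crep G)ᴴ).det‖⁻¹ := by
    rw [wt, wt, Real.rpow_add hDpos, Real.rpow_one]
    field_simp
  have hwn := wt_nonneg L s G
  rw [e5, hA, hC, abs_of_pos (inv_pos.2 hDpos), inv_inv, hw, mul_assoc C₁]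
  congr 1
  rw [mul_comm I, ← mul_assoc, ← mul_assoc, ← ENNReal.ofReal_mul (by positivity),
    ← ENNReal.ofReal_mul (by positivity), ← ENNReal.ofReal_mul (by positivity)]
  congr 2
  rw [show -(2 * (s + 1 - (Fintype.card n : ℝ))) =
    ((2 * Fintype.card n : ℕ) : ℝ) + -(2 * (s + 1)) by push_cast; ring,
    Real.rpow_add ha0, Real.rpow_natCast]
  field_simp

end

section

/-! ## Eigenvectors of a generic quaternion matrix -/

variable {n : Type*} [Fintype n] [DecidableEq n]

lemma lam_coeComplex_of_im_nonpos {z : ℂ} (hz : z.im ≤ 0) : lam (z : ℍ[ℝ]) = conj z := by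
  apply Complex.ext
  · rfl
  · have : Real.sqrt (z.im ^ 2) = -z.im := by rw [Real.sqrt_sq_eq_abs, abs_of_nonpos hz]
    simpa [lam] using this

/-- The quadratic map whose fibres are the normalised eigenvectors. -/
def riccati (a : ℍ[ℝ]) (b : n → ℍ[ℝ]) (d : Matrix n n ℍ[ℝ]) (u : n → ℍ[ℝ]) : n → ℍ[ℝ] :=
  fun i => u i * (a + b ⬝ᵥ u) - (d *ᵥ u) i

lemma vecMulVec_mulVec_quat (u b v : n → ℍ[ℝ]) :
    Matrix.vecMulVec u b *ᵥ v = fun i => u i * (b ⬝ᵥ v) := by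
  ext1 i
  simp only [Matrix.mulVec, dotProduct, Matrix.vecMulVec_apply, Finset.mul_sum, mul_assoc]

/-- The column `riccati a b d u` is the one for which (1, u) is an eigenvector with eigenvalue a +
b·u. The matrix is then a shear conjugate of a block triangular one, whose minor is d - u b. -/
lemma block_riccati (a : ℍ[ℝ]) (b : n → ℍ[ℝ]) (d : Matrix n n ℍ[ℝ]) (u : n → ℍ[ℝ]) :
    block a b (riccati a b d u) d =
      block ((a + b ⬝ᵥ u) - b ⬝ᵥ u) b
        (fun i => u i * ((a + b ⬝ᵥ u) - b ⬝ᵥ u) - ((d - Matrix.vecMulVec u b) *ᵥ u) i)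
        (Matrix.vecMulVec u b + (d - Matrix.vecMulVec u b)) := by
  rw [add_sub_cancel_right, add_sub_cancel]
  congr 1
  ext1 i
  rw [Matrix.sub_mulVec, vecMulVec_mulVec_quat]
  simp only [riccati, Pi.sub_apply, mul_add]
  abel

lemma charpoly_block_riccati (a : ℍ[ℝ]) (b : n → ℍ[ℝ]) (d : Matrix n n ℍ[ℝ]) (u : n → ℍ[ℝ]) :
    (crep (block a b (riccati a b d u) d)).charpoly =
      quatCharpoly (a + b ⬝ᵥ u) * (crep (d - Matrix.vecMulVec u b)).charpoly := by
  rw [block_riccati, charpoly_crep_shear_conj]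

/-- All roots of the polynomial are simple. -/
def SimpleRoots (p : Polynomial ℂ) : Prop := ∀ z, p.IsRoot z → ¬ p.derivative.IsRoot z

/-- No eigenvector is orthogonal to the row `b`. -/
def Observable (b : n → ℍ[ℝ]) (d : Matrix n n ℍ[ℝ]) : Prop :=
  ∀ (v : n → ℍ[ℝ]) (q : ℍ[ℝ]), b ⬝ᵥ v = 0 → d *ᵥ v = (fun i => v i * q) → v = 0

section Count

variable {a : ℍ[ℝ]} {b c : n → ℍ[ℝ]} {d : Matrix n n ℍ[ℝ]}

lemma isRoot_quatCharpoly_mul (q : ℍ[ℝ]) (p : Polynomial ℂ) :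
    (quatCharpoly q * p).IsRoot (lam q) ∧ (quatCharpoly q * p).IsRoot (conj (lam q)) := by
  simp [quatCharpoly, Polynomial.IsRoot]

/-- A common root with the cofactor would be a double root, and a real `lam q` would be a double
root of `quatCharpoly q` itself. -/
lemma not_isRoot_of_simpleRoots {q : ℍ[ℝ]} {p : Polynomial ℂ}
    (h : SimpleRoots (quatCharpoly q * p)) : ¬ p.IsRoot (lam q) ∧ (lam q).im ≠ 0 := by
  have h1 := h _ (isRoot_quatCharpoly_mul q p).1
  rw [Polynomial.IsRoot, quatCharpoly] at h1
  simp at h1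
  refine ⟨fun h2 => h1.2 h2, fun h3 => h1.1 ?_⟩
  rw [sub_eq_zero, eq_comm, Complex.conj_eq_iff_im]
  exact h3

/-- The difference of two solutions is in the kernel of v ↦ v (a + b·u₂) - (d - u₁ b) v. By
`det_sylvester` that kernel is trivial, because the common eigenvalue is a simple root and hence not
an eigenvalue of d - u₁ b. -/
lemma riccati_injOn (h1 : SimpleRoots (crep (block a b c d)).charpoly) {u₁ u₂ : n → ℍ[ℝ]}
    (hu₁ : riccati a b d u₁ = c) (hu₂ : riccati a b d u₂ = c)
    (h : lam (a + b ⬝ᵥ u₁) = lam (a + b ⬝ᵥ u₂)) : u₁ = u₂ := by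
  rw [← hu₁, charpoly_block_riccati] at h1
  have h2 := (not_isRoot_of_simpleRoots h1).1
  rw [h] at h2
  have hdet : LinearMap.det (mulRightR n (a + b ⬝ᵥ u₂) -
      mulVecR (d - Matrix.vecMulVec u₁ b)) ≠ 0 := by
    rw [det_sylvester]
    exact pow_ne_zero _ (norm_ne_zero_iff.2 h2)
  have hinj := (LinearMap.equivOfDetNeZero _ hdet).injective
  refine (sub_eq_zero.1 (hinj (a₁ := u₂ - u₁) (a₂ := 0) ?_)).symm
  rw [map_zero]
  ext1 i
  change (u₂ i - u₁ i) * (a + b ⬝ᵥ u₂) - ((d - Matrix.vecMulVec u₁ b) *ᵥ (u₂ - u₁)) i = 0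
  have e1 := congrFun hu₁ i
  have e2 := congrFun hu₂ i
  simp only [riccati] at e1 e2
  rw [Matrix.sub_mulVec, vecMulVec_mulVec_quat, Matrix.mulVec_sub, dotProduct_sub]
  simp only [Pi.sub_apply]
  have e3 := e2.trans e1.symm
  rw [← sub_eq_zero] at e3
  rw [← e3]
  simp only [mul_add, mul_sub, sub_mul]
  abel

/-- A complex eigenvector of the representative is a quaternion eigenvector. Its first entry is
nonzero, for otherwise the rest would be an eigenvector of d orthogonal to b, so right division by
it normalises the vector to (1, u). The division conjugates the eigenvalue. -/
lemma exists_riccati_of_isRoot (h2 : Observable b d) {z : ℂ}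
    (hz : (crep (block a b c d)).charpoly.IsRoot z) :
    ∃ u, riccati a b d u = c ∧ lam (a + b ⬝ᵥ u) = lam (z : ℍ[ℝ]) := by
  obtain ⟨w, hw0, hw⟩ : ∃ w, w ≠ 0 ∧ crep (block a b c d) *ᵥ w = z • w := by
    have h3 : (Matrix.scalar _ z - crep (block a b c d)).det = 0 := by
      rw [← Matrix.eval_charpoly]; exact hz
    obtain ⟨w, hw0, hw⟩ := Matrix.exists_mulVec_eq_zero_iff.2 h3
    refine ⟨w, hw0, ?_⟩
    rw [Matrix.sub_mulVec, sub_eq_zero] at hw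
    rw [← hw]
    ext p
    simp [Matrix.scalar_apply, Matrix.mulVec_diagonal]
  set v : Unit ⊕ n → ℍ[ℝ] := ccol.symm w with hv
  have hvw : ccol v = w := ccol.apply_symm_apply w
  have hGv : block a b c d *ᵥ v = fun i => v i * (z : ℍ[ℝ]) := by
    apply ccol.injective
    rw [ccol_mulVec, ccol_mul_complex, hvw, hw]
  set v₀ := v (Sum.inl ()) with hv0
  set v' : n → ℍ[ℝ] := fun i => v (Sum.inr i) with hv'
  have e1 : a * v₀ + b ⬝ᵥ v' = v₀ * (z : ℍ[ℝ]) := by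
    have := congrFun hGv (Sum.inl ())
    simpa [block, Matrix.mulVec, dotProduct, Fintype.sum_sum_type] using this
  have e2 : ∀ i, c i * v₀ + (d *ᵥ v') i = v' i * (z : ℍ[ℝ]) := fun i => by
    have := congrFun hGv (Sum.inr i)
    simpa [block, Matrix.mulVec, dotProduct, Fintype.sum_sum_type] using this
  have hv00 : v₀ ≠ 0 := by
    intro h0
    have h3 : v' = 0 := by
      refine h2 v' z ?_ ?_
      · simpa [h0] using e1
      · ext1 i; simpa [h0] using e2 i
    apply hw0
    rw [← hvw]
    have : v = 0 := by
      ext1 i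
      rcases i with i | i
      · exact h0
      · exact congrFun h3 i
    rw [this, map_zero]
  set u : n → ℍ[ℝ] := fun i => v' i * v₀⁻¹ with hu
  have hbu : b ⬝ᵥ u = (b ⬝ᵥ v') * v₀⁻¹ := by
    simp only [hu, dotProduct, Finset.sum_mul, mul_assoc]
  have hdu : ∀ i, (d *ᵥ u) i = (d *ᵥ v') i * v₀⁻¹ := fun i => by
    simp only [hu, Matrix.mulVec, dotProduct, Finset.sum_mul, mul_assoc]
  have hq : a + b ⬝ᵥ u = v₀ * (z : ℍ[ℝ]) * v₀⁻¹ := by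
    rw [← e1, hbu, add_mul, mul_assoc, mul_inv_cancel₀ hv00, mul_one]
  refine ⟨u, ?_, ?_⟩
  · ext1 i
    simp only [riccati]
    rw [hq, hdu, sub_eq_iff_eq_add]
    have e3 : c i = (c i * v₀) * v₀⁻¹ := by rw [mul_assoc, mul_inv_cancel₀ hv00, mul_one]
    rw [e3, ← add_mul, e2]
    simp only [hu]
    rw [← mul_assoc, ← mul_assoc, mul_assoc (v' i), inv_mul_cancel₀ hv00, mul_one]
  · exact lam_conj hv00 (by rw [hq, mul_assoc, inv_mul_cancel₀ hv00, mul_one])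

end Count

end

section

variable {n : Type*} [Fintype n] [DecidableEq n]

section Count

variable {a : ℍ[ℝ]} {b c : n → ℍ[ℝ]} {d : Matrix n n ℍ[ℝ]}

/-- A generic quaternion matrix of size `k + 1` has `k + 1` normalised eigenvectors. -/
lemma ncard_riccati (h1 : SimpleRoots (crep (block a b c d)).charpoly) (h2 : Observable b d) :
    (riccati a b d ⁻¹' {c}).Finite ∧ (riccati a b d ⁻¹' {c}).ncard = Fintype.card n + 1 := by
  set p := (crep (block a b c d)).charpoly with hp
  have hp0 : p ≠ 0 := (Matrix.charpoly_monic _).ne_zero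
  -- Each root belongs to the quadratic factor of some solution u, so its conjugate is a root too,
  -- and simplicity excludes real roots.
  have hroot : ∀ z, p.IsRoot z → p.IsRoot (conj z) ∧ z.im ≠ 0 := by
    intro z hz
    obtain ⟨u, hu, hlam⟩ := exists_riccati_of_isRoot h2 hz
    have h3 : p = quatCharpoly (a + b ⬝ᵥ u) * (crep (d - Matrix.vecMulVec u b)).charpoly := by
      rw [hp, ← hu, charpoly_block_riccati]
    have h4 := isRoot_quatCharpoly_mul (a + b ⬝ᵥ u) (crep (d - Matrix.vecMulVec u b)).charpoly
    have h5 := (not_isRoot_of_simpleRoots (h3 ▸ h1)).2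
    rw [← h3, hlam] at h4
    rw [hlam] at h5
    rcases le_total 0 z.im with h6 | h6
    · rw [lam_coeComplex h6] at h4 h5
      exact ⟨h4.2, h5⟩
    · rw [lam_coeComplex_of_im_nonpos h6] at h4 h5
      exact ⟨h4.1, by simpa using h5⟩
  classical
  set R := p.roots.toFinset with hR
  have hRmem : ∀ z, z ∈ R ↔ p.IsRoot z := fun z => by
    rw [hR, Multiset.mem_toFinset, Polynomial.mem_roots hp0]
  have hnodup : p.roots.Nodup := by
    rw [Multiset.nodup_iff_count_le_one]
    intro z
    rw [Polynomial.count_roots]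
    by_contra! h3
    have h4 := (Polynomial.one_lt_rootMultiplicity_iff_isRoot hp0).1 h3
    exact h1 z h4.1 h4.2
  have hcard : R.card = 2 * (Fintype.card n + 1) := by
    rw [hR, Multiset.toFinset_card_of_nodup hnodup,
      Polynomial.splits_iff_card_roots.1 (IsAlgClosed.splits p), hp,
      Matrix.charpoly_natDegree_eq_dim]
    simp
    ring
  have hsplit := Finset.card_filter_add_card_filter_not (s := R) (fun z : ℂ => 0 < z.im)
  have hconj : (R.filter fun z : ℂ => ¬ 0 < z.im).card = (R.filter fun z : ℂ => 0 < z.im).card := by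
    refine Finset.card_bij' (fun z _ => conj z) (fun z _ => conj z) ?_ ?_ (by simp) (by simp)
    · intro z hz
      rw [Finset.mem_filter, hRmem] at hz ⊢
      have h3 := hroot z hz.1
      refine ⟨h3.1, ?_⟩
      have := lt_of_le_of_ne (not_lt.1 hz.2) h3.2
      simpa using this
    · intro z hz
      rw [Finset.mem_filter, hRmem] at hz ⊢
      refine ⟨(hroot z hz.1).1, ?_⟩
      simpa using hz.2.le
  -- Solutions correspond to roots in the upper half plane, which are half of the 2 (card n + 1)
  -- distinct roots.
  have hbij : Set.BijOn (fun u => lam (a + b ⬝ᵥ u)) (riccati a b d ⁻¹' {c})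
      (R.filter fun z : ℂ => 0 < z.im) := by
    refine ⟨?_, ?_, ?_⟩
    · intro u hu
      have hu' : riccati a b d u = c := hu
      have h3 : p = quatCharpoly (a + b ⬝ᵥ u) * (crep (d - Matrix.vecMulVec u b)).charpoly := by
        rw [hp, ← hu', charpoly_block_riccati]
      rw [Finset.mem_coe, Finset.mem_filter, hRmem]
      refine ⟨by rw [h3]; exact (isRoot_quatCharpoly_mul _ _).1, ?_⟩
      exact lt_of_le_of_ne (lam_im_nonneg _) (Ne.symm (not_isRoot_of_simpleRoots (h3 ▸ h1)).2)
    · intro u₁ hu₁ u₂ hu₂ h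
      exact riccati_injOn h1 hu₁ hu₂ h
    · intro z hz
      rw [Finset.mem_coe, Finset.mem_filter, hRmem] at hz
      obtain ⟨u, hu, hlam⟩ := exists_riccati_of_isRoot h2 hz.1
      exact ⟨u, hu, by simpa [lam_coeComplex hz.2.le] using hlam⟩
  have hncard : (riccati a b d ⁻¹' {c}).ncard = (R.filter fun z : ℂ => 0 < z.im).card := by
    rw [← Set.ncard_coe_finset, ← hbij.image_eq, hbij.injOn.ncard_image]
  refine ⟨?_, by omega⟩
  exact Set.Finite.of_finite_image (hbij.image_eq ▸ Finset.finite_toSet _) hbij.injOn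

end Count

end

/-! ### Genericity: simple spectrum and observability hold off a null set -/

section

section AnalyticMatrix

variable {E : Type*} [NormedAddCommGroup E] [NormedSpace ℝ E]
variable {l m n : Type*} [Fintype m] [Fintype n] [DecidableEq n]

/-- A matrix-valued function with analytic entries. -/
def AnalyticEntries (M : E → Matrix l m ℂ) : Prop :=
  ∀ i j, AnalyticOnNhd ℝ (fun x => M x i j) Set.univ

lemma AnalyticEntries.mul {M : E → Matrix l m ℂ} {M' : E → Matrix m n ℂ}
    (h : AnalyticEntries M) (h' : AnalyticEntries M') : AnalyticEntries fun x => M x * M' x := by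
  intro i j
  simp only [Matrix.mul_apply]
  exact Finset.analyticOnNhd_fun_sum _ fun a _ => (h i a).mul (h' a j)

lemma AnalyticEntries.pow {M : E → Matrix n n ℂ} (h : AnalyticEntries M) (k : ℕ) :
    AnalyticEntries fun x => M x ^ k := by
  induction k with
  | zero => intro i j; simpa using analyticOnNhd_const
  | succ k ih => simpa only [pow_succ] using ih.mul h

lemma AnalyticEntries.det {M : E → Matrix n n ℂ} (h : AnalyticEntries M) :
    AnalyticOnNhd ℝ (fun x => (M x).det) Set.univ := by
  simp only [Matrix.det_apply']
  exact Finset.analyticOnNhd_fun_sum _ fun σ _ => analyticOnNhd_const.mul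
    (Finset.analyticOnNhd_fun_prod _ fun i _ => h _ _)

/-- The coefficients are universal polynomials in the matrix entries. -/
lemma AnalyticEntries.coeff_charpoly {M : E → Matrix n n ℂ} (h : AnalyticEntries M) (k : ℕ) :
    AnalyticOnNhd ℝ (fun x => (M x).charpoly.coeff k) Set.univ := by
  have h1 : ∀ x, (M x).charpoly.coeff k =
      MvPolynomial.aeval (fun p : n × n => M x p.1 p.2) ((Matrix.charpoly.univ ℂ n).coeff k) := by
    intro x
    have := Matrix.charpoly.univ_coeff_eval₂Hom n (RingHom.id ℂ) (fun p : n × n => M x p.1 p.2) k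
    rw [MvPolynomial.aeval_def]
    exact this.symm
  rw [funext h1]
  generalize (Matrix.charpoly.univ ℂ n).coeff k = p
  exact AnalyticOnNhd.aeval_mvPolynomial (fun p : n × n => h p.1 p.2) p

/-- For p the characteristic polynomial of M, det p'(M) detects multiple roots as the discriminant
does. This analytic function makes simplicity of the spectrum a generic condition. -/
lemma AnalyticEntries.aeval_derivative_charpoly {M : E → Matrix n n ℂ} (h : AnalyticEntries M) :
    AnalyticEntries fun x => Polynomial.aeval (M x) (M x).charpoly.derivative := by
  have h1 : ∀ x, Polynomial.aeval (M x) (M x).charpoly.derivative =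
      ∑ i ∈ Finset.range (Fintype.card n + 1),
        ((M x).charpoly.coeff (i + 1) * (i + 1)) • M x ^ i := by
    intro x
    rw [Polynomial.aeval_eq_sum_range' (n := Fintype.card n + 1)]
    · simp only [Polynomial.coeff_derivative]
    · have := Polynomial.natDegree_derivative_le (M x).charpoly
      rw [Matrix.charpoly_natDegree_eq_dim] at this
      omega
  intro i j
  simp only [h1, Matrix.sum_apply, Matrix.smul_apply, smul_eq_mul]
  exact Finset.analyticOnNhd_fun_sum _ fun a _ =>
    ((h.coeff_charpoly _).mul analyticOnNhd_const).mul (h.pow _ _ _)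

end AnalyticMatrix

/-- If an eigenvalue z of M were a root of p', the singular matrix M - z would be a factor of p'(M).
-/
lemma simpleRoots_of_det_ne_zero {n : Type*} [Fintype n] [DecidableEq n] {M : Matrix n n ℂ}
    (h : (Polynomial.aeval M M.charpoly.derivative).det ≠ 0) : SimpleRoots M.charpoly := by
  intro z hz hz'
  obtain ⟨r, hr⟩ := Polynomial.dvd_iff_isRoot.2 hz'
  apply h
  rw [hr, map_mul, Matrix.det_mul]
  have : (Polynomial.aeval M (Polynomial.X - Polynomial.C z)).det = 0 := by
    have h1 : Polynomial.aeval M (Polynomial.X - Polynomial.C z) = -(Matrix.scalar n z - M) := by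
      simp [Matrix.algebraMap_eq_diagonal, Matrix.scalar_apply]
    rw [h1, Matrix.det_neg, ← Matrix.eval_charpoly, hz.eq_zero, mul_zero]
  rw [this, zero_mul]

/-- Evaluate the Bézout relation of p and p' at M: by Cayley–Hamilton p(M) = 0, so p'(M) is
invertible. -/
lemma det_aeval_derivative_ne_zero {n : Type*} [Fintype n] [DecidableEq n] {M : Matrix n n ℂ}
    (h : M.charpoly.Separable) : (Polynomial.aeval M M.charpoly.derivative).det ≠ 0 := by
  obtain ⟨a, b, hab⟩ := h
  have h1 := congrArg (Polynomial.aeval M) hab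
  rw [map_add, map_mul, map_mul, Matrix.aeval_self_charpoly, mul_zero, zero_add, map_one] at h1
  have h2 := congrArg Matrix.det h1
  rw [Matrix.det_mul, Matrix.det_one] at h2
  intro h0
  rw [h0, mul_zero] at h2
  exact zero_ne_one h2

section Generic

variable {m n : Type*} [Fintype m] [Fintype n] [DecidableEq m] [DecidableEq n]

/-- An entry of the complex representation as a real linear form. -/
lemma analyticEntries_crep {E : Type*} [NormedAddCommGroup E] [NormedSpace ℝ E]
    [FiniteDimensional ℝ E] {l m : Type*} (f : E →ₗ[ℝ] Matrix l m ℍ[ℝ]) :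
    AnalyticEntries fun x => crep (f x) := by
  intro i j
  let φ : E →ₗ[ℝ] ℂ :=
    { toFun := fun x => crep (f x) i j
      map_add' := fun x y => by rw [map_add, crep_add]; rfl
      map_smul' := fun r x => by rw [map_smul, crep_smul]; rfl }
  exact (LinearMap.toContinuousLinearMap φ).analyticOnNhd _

lemma crep_diagonal (t : n → ℍ[ℝ]) (w : n × Fin 2 → ℂ)
    (h : ∀ i, quatBlock (t i) = Matrix.diagonal fun a => w (i, a)) :
    crep (Matrix.diagonal t) = Matrix.diagonal w := by
  ext ⟨i, a⟩ ⟨j, b⟩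
  rw [crep_apply]
  by_cases hij : i = j
  · subst hij
    simp only [Matrix.diagonal_apply_eq, h]
    simp [Matrix.diagonal_apply]
  · rw [Matrix.diagonal_apply_ne _ hij, Matrix.diagonal_apply_ne _ (by simp [hij]),
      ← quatBlockHom_apply, map_zero, Matrix.zero_apply]

lemma exists_separable_charpoly (n : Type*) [Fintype n] [DecidableEq n] :
    ∃ M : Matrix n n ℍ[ℝ], (crep M).charpoly.Separable := by
  let e := Fintype.equivFin n
  let w : n × Fin 2 → ℂ := fun p => ![1, -1] p.2 * ((((e p.1 : ℕ) : ℝ) + 1 : ℝ) : ℂ) * Complex.I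
  -- The eigenvalues are ±(m + 1) i for distinct m ≥ 0. The shift by one keeps them off zero, where
  -- a conjugate pair would coincide.
  refine ⟨Matrix.diagonal fun i => quat 0 ((e i : ℕ) + 1) 0 0, ?_⟩
  rw [crep_diagonal _ w, Matrix.charpoly_diagonal, Polynomial.separable_prod_X_sub_C_iff]
  · rintro ⟨i, a⟩ ⟨j, b⟩ h
    have hi : (0 : ℝ) ≤ ((e i : ℕ) : ℝ) := Nat.cast_nonneg _
    have hj : (0 : ℝ) ≤ ((e j : ℕ) : ℝ) := Nat.cast_nonneg _
    have h' := congrArg Complex.im h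
    have key : (e i : ℕ) = (e j : ℕ) → i = j := fun h0 => e.injective (Fin.ext h0)
    fin_cases a <;> fin_cases b <;> simp [w] at h'
    · rw [key h']
    · linarith
    · linarith
    · rw [key h']
  · intro i
    ext a b
    fin_cases a <;> fin_cases b <;> simp [w, quatBlock, quat, Complex.ext_iff]

/-- The matrix with rows `b d ^ i`. -/
def krylov (e : n ≃ Fin (Fintype.card n)) (b : n → ℍ[ℝ]) (d : Matrix n n ℍ[ℝ]) :
    Matrix (n × Fin 2) (n × Fin 2) ℂ :=
  Matrix.of fun p c => (crep (Matrix.replicateRow Unit b) * crep d ^ (e p.1 : ℕ)) ((), p.2) c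

/-- If b·v = 0 and d v = v q, then b d^k v = (b·v) q^k = 0 for all k, so v is annihilated by every
row of the Krylov matrix. -/
lemma observable_of_det_krylov_ne_zero {e : n ≃ Fin (Fintype.card n)} {b : n → ℍ[ℝ]}
    {d : Matrix n n ℍ[ℝ]} (h : (krylov e b d).det ≠ 0) : Observable b d := by
  intro v q hv hq
  have hpow : ∀ k : ℕ, d ^ k *ᵥ v = fun i => v i * q ^ k := by
    intro k
    induction k with
    | zero => simp
    | succ k ih =>
      rw [pow_succ', ← Matrix.mulVec_mulVec, ih]
      have h1 : d *ᵥ (fun i => v i * q ^ k) = fun i => (d *ᵥ v) i * q ^ k := by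
        ext1 i; simp only [Matrix.mulVec, dotProduct, Finset.sum_mul, mul_assoc]
      rw [h1, hq]
      ext1 i
      rw [mul_assoc, ← pow_succ']
  have h0 : krylov e b d *ᵥ ccol v = 0 := by
    ext p
    have h1 : (krylov e b d *ᵥ ccol v) p =
        ((crep (Matrix.replicateRow Unit b) * crep d ^ (e p.1 : ℕ)) *ᵥ ccol v) ((), p.2) := rfl
    rw [h1, ← Matrix.mulVec_mulVec, ← crepHom_apply, ← map_pow, crepHom_apply, ← ccol_mulVec,
      hpow, ← ccol_mulVec]
    have h2 : Matrix.replicateRow Unit b *ᵥ (fun i => v i * q ^ (e p.1 : ℕ)) = 0 := by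
      ext1 i
      have : (b ⬝ᵥ v) * q ^ (e p.1 : ℕ) = 0 := by rw [hv, zero_mul]
      rw [Pi.zero_apply, ← this]
      simp only [Matrix.mulVec, dotProduct, Finset.sum_mul, mul_assoc, Matrix.replicateRow_apply]
    rw [h2, map_zero]
    rfl
  exact ccol.map_eq_zero_iff.1 (Matrix.eq_zero_of_mulVec_eq_zero h h0)

/-- For b = (1, …, 1) and d diagonal with the distinct real entries 0, 1, 2, …, the Krylov matrix is
a transposed Vandermonde matrix tensored with the 2 × 2 identity. -/
lemma exists_det_krylov_ne_zero (e : n ≃ Fin (Fintype.card n)) :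
    ∃ b : n → ℍ[ℝ], ∃ d, (krylov e b d).det ≠ 0 := by
  refine ⟨fun _ => 1, Matrix.diagonal fun i => quat (e i : ℕ) 0 0 0, ?_⟩
  have h1 : krylov e (fun _ => 1) (Matrix.diagonal fun i => quat (e i : ℕ) 0 0 0) =
      Matrix.kroneckerMap (· * ·)
        (((Matrix.vandermonde fun i : Fin (Fintype.card n) => ((i : ℕ) : ℂ)).transpose).submatrix e e)
        (1 : Matrix (Fin 2) (Fin 2) ℂ) := by
    ext ⟨i, a⟩ ⟨j, c⟩
    rw [krylov, Matrix.of_apply, crep_diagonal _ (fun p => ((e p.1 : ℕ) : ℂ)), Matrix.diagonal_pow]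
    · simp only [Matrix.mul_diagonal, crep_apply, Matrix.replicateRow_apply]
      rw [← quatBlockHom_apply, map_one]
      simp [Matrix.vandermonde, mul_comm]
    · intro i
      ext a b
      fin_cases a <;> fin_cases b <;> simp [quatBlock, quat, Complex.ext_iff]
  rw [h1, Matrix.det_kronecker, Matrix.det_submatrix_equiv_self, Matrix.det_transpose]
  simp only [Matrix.det_one, one_pow, mul_one]
  refine pow_ne_zero _ (Matrix.det_vandermonde_ne_zero_iff.2 ?_)
  intro i j hij
  exact Fin.ext (Nat.cast_injective (R := ℂ) hij)

end Generic

instance : ProperSpace ℍ[ℝ] := FiniteDimensional.proper ℝ ℍ[ℝ]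

/-- The measure on a space of quaternion matrices is a Haar measure. -/
instance isAddHaarMeasure_volume_matrix (m n : Type*) [Fintype m] [Fintype n] :
    (volume : Measure (m → n → ℍ[ℝ])).IsAddHaarMeasure :=
  Measure.pi.isAddHaarMeasure fun _ : m => (volume : Measure (n → ℍ[ℝ]))

section BlockCoordinates

variable (n : Type*) [Fintype n] [DecidableEq n]

/-- The coordinates of a quaternion matrix with a distinguished first row and column: the corner,
the rest of the row, the complementary minor and the rest of the column. -/
abbrev BlockCoord := (ℍ[ℝ] × (n → ℍ[ℝ]) × (n → n → ℍ[ℝ])) × (n → ℍ[ℝ])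

instance : BorelSpace (BlockCoord n) := Prod.borelSpace

instance : (volume : Measure ((n → ℍ[ℝ]) × (n → n → ℍ[ℝ]))).IsAddHaarMeasure :=
  Measure.prod.instIsAddHaarMeasure (volume : Measure (n → ℍ[ℝ])) (volume : Measure (n → n → ℍ[ℝ]))

instance : (volume : Measure (ℍ[ℝ] × (n → ℍ[ℝ]) × (n → n → ℍ[ℝ]))).IsAddHaarMeasure :=
  Measure.prod.instIsAddHaarMeasure
    (volume : Measure ℍ[ℝ]) (volume : Measure ((n → ℍ[ℝ]) × (n → n → ℍ[ℝ])))

instance : (volume : Measure (BlockCoord n)).IsAddHaarMeasure :=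
  Measure.prod.instIsAddHaarMeasure
    (volume : Measure (ℍ[ℝ] × (n → ℍ[ℝ]) × (n → n → ℍ[ℝ]))) (volume : Measure (n → ℍ[ℝ]))

/-- The matrix with given block coordinates. -/
def blockEquiv : BlockCoord n ≃ₗ[ℝ] (Unit ⊕ n → Unit ⊕ n → ℍ[ℝ]) where
  toFun x := block x.1.1 x.1.2.1 x.2 (Matrix.of x.1.2.2)
  map_add' x y := by
    ext1 i; ext1 j
    rcases i with i | i <;> rcases j with j | j <;> rfl
  map_smul' r x := by
    ext1 i; ext1 j
    rcases i with i | i <;> rcases j with j | j <;> rfl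
  invFun M := ((M (.inl ()) (.inl ()), fun j => M (.inl ()) (.inr j), fun i j => M (.inr i) (.inr j)),
    fun i => M (.inr i) (.inl ()))
  left_inv x := rfl
  right_inv M := by
    ext1 i; ext1 j
    rcases i with i | i <;> rcases j with j | j <;> rfl

/-- Each condition follows from the nonvanishing of an analytic function of the entries, and each
function is nonzero at an explicit matrix. -/
lemma ae_simpleRoots_observable : ∀ᵐ x : BlockCoord n,
    SimpleRoots (crep (block x.1.1 x.1.2.1 x.2 (Matrix.of x.1.2.2))).charpoly ∧
      Observable x.1.2.1 (Matrix.of x.1.2.2) := by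
  refine Filter.Eventually.and ?_ ?_
  · have h1 : AnalyticEntries fun x : BlockCoord n => crep (blockEquiv n x) :=
      analyticEntries_crep (blockEquiv n).toLinearMap
    obtain ⟨M, hM⟩ := exists_separable_charpoly (Unit ⊕ n)
    have h2 := measure_zeros_of_analytic (volume : Measure (BlockCoord n)) _
      h1.aeval_derivative_charpoly.det ((blockEquiv n).symm M) (by
        have h3 : crep (blockEquiv n ((blockEquiv n).symm M)) = crep M :=
          congrArg crep ((blockEquiv n).apply_symm_apply M)
        rw [h3]; exact det_aeval_derivative_ne_zero hM)
    filter_upwards [measure_eq_zero_iff_ae_notMem.1 h2] with x hx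
    exact simpleRoots_of_det_ne_zero hx
  · let e := Fintype.equivFin n
    obtain ⟨b, d, hbd⟩ := exists_det_krylov_ne_zero e
    let fb : BlockCoord n →ₗ[ℝ] Matrix Unit n ℍ[ℝ] :=
      { toFun := fun x => Matrix.replicateRow Unit x.1.2.1
        map_add' := fun x y => rfl
        map_smul' := fun r x => rfl }
    let fd : BlockCoord n →ₗ[ℝ] Matrix n n ℍ[ℝ] :=
      { toFun := fun x => Matrix.of x.1.2.2
        map_add' := fun x y => rfl
        map_smul' := fun r x => rfl }
    have h1 : AnalyticEntries fun x : BlockCoord n => krylov e x.1.2.1 (Matrix.of x.1.2.2) :=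
      fun p c => ((analyticEntries_crep fb).mul ((analyticEntries_crep fd).pow _)) _ _
    have h2 := measure_zeros_of_analytic (volume : Measure (BlockCoord n)) _ h1.det
      ((0, b, d), 0) hbd
    filter_upwards [measure_eq_zero_iff_ae_notMem.1 h2] with x hx
    exact observable_of_det_krylov_ne_zero hx

end BlockCoordinates

end

section

/-! ## Splitting off one eigenvalue -/

variable {n : Type*} [Fintype n] [DecidableEq n]

section Derivative

/-- The row vector `b` as a real-linear map. -/
def dotR (b : n → ℍ[ℝ]) : (n → ℍ[ℝ]) →ₗ[ℝ] ℍ[ℝ] where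
  toFun v := b ⬝ᵥ v
  map_add' v w := dotProduct_add b v w
  map_smul' r v := dotProduct_smul r b v

/-- The derivative of `riccati`. -/
def riccatiDeriv (a : ℍ[ℝ]) (b : n → ℍ[ℝ]) (d : Matrix n n ℍ[ℝ]) (u : n → ℍ[ℝ]) :
    (n → ℍ[ℝ]) →L[ℝ] (n → ℍ[ℝ]) :=
  LinearMap.toContinuousLinearMap
    (mulRightR n (a + b ⬝ᵥ u) - mulVecR (d - Matrix.vecMulVec u b))

variable (a : ℍ[ℝ]) (b : n → ℍ[ℝ]) (d : Matrix n n ℍ[ℝ]) (u : n → ℍ[ℝ])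

/-- The derivative of the quadratic map is the Sylvester operator of the eigenvalue and the deflated
minor. -/
lemma det_riccatiDeriv : (riccatiDeriv a b d u).det =
    ‖(crep (d - Matrix.vecMulVec u b)).charpoly.eval (lam (a + b ⬝ᵥ u))‖ ^ 2 := by
  rw [← det_sylvester]; rfl

lemma riccatiDeriv_apply (v : n → ℍ[ℝ]) : riccatiDeriv a b d u v =
    fun i => v i * (a + b ⬝ᵥ u) + u i * (b ⬝ᵥ v) - (d *ᵥ v) i := by
  ext1 i
  change v i * (a + b ⬝ᵥ u) - ((d - Matrix.vecMulVec u b) *ᵥ v) i = _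
  rw [Matrix.sub_mulVec, vecMulVec_mulVec_quat, Pi.sub_apply]
  abel

lemma hasFDerivAt_riccati : HasFDerivAt (riccati a b d) (riccatiDeriv a b d u) u := by
  rw [hasFDerivAt_pi']
  intro i
  have h1 : HasFDerivAt (fun u : n → ℍ[ℝ] => u i)
      (ContinuousLinearMap.proj i : (n → ℍ[ℝ]) →L[ℝ] ℍ[ℝ]) u := hasFDerivAt_apply i u
  have h2 : HasFDerivAt (fun u => a + b ⬝ᵥ u) (LinearMap.toContinuousLinearMap (dotR b)) u :=
    ((LinearMap.toContinuousLinearMap (dotR b)).hasFDerivAt).const_add a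
  have h3 : HasFDerivAt (fun u => (d *ᵥ u) i)
      ((ContinuousLinearMap.proj i).comp (LinearMap.toContinuousLinearMap (mulVecR d))) u :=
    ((ContinuousLinearMap.proj i).comp (LinearMap.toContinuousLinearMap (mulVecR d))).hasFDerivAt
  refine ((h1.mul' h2).sub h3).congr_fderiv ?_
  ext1 v
  simp only [ContinuousLinearMap.comp_apply, ContinuousLinearMap.proj_apply, riccatiDeriv_apply]
  change u i * (b ⬝ᵥ v) + v i * (a + b ⬝ᵥ u) - (d *ᵥ v) i = _
  abel

lemma continuous_riccatiDeriv : Continuous (riccatiDeriv a b d) := by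
  rw [continuous_clm_apply]
  intro v
  simp only [riccatiDeriv_apply, dotProduct, Matrix.mulVec]
  fun_prop

end Derivative

section Measurability

variable {X : Type*} [MeasurableSpace X]

lemma measurable_coeff_charpoly {M : X → Matrix n n ℍ[ℝ]}
    (hM : ∀ i j, Measurable fun x => M x i j) :
    Measurable fun x => (crep (M x)).charpoly.coeff := by
  refine measurable_pi_iff.2 fun k => ?_
  have h1 : AnalyticEntries fun A : n → n → ℍ[ℝ] => crep (Matrix.of A) :=
    analyticEntries_crep (E := n → n → ℍ[ℝ]) (Matrix.ofLinearEquiv ℝ).toLinearMap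
  have h2 : Continuous fun A : n → n → ℍ[ℝ] => (crep (Matrix.of A)).charpoly.coeff k :=
    continuousOn_univ.1 (h1.coeff_charpoly k).continuousOn
  exact h2.measurable.comp (measurable_pi_iff.2 fun i => measurable_pi_iff.2 fun j => hM i j)

lemma measurable_wt (L s : ℝ) {M : X → Matrix n n ℍ[ℝ]}
    (hM : ∀ i j, Measurable fun x => M x i j) : Measurable fun x => wt L s (M x) := by
  have h1 : Continuous fun A : n → n → ℍ[ℝ] => crep (Matrix.of A) :=
    continuous_matrix continuous_crep_entry
  have h2 : Measurable fun A : n → n → ℍ[ℝ] => wt L s (Matrix.of A) := by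
    have h3 : Continuous fun A : n → n → ℍ[ℝ] => ‖(crep (Matrix.of A)).det‖ :=
      h1.matrix_det.norm
    have h4 : Continuous fun A : n → n → ℍ[ℝ] =>
        ‖(1 + crep (Matrix.of A) * (crep (Matrix.of A))ᴴ).det‖ :=
      (continuous_const.add (h1.mul h1.matrix_conjTranspose)).matrix_det.norm
    exact (h3.measurable.pow_const _).div (h4.measurable.pow_const _)
  exact h2.comp (measurable_pi_iff.2 fun i => measurable_pi_iff.2 fun j => hM i j)

lemma measurable_dotProduct {b u : X → n → ℍ[ℝ]} (hb : Measurable b) (hu : Measurable u) :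
    Measurable fun x => b x ⬝ᵥ u x := by
  simp only [dotProduct]
  exact Finset.measurable_sum _ fun i _ =>
    (measurable_pi_iff.1 hb i).mul (measurable_pi_iff.1 hu i)

lemma measurable_mulVec {d : X → n → n → ℍ[ℝ]} {u : X → n → ℍ[ℝ]} (hd : Measurable d)
    (hu : Measurable u) : Measurable fun x => Matrix.of (d x) *ᵥ u x :=
  measurable_pi_iff.2 fun i => measurable_dotProduct (measurable_pi_iff.1 hd i) hu

lemma measurable_block {a : X → ℍ[ℝ]} {b c : X → n → ℍ[ℝ]} {d : X → Matrix n n ℍ[ℝ]}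
    (ha : Measurable a) (hb : Measurable b) (hc : Measurable c)
    (hd : ∀ i j, Measurable fun x => d x i j) (i j : Unit ⊕ n) :
    Measurable fun x => block (a x) (b x) (c x) (d x) i j := by
  rcases i with i | i <;> rcases j with j | j
  · exact ha
  · exact measurable_pi_iff.1 hb j
  · exact measurable_pi_iff.1 hc i
  · exact hd i j

end Measurability

/-! ### Multiplication by a quadratic factor, on coefficients -/

/-- The real quadratic polynomial with root `z`. -/
def pairPoly (z : ℂ) : Polynomial ℂ :=
  (Polynomial.X - Polynomial.C z) * (Polynomial.X - Polynomial.C (conj z))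

/-- The coefficients of the product with `pairPoly z`. -/
def mulPair (z : ℂ) (c : ℕ → ℂ) : ℕ → ℂ := fun k =>
  (if 2 ≤ k then c (k - 2) else 0) - (z + conj z) * (if 1 ≤ k then c (k - 1) else 0) +
    z * conj z * c k

/-- Statistics of the spectrum are taken as functions of the coefficient sequence, because ℕ → ℂ
carries a Borel structure. This transports multiplication by a quadratic factor to sequences. -/
lemma coeff_pairPoly_mul (z : ℂ) (p : Polynomial ℂ) :
    (pairPoly z * p).coeff = mulPair z p.coeff := by
  ext k
  have h1 : pairPoly z * p = Polynomial.X ^ 2 * p - Polynomial.C (z + conj z) *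
      (Polynomial.X ^ 1 * p) + Polynomial.C (z * conj z) * p := by
    rw [pairPoly, Polynomial.C_add, Polynomial.C_mul]; ring
  rw [h1, Polynomial.coeff_add, Polynomial.coeff_sub, Polynomial.coeff_C_mul,
    Polynomial.coeff_C_mul, Polynomial.coeff_X_pow_mul', Polynomial.coeff_X_pow_mul']
  rfl

lemma measurable_mulPair {X : Type*} [MeasurableSpace X] {z : X → ℂ} {c : X → ℕ → ℂ}
    (hz : Measurable z) (hc : Measurable c) : Measurable fun x => mulPair (z x) (c x) := by
  refine measurable_pi_iff.2 fun k => ?_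
  have h1 : ∀ j, Measurable fun x => c x j := fun j => measurable_pi_iff.1 hc j
  have h2 : Measurable fun x => conj (z x) := Complex.continuous_conj.measurable.comp hz
  refine ((Measurable.sub ?_ ((hz.add h2).mul ?_))).add ((hz.mul h2).mul (h1 k))
  · split_ifs
    · exact h1 _
    · exact measurable_const
  · split_ifs
    · exact h1 _
    · exact measurable_const

/-- The factor that an eigenvalue `z` contributes, besides its weight, in terms of the
coefficients `c` of the remaining characteristic polynomial, of degree `2 k`. -/
def pairFactor (Φ : (ℕ → ℂ) → ℝ≥0∞) (k : ℕ) (z : ℂ) (c : ℕ → ℂ) : ℝ≥0∞ :=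
  ENNReal.ofReal (‖∑ i ∈ Finset.range (2 * k + 1), c i * z ^ i‖ ^ 2) * Φ (mulPair z c)

lemma measurable_pairFactor {Φ : (ℕ → ℂ) → ℝ≥0∞} (hΦ : Measurable Φ) (k : ℕ) {X : Type*}
    [MeasurableSpace X] {z : X → ℂ} {c : X → ℕ → ℂ} (hz : Measurable z) (hc : Measurable c) :
    Measurable fun x => pairFactor Φ k (z x) (c x) := by
  have h1 : ∀ j, Measurable fun x => c x j := fun j => measurable_pi_iff.1 hc j
  refine Measurable.mul (Measurable.ennreal_ofReal ?_) (hΦ.comp (measurable_mulPair hz hc))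
  exact ((Finset.measurable_sum _ fun i _ => (h1 i).mul (hz.pow_const i)).norm).pow_const 2

lemma pairFactor_coeff (Φ : (ℕ → ℂ) → ℝ≥0∞) (k : ℕ) (z : ℂ) {p : Polynomial ℂ}
    (hp : p.natDegree = 2 * k) : pairFactor Φ k z p.coeff =
      ENNReal.ofReal (‖p.eval z‖ ^ 2) * Φ (pairPoly z * p).coeff := by
  rw [pairFactor, coeff_pairPoly_mul, Polynomial.eval_eq_sum_range, hp]

lemma natDegree_charpoly_crep (G : Matrix n n ℍ[ℝ]) :
    (crep G).charpoly.natDegree = 2 * Fintype.card n := by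
  rw [Matrix.charpoly_natDegree_eq_dim]
  simp [mul_comm]

/-! ### Invariance under conjugation -/

/-- Conjugation by an invertible matrix. -/
def conjMat (K K' : Matrix n n ℍ[ℝ]) : Matrix n n ℍ[ℝ] →ₗ[ℝ] Matrix n n ℍ[ℝ] where
  toFun G := K' * G * K
  map_add' G H := by rw [Matrix.mul_add, Matrix.add_mul]
  map_smul' r G := by rw [Matrix.mul_smul, Matrix.smul_mul]; rfl

/-- The quaternion dual as a real-linear equivalence. -/
def dualMat (n : Type*) : Matrix n n ℍ[ℝ] ≃ₗ[ℝ] Matrix n n ℍ[ℝ] where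
  toFun G := Gᴴ
  map_add' G H := Matrix.conjTranspose_add G H
  map_smul' r G := conjTranspose_real_smul r G
  invFun G := Gᴴ
  left_inv G := Matrix.conjTranspose_conjTranspose G
  right_inv G := Matrix.conjTranspose_conjTranspose G

/-- For self-dual K, the dual G ↦ G† carries G ↦ K⁻¹ G K into G ↦ K G K⁻¹, its inverse. A
real-linear map conjugate to its inverse has determinant ±1. -/
lemma abs_det_conjMat {K K' : Matrix n n ℍ[ℝ]} (hK : Kᴴ = K) (h1 : K' * K = 1)
    (h2 : K * K' = 1) : |LinearMap.det (conjMat K K')| = 1 := by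
  have hK' : K'ᴴ = K' := by
    have h3 : K * K'ᴴ = 1 := by
      have := congrArg Matrix.conjTranspose h1
      rwa [Matrix.conjTranspose_mul, hK, Matrix.conjTranspose_one] at this
    calc K'ᴴ = (K' * K) * K'ᴴ := by rw [h1, Matrix.one_mul]
      _ = K' := by rw [Matrix.mul_assoc, h3, Matrix.mul_one]
  have h3 : (dualMat n).toLinearMap ∘ₗ conjMat K K' ∘ₗ (dualMat n).symm.toLinearMap =
      conjMat K' K := by
    refine LinearMap.ext fun G => ?_
    change (K' * Gᴴ * K)ᴴ = K * G * K'
    rw [Matrix.conjTranspose_mul, Matrix.conjTranspose_mul, Matrix.conjTranspose_conjTranspose, hK,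
      hK', Matrix.mul_assoc]
  have h4 : conjMat K' K ∘ₗ conjMat K K' = LinearMap.id := by
    refine LinearMap.ext fun G => ?_
    change K * (K' * G * K) * K' = G
    rw [← Matrix.mul_assoc, ← Matrix.mul_assoc, h2, Matrix.one_mul, Matrix.mul_assoc, h2,
      Matrix.mul_one]
  have h5 : LinearMap.det (conjMat K' K) = LinearMap.det (conjMat K K') := by
    rw [← h3, LinearMap.det_conj]
  have h6 := congrArg LinearMap.det h4
  rw [LinearMap.det_comp, h5, LinearMap.det_id, ← sq] at h6
  rwa [← sq_eq_sq₀ (abs_nonneg _) zero_le_one, sq_abs, one_pow]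

lemma lintegral_conjMat {K K' : Matrix n n ℍ[ℝ]} (hK : Kᴴ = K) (h1 : K' * K = 1)
    (h2 : K * K' = 1) (f : Matrix n n ℍ[ℝ] → ℝ≥0∞) :
    ∫⁻ G : n → n → ℍ[ℝ], f (K' * Matrix.of G * K) = ∫⁻ G : n → n → ℍ[ℝ], f (Matrix.of G) := by
  let A : (n → n → ℍ[ℝ]) →ₗ[ℝ] (n → n → ℍ[ℝ]) := conjMat K K'
  have h3 : |LinearMap.det A| = 1 := abs_det_conjMat hK h1 h2
  have h4 := lintegral_comp_linearMap (volume : Measure (n → n → ℍ[ℝ])) A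
    (fun h0 => by rw [h0, abs_zero] at h3; exact zero_ne_one h3) f
  rw [h3, inv_one, ENNReal.ofReal_one, one_mul] at h4
  exact h4

end

/-! ### Integrating out the eigenvector and the off-diagonal row -/

section

variable {n : Type*} [Fintype n] [DecidableEq n]

/-- The statistic of the characteristic polynomial given by `Φ`. -/
def charStat (Φ : (ℕ → ℂ) → ℝ≥0∞) (G : Matrix n n ℍ[ℝ]) : ℝ≥0∞ := Φ (crep G).charpoly.coeff

lemma pairFactor_charpoly (Φ : (ℕ → ℂ) → ℝ≥0∞) (q : ℍ[ℝ]) (G : Matrix n n ℍ[ℝ]) :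
    pairFactor Φ (Fintype.card n) (lam q) (crep G).charpoly.coeff =
      ENNReal.ofReal (‖(crep G).charpoly.eval (lam q)‖ ^ 2) *
        Φ (quatCharpoly q * (crep G).charpoly).coeff :=
  pairFactor_coeff Φ _ _ (natDegree_charpoly_crep G)

/-- The integrand after the change of variables from the first column to an eigenvector. -/
def columnIntegrand (Φ : (ℕ → ℂ) → ℝ≥0∞) (L s : ℝ) (u : n → ℍ[ℝ])
    (x : ℍ[ℝ] × (n → ℍ[ℝ]) × (n → n → ℍ[ℝ])) : ℝ≥0∞ :=
  pairFactor Φ (Fintype.card n) (lam x.1) (crep (Matrix.of x.2.2)).charpoly.coeff *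
    ENNReal.ofReal (wt L s (block (x.1 - x.2.1 ⬝ᵥ u) x.2.1
      (fun i => u i * (x.1 - x.2.1 ⬝ᵥ u) - (Matrix.of x.2.2 *ᵥ u) i)
      (Matrix.of fun i j => u i * x.2.1 j + x.2.2 i j)))

lemma measurable_columnIntegrand {Φ : (ℕ → ℂ) → ℝ≥0∞} (hΦ : Measurable Φ) (L s : ℝ) :
    Measurable fun y : (ℍ[ℝ] × (n → ℍ[ℝ]) × (n → n → ℍ[ℝ])) × (n → ℍ[ℝ]) =>
      columnIntegrand Φ L s y.2 y.1 := by
  have hu : Measurable fun y : (ℍ[ℝ] × (n → ℍ[ℝ]) × (n → n → ℍ[ℝ])) × (n → ℍ[ℝ]) => y.2 :=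
    measurable_snd
  have hq : Measurable fun y : (ℍ[ℝ] × (n → ℍ[ℝ]) × (n → n → ℍ[ℝ])) × (n → ℍ[ℝ]) => y.1.1 :=
    measurable_fst.fst
  have hb : Measurable fun y : (ℍ[ℝ] × (n → ℍ[ℝ]) × (n → n → ℍ[ℝ])) × (n → ℍ[ℝ]) => y.1.2.1 :=
    measurable_fst.snd.fst
  have hd : Measurable fun y : (ℍ[ℝ] × (n → ℍ[ℝ]) × (n → n → ℍ[ℝ])) × (n → ℍ[ℝ]) => y.1.2.2 :=
    measurable_fst.snd.snd
  have ha := hq.sub (measurable_dotProduct hb hu)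
  refine (measurable_pairFactor hΦ _ (measurable_lam.comp hq)
    (measurable_coeff_charpoly fun i j => measurable_pi_iff.1 (measurable_pi_iff.1 hd i) j)).mul (Measurable.ennreal_ofReal ?_)
  refine measurable_wt L s (measurable_block ha hb ?_ fun i j => ?_)
  · exact measurable_pi_iff.2 fun i => ((measurable_pi_iff.1 hu i).mul ha).sub
      (measurable_pi_iff.1 (measurable_mulVec hd hu) i)
  · exact ((measurable_pi_iff.1 hu i).mul (measurable_pi_iff.1 hb j)).add
      (measurable_pi_iff.1 (measurable_pi_iff.1 hd i) j)

/-- The area formula for `riccati`: the factor card n + 1 is the size of its generic fibres, and the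
Jacobian is the squared characteristic polynomial inside `pairFactor`. -/
lemma lintegral_column {Φ : (ℕ → ℂ) → ℝ≥0∞} (hΦ : Measurable Φ) (L s : ℝ) (a : ℍ[ℝ])
    (b : n → ℍ[ℝ]) (d : n → n → ℍ[ℝ])
    (h : ∀ᵐ c : n → ℍ[ℝ], SimpleRoots (crep (block a b c (Matrix.of d))).charpoly ∧
      Observable b (Matrix.of d)) :
    (Fintype.card n + 1 : ℕ) * ∫⁻ c : n → ℍ[ℝ], charStat Φ (block a b c (Matrix.of d)) *
        ENNReal.ofReal (wt L s (block a b c (Matrix.of d))) =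
      ∫⁻ u : n → ℍ[ℝ], columnIntegrand Φ L s u
        (a + b ⬝ᵥ u, b, fun i j => d i j - u i * b j) := by
  have hblock := measurable_block (n := n) (X := n → ℍ[ℝ]) (measurable_const (a := a))
    (measurable_const (a := b)) measurable_id
    (fun i j => measurable_const (a := Matrix.of d i j)) (d := fun _ => Matrix.of d)
  rw [← lintegral_comp_mul_abs_det_of_ncard volume (riccati a b (Matrix.of d))
    (riccatiDeriv a b (Matrix.of d)) (hasFDerivAt_riccati a b _) (continuous_riccatiDeriv a b _)
    (Fintype.card n + 1) (h.mono fun c hc => ncard_riccati hc.1 hc.2)]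
  · refine lintegral_congr fun u => ?_
    have e1 : (Matrix.of fun i j => d i j - u i * b j) = Matrix.of d - Matrix.vecMulVec u b := rfl
    rw [det_riccatiDeriv, abs_of_nonneg (by positivity), charStat, charpoly_block_riccati,
      columnIntegrand, e1, pairFactor_charpoly, mul_assoc]
    congr 3
    rw [block_riccati]
    congr 2
  · exact (hΦ.comp (measurable_coeff_charpoly hblock)).mul (measurable_wt L s hblock).ennreal_ofReal

/-- The change of variables to the eigenvalue and the deflated matrix. -/
lemma lintegral_deflate (u : n → ℍ[ℝ]) {F : ℍ[ℝ] × (n → ℍ[ℝ]) × (n → n → ℍ[ℝ]) → ℝ≥0∞}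
    (hF : Measurable F) :
    ∫⁻ x : ℍ[ℝ] × (n → ℍ[ℝ]) × (n → n → ℍ[ℝ]),
      F (x.1 + x.2.1 ⬝ᵥ u, x.2.1, fun i j => x.2.2 i j - u i * x.2.1 j) =
    ∫⁻ q : ℍ[ℝ], ∫⁻ G : n → n → ℍ[ℝ], ∫⁻ b : n → ℍ[ℝ], F (q, b, G) := by
  have hu : Measurable fun x : ℍ[ℝ] × (n → ℍ[ℝ]) × (n → n → ℍ[ℝ]) => u := measurable_const
  have hmap : Measurable fun x : ℍ[ℝ] × (n → ℍ[ℝ]) × (n → n → ℍ[ℝ]) =>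
      ((x.1 + x.2.1 ⬝ᵥ u, x.2.1, fun i j => x.2.2 i j - u i * x.2.1 j) :
        ℍ[ℝ] × (n → ℍ[ℝ]) × (n → n → ℍ[ℝ])) := by
    have hb : Measurable fun x : ℍ[ℝ] × (n → ℍ[ℝ]) × (n → n → ℍ[ℝ]) => x.2.1 :=
      measurable_snd.fst
    have hd : Measurable fun x : ℍ[ℝ] × (n → ℍ[ℝ]) × (n → n → ℍ[ℝ]) => x.2.2 :=
      measurable_snd.snd
    refine (measurable_fst.add (measurable_dotProduct hb hu)).prodMk (hb.prodMk ?_)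
    exact measurable_pi_iff.2 fun i => measurable_pi_iff.2 fun j =>
      (measurable_pi_iff.1 (measurable_pi_iff.1 hd i) j).sub
        (measurable_const.mul (measurable_pi_iff.1 hb j))
  have hF' : Measurable fun y : (n → ℍ[ℝ]) × (n → n → ℍ[ℝ]) => ∫⁻ q, F (q, y) :=
    hF.lintegral_prod_left'
  -- For fixed u and b the substitution consists of translations, of the corner by b·u and of the
  -- minor by u b, so no Jacobian appears.
  calc _ = ∫⁻ y : (n → ℍ[ℝ]) × (n → n → ℍ[ℝ]), ∫⁻ q : ℍ[ℝ],
        F (q + y.1 ⬝ᵥ u, y.1, fun i j => y.2 i j - u i * y.1 j) :=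
      lintegral_prod_symm' _ (hF.comp hmap)
    _ = ∫⁻ y : (n → ℍ[ℝ]) × (n → n → ℍ[ℝ]), ∫⁻ q : ℍ[ℝ],
        F (q, y.1, fun i j => y.2 i j - u i * y.1 j) := lintegral_congr fun y =>
      lintegral_add_right_eq_self (μ := (volume : Measure ℍ[ℝ]))
        (fun q => F (q, y.1, fun i j => y.2 i j - u i * y.1 j)) (y.1 ⬝ᵥ u)
    _ = ∫⁻ b : n → ℍ[ℝ], ∫⁻ G : n → n → ℍ[ℝ], ∫⁻ q : ℍ[ℝ],
        F (q, b, fun i j => G i j - u i * b j) := by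
      refine lintegral_prod _ (Measurable.aemeasurable ?_)
      refine hF'.comp (f := fun y : (n → ℍ[ℝ]) × (n → n → ℍ[ℝ]) =>
        (y.1, fun i j => y.2 i j - u i * y.1 j)) (measurable_fst.prodMk ?_)
      exact measurable_pi_iff.2 fun i => measurable_pi_iff.2 fun j =>
        (measurable_pi_iff.1 (measurable_pi_iff.1 measurable_snd i) j).sub
          (measurable_const.mul (measurable_pi_iff.1 measurable_fst j))
    _ = ∫⁻ b : n → ℍ[ℝ], ∫⁻ G : n → n → ℍ[ℝ], ∫⁻ q : ℍ[ℝ], F (q, b, G) := lintegral_congr fun b =>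
      lintegral_sub_right_eq_self (μ := (volume : Measure (n → n → ℍ[ℝ])))
        (fun G => ∫⁻ q : ℍ[ℝ], F (q, b, G)) (fun i j => u i * b j)
    _ = ∫⁻ y : (n → ℍ[ℝ]) × (n → n → ℍ[ℝ]), ∫⁻ q : ℍ[ℝ], F (q, y) :=
      (lintegral_prod _ hF'.aemeasurable).symm
    _ = ∫⁻ q : ℍ[ℝ], ∫⁻ y : (n → ℍ[ℝ]) × (n → n → ℍ[ℝ]), F (q, y) :=
      lintegral_lintegral_swap (f := fun y q => F (q, y)) (hF.comp measurable_swap).aemeasurable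
    _ = _ := lintegral_congr fun q =>
      lintegral_prod_symm' _ (hF.comp measurable_prodMk_left)

/-- The complex determinant of ρ K has modulus ρ ^ (2k) · ρ², with k = card n and K the square root
of 1 + u u†. On quaternion rows the real determinant is its square, ρ ^ (4 (k + 1)). -/
lemma lintegral_vecMul_sqrtOuter (u v : n → ℍ[ℝ]) (f : (n → ℍ[ℝ]) → ℝ≥0∞) :
    ∫⁻ b : n → ℍ[ℝ], f (b ᵥ* (rho u • sqrtOuter u) + v) =
      ENNReal.ofReal ((1 + ∑ i, ‖u i‖ ^ 2) ^ (-(2 * (Fintype.card n + 1) : ℝ))) * ∫⁻ b, f b := by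
  have hr := rho_pos u
  have hdet : LinearMap.det (vecMulR (rho u • sqrtOuter u)) =
      rho u ^ (4 * (Fintype.card n + 1)) := by
    rw [det_vecMulR, crep_smul, Matrix.det_smul_of_tower, norm_smul, norm_det_sqrtOuter,
      Real.norm_eq_abs, abs_of_pos (by positivity)]
    simp only [Fintype.card_prod, Fintype.card_fin]
    ring
  have h1 := lintegral_comp_linearMap (volume : Measure (n → ℍ[ℝ]))
    (vecMulR (rho u • sqrtOuter u)) (by rw [hdet]; positivity) (fun b => f (b + v))
  rw [lintegral_add_right_eq_self f v, hdet, abs_of_pos (by positivity)] at h1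
  rw [← rho_sq, ← Real.rpow_natCast, ← Real.rpow_mul hr.le]
  refine h1.trans ?_
  congr 2
  rw [← Real.rpow_natCast, ← Real.rpow_neg hr.le]
  congr 1
  push_cast
  ring

lemma charpoly_crep_conj {K K' : Matrix n n ℍ[ℝ]} (h : K * K' = 1) (G : Matrix n n ℍ[ℝ]) :
    (crep (K' * G * K)).charpoly = (crep G).charpoly := by
  rw [crep_mul, crep_mul, Matrix.charpoly_mul_comm, ← Matrix.mul_assoc, ← crep_mul, h, crep_one,
    Matrix.one_mul]

/-- The integrand left after the first row and column are integrated out. -/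
def deflatedIntegrand (Φ : (ℕ → ℂ) → ℝ≥0∞) (L s : ℝ) (q : ℍ[ℝ]) (G : Matrix n n ℍ[ℝ]) : ℝ≥0∞ :=
  ENNReal.ofReal (‖q‖ ^ (4 * L) * (1 + ‖q‖ ^ 2) ^ (-(2 * (s + 1 - Fintype.card n)))) *
    (pairFactor Φ (Fintype.card n) (lam q) (crep G).charpoly.coeff * ENNReal.ofReal (wt L s G))

lemma measurable_deflatedIntegrand {Φ : (ℕ → ℂ) → ℝ≥0∞} (hΦ : Measurable Φ) (L s : ℝ) :
    Measurable fun y : ℍ[ℝ] × (n → n → ℍ[ℝ]) => deflatedIntegrand Φ L s y.1 (Matrix.of y.2) := by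
  have h1 : Measurable fun y : ℍ[ℝ] × (n → n → ℍ[ℝ]) => ‖y.1‖ := measurable_fst.norm
  have h2 : Measurable fun y : ℍ[ℝ] × (n → n → ℍ[ℝ]) => y.2 := measurable_snd
  have hG : ∀ i j, Measurable fun y : ℍ[ℝ] × (n → n → ℍ[ℝ]) => Matrix.of y.2 i j :=
    fun i j => measurable_pi_iff.1 (measurable_pi_iff.1 h2 i) j
  refine Measurable.mul (Measurable.ennreal_ofReal ?_) (Measurable.mul ?_ ?_)
  · exact (h1.pow_const _).mul (((h1.pow_const 2).const_add 1).pow_const _)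
  · exact measurable_pairFactor hΦ _ (measurable_lam.comp measurable_fst)
      (measurable_coeff_charpoly hG)
  · exact (measurable_wt L s hG).ennreal_ofReal

/-- The triangular form makes the weight a function of an affine image of b. After that substitution
the integral over b is the one in hypothesis `H`, and u remains only in the Jacobian and in the
conjugation of the minor. -/
lemma lintegral_columnIntegrand {Φ : (ℕ → ℂ) → ℝ≥0∞} {L s : ℝ} {c : ℝ≥0∞}
    (H : ∀ (q : ℍ[ℝ]) (G : Matrix n n ℍ[ℝ]),
      ∫⁻ b : n → ℍ[ℝ], ENNReal.ofReal (wt L (s + 1) (block q b 0 G)) =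
        c * (ENNReal.ofReal (‖q‖ ^ (4 * L) *
          (1 + ‖q‖ ^ 2) ^ (-(2 * (s + 1 - Fintype.card n)))) * ENNReal.ofReal (wt L s G)))
    (u : n → ℍ[ℝ]) (q : ℍ[ℝ]) (G : n → n → ℍ[ℝ]) :
    ∫⁻ b, columnIntegrand Φ L (s + 1) u (q, b, G) =
      ENNReal.ofReal ((1 + ∑ i, ‖u i‖ ^ 2) ^ (-(2 * (Fintype.card n + 1) : ℝ))) * c *
        deflatedIntegrand Φ L s q (invSqrtOuter u * Matrix.of G * sqrtOuter u) := by
  obtain ⟨v, hv⟩ := wt_shear_conj u L (s + 1) q (Matrix.of G)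
  have e1 : ∀ b : n → ℍ[ℝ], columnIntegrand Φ L (s + 1) u (q, b, G) =
      pairFactor Φ (Fintype.card n) (lam q) (crep (Matrix.of G)).charpoly.coeff *
        ENNReal.ofReal (wt L (s + 1) (block q (b ᵥ* (rho u • sqrtOuter u) + v) 0
          (invSqrtOuter u * Matrix.of G * sqrtOuter u))) := by
    intro b
    rw [← hv b]
    rfl
  have hm : Measurable fun b : n → ℍ[ℝ] => ENNReal.ofReal (wt L (s + 1) (block q b 0
          (invSqrtOuter u * Matrix.of G * sqrtOuter u))) :=
    (measurable_wt L (s + 1) (measurable_block (n := n) (X := n → ℍ[ℝ])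
      (measurable_const (a := q)) measurable_id (measurable_const (a := 0))
      (fun i j => measurable_const (a := (invSqrtOuter u * Matrix.of G * sqrtOuter u) i j))
        (d := fun _ => invSqrtOuter u * Matrix.of G * sqrtOuter u))).ennreal_ofReal
  have hm' : Measurable fun b : n → ℍ[ℝ] => b ᵥ* (rho u • sqrtOuter u) + v := by
    have : Continuous (vecMulR (rho u • sqrtOuter u)) := LinearMap.continuous_of_finiteDimensional _
    exact (this.measurable).add_const v
  have hmm : Measurable fun b : n → ℍ[ℝ] => ENNReal.ofReal (wt L (s + 1)
      (block q (b ᵥ* (rho u • sqrtOuter u) + v) 0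
        (invSqrtOuter u * Matrix.of G * sqrtOuter u))) := hm.comp hm'
  simp only [e1]
  rw [lintegral_const_mul _ hmm, lintegral_vecMul_sqrtOuter u v
    (fun b => ENNReal.ofReal (wt L (s + 1) (block q b 0
      (invSqrtOuter u * Matrix.of G * sqrtOuter u)))), H, deflatedIntegrand,
    charpoly_crep_conj (sqrtOuter_mul_invSqrtOuter u)]
  ring

/-- The integrand in block coordinates. -/
def blockIntegrand (Φ : (ℕ → ℂ) → ℝ≥0∞) (L s : ℝ) (x : BlockCoord n) : ℝ≥0∞ :=
  charStat Φ (block x.1.1 x.1.2.1 x.2 (Matrix.of x.1.2.2)) *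
    ENNReal.ofReal (wt L s (block x.1.1 x.1.2.1 x.2 (Matrix.of x.1.2.2)))

lemma measurable_blockIntegrand {Φ : (ℕ → ℂ) → ℝ≥0∞} (hΦ : Measurable Φ) (L s : ℝ) :
    Measurable (blockIntegrand (n := n) Φ L s) := by
  have h1 : Measurable fun x : BlockCoord n => x.1 := measurable_fst
  have h4 : Measurable fun x : BlockCoord n => x.1.2.2 := h1.snd.snd
  have hb := measurable_block h1.fst h1.snd.fst (measurable_snd : Measurable fun x : BlockCoord n => x.2)
    (d := fun x => Matrix.of x.1.2.2)
    fun i j => measurable_pi_iff.1 (measurable_pi_iff.1 h4 i) j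
  exact (hΦ.comp (measurable_coeff_charpoly hb)).mul (measurable_wt L s hb).ennreal_ofReal

attribute [irreducible] columnIntegrand deflatedIntegrand blockIntegrand

lemma measurable_columnIntegrand_comp {Φ : (ℕ → ℂ) → ℝ≥0∞} (hΦ : Measurable Φ) (L s : ℝ) :
    Measurable fun y : (ℍ[ℝ] × (n → ℍ[ℝ]) × (n → n → ℍ[ℝ])) × (n → ℍ[ℝ]) =>
      columnIntegrand Φ L s y.2
        (y.1.1 + y.1.2.1 ⬝ᵥ y.2, y.1.2.1, fun i j => y.1.2.2 i j - y.2 i * y.1.2.1 j) := by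
  have h1 : Measurable fun y : (ℍ[ℝ] × (n → ℍ[ℝ]) × (n → n → ℍ[ℝ])) × (n → ℍ[ℝ]) => y.1 :=
    measurable_fst
  have h2 : Measurable fun y : (ℍ[ℝ] × (n → ℍ[ℝ]) × (n → n → ℍ[ℝ])) × (n → ℍ[ℝ]) => y.2 :=
    measurable_snd
  have h3 : Measurable fun y : (ℍ[ℝ] × (n → ℍ[ℝ]) × (n → n → ℍ[ℝ])) × (n → ℍ[ℝ]) =>
      fun i j : n => y.1.2.2 i j - y.2 i * y.1.2.1 j :=
    measurable_pi_iff.2 fun i => measurable_pi_iff.2 fun j =>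
      (measurable_pi_iff.1 (measurable_pi_iff.1 h1.snd.snd i) j).sub
        ((measurable_pi_iff.1 h2 i).mul (measurable_pi_iff.1 h1.snd.fst j))
  have h4 : Measurable fun y : (ℍ[ℝ] × (n → ℍ[ℝ]) × (n → n → ℍ[ℝ])) × (n → ℍ[ℝ]) =>
      y.1.1 + y.1.2.1 ⬝ᵥ y.2 := h1.fst.add (measurable_dotProduct h1.snd.fst h2)
  have h5 := (h4.prodMk (h1.snd.fst.prodMk h3)).prodMk h2
  exact (measurable_columnIntegrand (n := n) hΦ L s).comp h5

/-- Conjugation of the minor by the square root preserves volume, so the dependence on u factors out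
completely. -/
lemma lintegral_deflate_columnIntegrand {Φ : (ℕ → ℂ) → ℝ≥0∞} (hΦ : Measurable Φ) {L s : ℝ}
    {c : ℝ≥0∞} (H : ∀ (q : ℍ[ℝ]) (G : Matrix n n ℍ[ℝ]),
      ∫⁻ b : n → ℍ[ℝ], ENNReal.ofReal (wt L (s + 1) (block q b 0 G)) =
        c * (ENNReal.ofReal (‖q‖ ^ (4 * L) *
          (1 + ‖q‖ ^ 2) ^ (-(2 * (s + 1 - Fintype.card n)))) * ENNReal.ofReal (wt L s G)))
    (u : n → ℍ[ℝ]) :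
    ∫⁻ q : ℍ[ℝ], ∫⁻ G : n → n → ℍ[ℝ], ∫⁻ b : n → ℍ[ℝ], columnIntegrand Φ L (s + 1) u (q, b, G) =
      ENNReal.ofReal ((1 + ∑ i, ‖u i‖ ^ 2) ^ (-(2 * (Fintype.card n + 1) : ℝ))) * (c *
        ∫⁻ q : ℍ[ℝ], ∫⁻ G : n → n → ℍ[ℝ], deflatedIntegrand Φ L s q (Matrix.of G)) := by
  have hdm := measurable_deflatedIntegrand (n := n) hΦ L s
  simp only [lintegral_columnIntegrand H]
  generalize ENNReal.ofReal ((1 + ∑ i, ‖u i‖ ^ 2) ^ (-(2 * (Fintype.card n + 1) : ℝ))) = r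
  have hconj : ∀ q : ℍ[ℝ], ∫⁻ G : n → n → ℍ[ℝ], r * c *
        deflatedIntegrand Φ L s q (invSqrtOuter u * Matrix.of G * sqrtOuter u) =
      r * c * ∫⁻ G : n → n → ℍ[ℝ], deflatedIntegrand Φ L s q (Matrix.of G) := by
    intro q
    have hdq : Measurable fun G : n → n → ℍ[ℝ] => deflatedIntegrand Φ L s q (Matrix.of G) :=
      hdm.comp (measurable_prodMk_left (x := q))
    rw [← lintegral_const_mul _ hdq]
    exact lintegral_conjMat (sqrtOuter_conjTranspose u) (invSqrtOuter_mul_sqrtOuter u)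
      (sqrtOuter_mul_invSqrtOuter u) (fun G => r * c * deflatedIntegrand Φ L s q G)
  simp only [hconj]
  rw [lintegral_const_mul _ hdm.lintegral_prod_right', mul_assoc]

-- The order of integration is what matters: the column is replaced by u, then u is taken outermost,
-- so that for fixed u the other variables can be substituted freely. The remaining integral over u
-- is a constant.
set_option maxHeartbeats 400000 in
lemma lintegral_blockIntegrand {Φ : (ℕ → ℂ) → ℝ≥0∞} (hΦ : Measurable Φ) {L s : ℝ}
    {c : ℝ≥0∞} (H : ∀ (q : ℍ[ℝ]) (G : Matrix n n ℍ[ℝ]),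
      ∫⁻ b : n → ℍ[ℝ], ENNReal.ofReal (wt L (s + 1) (block q b 0 G)) =
        c * (ENNReal.ofReal (‖q‖ ^ (4 * L) *
          (1 + ‖q‖ ^ 2) ^ (-(2 * (s + 1 - Fintype.card n)))) * ENNReal.ofReal (wt L s G))) :
    (Fintype.card n + 1 : ℕ) * ∫⁻ x : BlockCoord n, blockIntegrand Φ L (s + 1) x =
      (∫⁻ x : n → ℍ[ℝ], ENNReal.ofReal
        ((1 + ∑ p, ‖x p‖ ^ 2) ^ (-(2 * (Fintype.card n + 1) : ℝ)))) * (c *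
        ∫⁻ q : ℍ[ℝ], ∫⁻ G : n → n → ℍ[ℝ], deflatedIntegrand Φ L s q (Matrix.of G)) := by
  have hF := measurable_blockIntegrand (n := n) hΦ L (s + 1)
  have hcol := measurable_columnIntegrand (n := n) hΦ L (s + 1)
  have hae : ∀ᵐ p : ℍ[ℝ] × (n → ℍ[ℝ]) × (n → n → ℍ[ℝ]), ∀ᵐ c : n → ℍ[ℝ],
      SimpleRoots (crep (block p.1 p.2.1 c (Matrix.of p.2.2))).charpoly ∧
        Observable p.2.1 (Matrix.of p.2.2) :=
    Measure.ae_ae_of_ae_prod (ae_simpleRoots_observable n)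
  calc _ = ∫⁻ p : ℍ[ℝ] × (n → ℍ[ℝ]) × (n → n → ℍ[ℝ]), (Fintype.card n + 1 : ℕ) *
        ∫⁻ c : n → ℍ[ℝ], blockIntegrand Φ L (s + 1) (p, c) := by
        rw [lintegral_const_mul _ hF.lintegral_prod_right']
        exact congrArg _ (lintegral_prod _ hF.aemeasurable)
    _ = ∫⁻ p : ℍ[ℝ] × (n → ℍ[ℝ]) × (n → n → ℍ[ℝ]), ∫⁻ u : n → ℍ[ℝ],
        columnIntegrand Φ L (s + 1) u
          (p.1 + p.2.1 ⬝ᵥ u, p.2.1, fun i j => p.2.2 i j - u i * p.2.1 j) := by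
        refine lintegral_congr_ae ?_
        filter_upwards [hae] with p hp
        rw [← lintegral_column hΦ L (s + 1) p.1 p.2.1 p.2.2 hp]
        simp only [blockIntegrand]
    _ = ∫⁻ u : n → ℍ[ℝ], ∫⁻ p : ℍ[ℝ] × (n → ℍ[ℝ]) × (n → n → ℍ[ℝ]),
        columnIntegrand Φ L (s + 1) u
          (p.1 + p.2.1 ⬝ᵥ u, p.2.1, fun i j => p.2.2 i j - u i * p.2.1 j) :=
        lintegral_lintegral_swap (measurable_columnIntegrand_comp hΦ L (s + 1)).aemeasurable
    _ = ∫⁻ u : n → ℍ[ℝ], ENNReal.ofReal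
          ((1 + ∑ i, ‖u i‖ ^ 2) ^ (-(2 * (Fintype.card n + 1) : ℝ))) * (c *
        ∫⁻ q : ℍ[ℝ], ∫⁻ G : n → n → ℍ[ℝ], deflatedIntegrand Φ L s q (Matrix.of G)) := by
        refine lintegral_congr fun u => ?_
        rw [← lintegral_deflate_columnIntegrand hΦ H u]
        exact lintegral_deflate u (hcol.comp measurable_prodMk_right)
    _ = _ := lintegral_mul_const _ (by fun_prop)

/-- Splitting one pair of eigenvalues off a quaternion matrix. -/
theorem exists_lintegral_block (s : ℝ) (hs : (Fintype.card n : ℝ) < s + 1) :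
    ∃ C : ℝ≥0∞, C ≠ 0 ∧ C ≠ ⊤ ∧ ∀ (L : ℝ) (Φ : (ℕ → ℂ) → ℝ≥0∞), Measurable Φ →
      ∫⁻ G : Unit ⊕ n → Unit ⊕ n → ℍ[ℝ], charStat Φ (Matrix.of G) *
          ENNReal.ofReal (wt L (s + 1) (Matrix.of G)) =
        C * ∫⁻ q : ℍ[ℝ], ∫⁻ G : n → n → ℍ[ℝ], deflatedIntegrand Φ L s q (Matrix.of G) := by
  obtain ⟨C₁, h1, h1', H1⟩ := exists_lintegral_comp_linearEquiv
    (volume : Measure (BlockCoord n)) (volume : Measure (Unit ⊕ n → Unit ⊕ n → ℍ[ℝ]))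
    (blockEquiv n)
  obtain ⟨c, h2, h2', H2⟩ := exists_lintegral_wt_block (n := n) s hs
  -- The integral over u converges: the real dimension 4k is less than the decay order 4 (k + 1),
  -- where k = card n.
  obtain ⟨h3, h3'⟩ := lintegral_bracket_pos_finite (m := n) (E := ℍ[ℝ])
    (2 * (Fintype.card n + 1)) (by
      rw [Module.finrank_pi_fintype]
      simp [Quaternion.finrank_eq_four]
      linarith)
  set B := ∫⁻ x : n → ℍ[ℝ], ENNReal.ofReal
    ((1 + ∑ p, ‖x p‖ ^ 2) ^ (-(2 * (Fintype.card n + 1) : ℝ))) with hB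
  have hk0 : ((Fintype.card n + 1 : ℕ) : ℝ≥0∞) ≠ 0 := by simp
  have hk' : ((Fintype.card n + 1 : ℕ) : ℝ≥0∞) ≠ ⊤ := ENNReal.natCast_ne_top _
  refine ⟨(C₁ * (Fintype.card n + 1 : ℕ))⁻¹ * (B * c), ?_, ?_, fun L Φ hΦ => ?_⟩
  · exact mul_ne_zero (ENNReal.inv_ne_zero.2 (ENNReal.mul_ne_top h1' hk')) (mul_ne_zero h3 h2)
  · exact ENNReal.mul_ne_top (ENNReal.inv_ne_top.2 (mul_ne_zero h1 hk0)) (ENNReal.mul_ne_top h3' h2')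
  have key := lintegral_blockIntegrand hΦ (H2 L)
  have hx : ∫⁻ x : BlockCoord n, blockIntegrand Φ L (s + 1) x =
      C₁ * ∫⁻ G : Unit ⊕ n → Unit ⊕ n → ℍ[ℝ], charStat Φ (Matrix.of G) *
          ENNReal.ofReal (wt L (s + 1) (Matrix.of G)) := by
    simp only [blockIntegrand]
    exact H1 (fun G => charStat Φ (Matrix.of G) * ENNReal.ofReal (wt L (s + 1) (Matrix.of G)))
  rw [hx, ← hB, ← mul_assoc B c] at key
  rw [mul_assoc, ← key, ← mul_assoc _ C₁, mul_comm _ C₁, ← mul_assoc,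
    ENNReal.inv_mul_cancel (mul_ne_zero h1 hk0) (ENNReal.mul_ne_top h1' hk'), one_mul]

end

section

/-! ## The distribution of the eigenvalues -/

section Reindex

variable {m m' : Type*} [Fintype m] [DecidableEq m] [Fintype m'] [DecidableEq m']

/-- Relabelling rows and columns. -/
def relabel (e : m ≃ m') : (m' → m' → ℍ[ℝ]) ≃ₗ[ℝ] (m → m → ℍ[ℝ]) where
  toFun G := fun i j => G (e i) (e j)
  map_add' _ _ := rfl
  map_smul' _ _ := rfl
  invFun G := fun i j => G (e.symm i) (e.symm j)
  left_inv G := by ext1 i; ext1 j; simp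
  right_inv G := by ext1 i; ext1 j; simp

lemma crep_submatrix_equiv (e : m ≃ m') (G : Matrix m' m' ℍ[ℝ]) :
    crep (G.submatrix e e) = (crep G).submatrix (e.prodCongr (Equiv.refl (Fin 2)))
      (e.prodCongr (Equiv.refl (Fin 2))) := rfl

lemma charpoly_crep_submatrix (e : m ≃ m') (G : Matrix m' m' ℍ[ℝ]) :
    (crep (G.submatrix e e)).charpoly = (crep G).charpoly := by
  rw [crep_submatrix_equiv]
  exact Matrix.charpoly_reindex (e.prodCongr (Equiv.refl (Fin 2))).symm (crep G)

lemma wt_submatrix (L s : ℝ) (e : m ≃ m') (G : Matrix m' m' ℍ[ℝ]) :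
    wt L s (G.submatrix e e) = wt L s G := by
  have h1 : (1 : Matrix (m × Fin 2) (m × Fin 2) ℂ) + (crep G).submatrix
      (e.prodCongr (Equiv.refl (Fin 2))) (e.prodCongr (Equiv.refl (Fin 2))) *
      ((crep G).submatrix (e.prodCongr (Equiv.refl (Fin 2)))
        (e.prodCongr (Equiv.refl (Fin 2))))ᴴ = (1 + crep G * (crep G)ᴴ).submatrix
        (e.prodCongr (Equiv.refl (Fin 2))) (e.prodCongr (Equiv.refl (Fin 2))) := by
    rw [Matrix.conjTranspose_submatrix, Matrix.submatrix_mul_equiv]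
    conv_lhs => rw [← Matrix.submatrix_one_equiv (e.prodCongr (Equiv.refl (Fin 2)))]
    rfl
  rw [wt, wt, crep_submatrix_equiv, h1, Matrix.det_submatrix_equiv_self,
    Matrix.det_submatrix_equiv_self]

end Reindex

lemma measurableSet_upperHalf (k : ℕ) : MeasurableSet (upperHalf k) := by
  have : upperHalf k = ⋂ i, {z | 0 < (z i).im} := by ext; simp [upperHalf]
  rw [this]
  exact MeasurableSet.iInter fun i =>
    measurableSet_lt measurable_const (Complex.measurable_im.comp (measurable_pi_apply i))

lemma measurableSet_upper : MeasurableSet {z : ℂ | 0 < z.im} :=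
  measurableSet_lt measurable_const Complex.measurable_im

lemma setLIntegral_upperHalf_succ (k : ℕ) {F : (Fin (k + 1) → ℂ) → ℝ≥0∞} (hF : Measurable F) :
    ∫⁻ z in upperHalf (k + 1), F z =
      ∫⁻ x in {z : ℂ | 0 < z.im}, ∫⁻ z in upperHalf k, F (Fin.cons x z) := by
  have h1 := (volume_preserving_piFinSuccAbove (fun _ : Fin (k + 1) => ℂ) 0).symm
  have h2 := h1.setLIntegral_comp_preimage_emb (MeasurableEquiv.measurableEmbedding _) F
    (upperHalf (k + 1))
  have h3 : (MeasurableEquiv.piFinSuccAbove (fun _ : Fin (k + 1) => ℂ) 0).symm ⁻¹'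
      upperHalf (k + 1) = {z : ℂ | 0 < z.im} ×ˢ upperHalf k := by
    ext x
    simp [upperHalf, MeasurableEquiv.piFinSuccAbove, Fin.forall_fin_succ]
  rw [h3] at h2
  have h4 : Measurable fun a : ℂ × (Fin k → ℂ) =>
      F ((MeasurableEquiv.piFinSuccAbove (fun _ : Fin (k + 1) => ℂ) 0).symm a) :=
    hF.comp (MeasurableEquiv.measurable _)
  rw [← h2]
  have h5 : (volume : Measure (ℂ × (Fin k → ℂ))).restrict ({z : ℂ | 0 < z.im} ×ˢ upperHalf k) =
      (volume.restrict {z : ℂ | 0 < z.im}).prod (volume.restrict (upperHalf k)) :=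
    (Measure.prod_restrict _ _).symm
  rw [h5]
  have h6 : ∀ (x : ℂ) (z : Fin k → ℂ),
      (MeasurableEquiv.piFinSuccAbove (fun _ : Fin (k + 1) => ℂ) 0).symm (x, z) =
        (Fin.cons x z : Fin (k + 1) → ℂ) := fun x z => by
    simp only [MeasurableEquiv.piFinSuccAbove, Fin.insertNthEquiv_zero]
    rfl
  refine (lintegral_prod (μ := volume.restrict {z : ℂ | 0 < z.im})
    (ν := volume.restrict (upperHalf k)) _ h4.aemeasurable).trans ?_
  simp only [h6]

/-- The characteristic polynomial with the roots `zᵢ` and their conjugates. -/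
def pairProd {k : ℕ} (z : Fin k → ℂ) : Polynomial ℂ := ∏ i, pairPoly (z i)

lemma pairProd_cons {k : ℕ} (x : ℂ) (z : Fin k → ℂ) :
    pairProd (Fin.cons x z : Fin (k + 1) → ℂ) = pairPoly x * pairProd z := by
  simp [pairProd, Fin.prod_univ_succ]

lemma monic_pairPoly (z : ℂ) : (pairPoly z).Monic :=
  (Polynomial.monic_X_sub_C _).mul (Polynomial.monic_X_sub_C _)

lemma natDegree_pairPoly (z : ℂ) : (pairPoly z).natDegree = 2 := by
  rw [pairPoly, (Polynomial.monic_X_sub_C _).natDegree_mul (Polynomial.monic_X_sub_C _)]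
  simp

lemma natDegree_pairProd {k : ℕ} (z : Fin k → ℂ) : (pairProd z).natDegree = 2 * k := by
  rw [pairProd, Polynomial.natDegree_prod_of_monic _ _ fun i _ => monic_pairPoly (z i)]
  simp [natDegree_pairPoly, mul_comm]

lemma norm_eval_pairProd {k : ℕ} (x : ℂ) (z : Fin k → ℂ) :
    ‖(pairProd z).eval x‖ ^ 2 = ∏ j, (‖x - z j‖ ^ 2 * ‖x - conj (z j)‖ ^ 2) := by
  simp [pairProd, pairPoly, Polynomial.eval_prod, norm_prod, mul_pow, Finset.prod_mul_distrib,
    Finset.prod_pow]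

lemma continuous_coeff_pairProd (k : ℕ) : Continuous fun z : Fin k → ℂ => (pairProd z).coeff := by
  induction k with
  | zero => simpa [pairProd] using continuous_const
  | succ k ih =>
    have h1 : ∀ z : Fin (k + 1) → ℂ,
        (pairProd z).coeff = mulPair (z 0) (pairProd (Fin.tail z)).coeff := fun z => by
      rw [← coeff_pairPoly_mul, ← pairProd_cons, Fin.cons_self_tail]
    simp only [h1]
    have h2 : Continuous fun z : Fin (k + 1) → ℂ => (pairProd (Fin.tail z)).coeff :=
      ih.comp (continuous_pi fun i => continuous_apply i.succ)
    have h3 : ∀ j, Continuous fun z : Fin (k + 1) → ℂ => (pairProd (Fin.tail z)).coeff j :=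
      fun j => (continuous_apply j).comp h2
    refine continuous_pi fun j => ?_
    have h4 := Complex.continuous_conj
    unfold mulPair
    split_ifs <;> fun_prop

/-- The weight of a single eigenvalue. -/
def eigWeight₁ (n L : ℝ) (z : ℂ) : ℝ :=
  z.im ^ 2 * (‖z‖ ^ (4 * L) * (1 + ‖z‖ ^ 2) ^ (-(2 * (n + L + 1))))

/-- The unnormalised joint density of the eigenvalues. -/
def eigWeight (n L : ℝ) {k : ℕ} (z : Fin k → ℂ) : ℝ :=
  (∏ i, eigWeight₁ n L (z i)) *
    ∏ i, ∏ j ∈ Finset.Ioi i, (‖z i - z j‖ ^ 2 * ‖z i - conj (z j)‖ ^ 2)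

lemma eigWeight₁_nonneg (n L : ℝ) (z : ℂ) : 0 ≤ eigWeight₁ n L z := by
  unfold eigWeight₁; positivity

lemma eigWeight_nonneg (n L : ℝ) {k : ℕ} (z : Fin k → ℂ) : 0 ≤ eigWeight n L z :=
  mul_nonneg (Finset.prod_nonneg fun _ _ => eigWeight₁_nonneg n L _)
    (Finset.prod_nonneg fun _ _ => Finset.prod_nonneg fun _ _ =>
      mul_nonneg (sq_nonneg _) (sq_nonneg _))

lemma eigWeight_cons (n L : ℝ) {k : ℕ} (x : ℂ) (z : Fin k → ℂ) :
    eigWeight n L (Fin.cons x z : Fin (k + 1) → ℂ) =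
      eigWeight₁ n L x * ‖(pairProd z).eval x‖ ^ 2 * eigWeight n L z := by
  rw [norm_eval_pairProd, eigWeight, eigWeight]
  simp only [Fin.prod_univ_succ, Fin.cons_zero, Fin.cons_succ, Fin.prod_Ioi_zero, Fin.prod_Ioi_succ]
  ring

lemma continuous_eigWeight {n L : ℝ} (hL : 0 ≤ L) (k : ℕ) :
    Continuous fun z : Fin k → ℂ => eigWeight n L z := by
  have h1 : Continuous (eigWeight₁ n L) := by
    unfold eigWeight₁
    refine (Complex.continuous_im.pow 2).mul (Continuous.mul ?_ ?_)
    · exact continuous_norm.rpow_const fun x => Or.inr (by positivity)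
    · exact ((continuous_norm.pow 2).const_add 1).rpow_const fun x => Or.inl
        (by have : (0 : ℝ) < 1 + ‖x‖ ^ 2 := by positivity
            exact this.ne')
  unfold eigWeight
  refine Continuous.mul ?_ ?_
  · exact continuous_finsetProd _ fun i _ => h1.comp (continuous_apply i)
  · refine continuous_finsetProd _ fun i _ => continuous_finsetProd _ fun j _ => ?_
    have := Complex.continuous_conj
    fun_prop

/-- The distribution of the characteristic polynomial. -/
theorem exists_lintegral_charStat {n L : ℝ} (hn : 0 ≤ n) (hL : 0 ≤ L) (k : ℕ) :
    ∃ C : ℝ≥0∞, C ≠ 0 ∧ C ≠ ⊤ ∧ ∀ Φ : (ℕ → ℂ) → ℝ≥0∞, Measurable Φ →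
      ∫⁻ G : Fin k → Fin k → ℍ[ℝ], charStat Φ (Matrix.of G) *
          ENNReal.ofReal (wt L (n + k + L) (Matrix.of G)) =
        C * ∫⁻ z in upperHalf k, Φ (pairProd z).coeff * ENNReal.ofReal (eigWeight n L z) := by
  induction k with
  | zero =>
    refine ⟨1, one_ne_zero, ENNReal.one_ne_top, fun Φ hΦ => ?_⟩
    have h1 : upperHalf 0 = Set.univ := Set.eq_univ_of_forall fun z i => i.elim0
    rw [h1, setLIntegral_univ, volume_pi, Measure.pi_of_empty, volume_pi, Measure.pi_of_empty,
      lintegral_dirac, lintegral_dirac, one_mul]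
    congr 1
    · simp [charStat, pairProd, Matrix.charpoly]
    · simp [wt, eigWeight]
  | succ k ih =>
    obtain ⟨C₁, h1, h1', H1⟩ := ih
    have hs : (Fintype.card (Fin k) : ℝ) < (n + k + L) + 1 := by
      rw [Fintype.card_fin]; linarith
    obtain ⟨C₂, h2, h2', H2⟩ := exists_lintegral_block (n := Fin k) (n + k + L) hs
    obtain ⟨C₃, h3, h3', H3⟩ := exists_lintegral_lam
    let e : Unit ⊕ Fin k ≃ Fin (k + 1) :=
      (Fintype.equivFinOfCardEq (by simp [add_comm]))
    obtain ⟨C₄, h4, h4', H4⟩ := exists_lintegral_comp_linearEquiv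
      (volume : Measure (Fin (k + 1) → Fin (k + 1) → ℍ[ℝ]))
      (volume : Measure (Unit ⊕ Fin k → Unit ⊕ Fin k → ℍ[ℝ])) (relabel e)
    refine ⟨C₄ * C₂ * C₃ * C₁, by simp [h1, h2, h3, h4], ?_, fun Φ hΦ => ?_⟩
    · exact ENNReal.mul_ne_top (ENNReal.mul_ne_top (ENNReal.mul_ne_top h4' h2') h3') h1'
    have e1 := H4 fun G => charStat Φ (Matrix.of G) *
      ENNReal.ofReal (wt L (n + k + L + 1) (Matrix.of G))
    have e2 : ∀ G : Fin (k + 1) → Fin (k + 1) → ℍ[ℝ],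
        charStat Φ (Matrix.of (relabel e G)) *
          ENNReal.ofReal (wt L (n + k + L + 1) (Matrix.of (relabel e G))) =
        charStat Φ (Matrix.of G) *
          ENNReal.ofReal (wt L (n + (k + 1 : ℕ) + L) (Matrix.of G)) := by
      intro G
      have e3 : Matrix.of (relabel e G) = (Matrix.of G).submatrix e e := rfl
      rw [e3, charStat, charpoly_crep_submatrix, wt_submatrix, charStat]
      have e4 : n + k + L + 1 = n + (k + 1 : ℕ) + L := by push_cast; ring
      rw [e4]
    simp only [e2] at e1
    have hw : ∀ q : ℍ[ℝ], ∫⁻ G : Fin k → Fin k → ℍ[ℝ],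
        deflatedIntegrand Φ L (n + k + L) q (Matrix.of G) =
        (fun x : ℂ => ENNReal.ofReal (‖x‖ ^ (4 * L) * (1 + ‖x‖ ^ 2) ^ (-(2 * (n + L + 1)))) *
          (C₁ * ∫⁻ z in upperHalf k, pairFactor Φ k x (pairProd z).coeff *
            ENNReal.ofReal (eigWeight n L z))) (lam q) := by
      intro q
      -- The dependence on k cancels, so every eigenvalue receives the same weight in the induction.
      have e4 : n + k + L + 1 - (Fintype.card (Fin k) : ℝ) = n + L + 1 := by
        rw [Fintype.card_fin]; ring
      simp only [deflatedIntegrand, e4, norm_lam]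
      rw [lintegral_const_mul' _ _ ENNReal.ofReal_ne_top]
      congr 1
      have := H1 (pairFactor Φ k (lam q))
        (measurable_pairFactor hΦ k measurable_const measurable_id)
      simpa only [Fintype.card_fin, charStat] using this
    have hpm : Measurable fun y : ℂ × (Fin k → ℂ) => pairFactor Φ k y.1 (pairProd y.2).coeff *
        ENNReal.ofReal (eigWeight n L y.2) :=
      (measurable_pairFactor hΦ k measurable_fst
        ((continuous_coeff_pairProd k).measurable.comp measurable_snd)).mul
        ((continuous_eigWeight hL k).measurable.comp measurable_snd).ennreal_ofReal
    have hpm' : Measurable fun x : ℂ => ∫⁻ z in upperHalf k, pairFactor Φ k x (pairProd z).coeff *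
        ENNReal.ofReal (eigWeight n L z) := hpm.lintegral_prod_right'
    rw [e1, H2 L Φ hΦ]
    simp only [hw]
    have hwm : Measurable fun x : ℂ =>
        ENNReal.ofReal (‖x‖ ^ (4 * L) * (1 + ‖x‖ ^ 2) ^ (-(2 * (n + L + 1)))) *
          (C₁ * ∫⁻ z in upperHalf k, pairFactor Φ k x (pairProd z).coeff *
            ENNReal.ofReal (eigWeight n L z)) := by
      refine Measurable.mul (Measurable.ennreal_ofReal ?_) (hpm'.const_mul C₁)
      exact (measurable_norm.pow_const _).mul (((measurable_norm.pow_const 2).const_add 1).pow_const _)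
    have hFm : Measurable fun z : Fin (k + 1) → ℂ =>
        Φ (pairProd z).coeff * ENNReal.ofReal (eigWeight n L z) :=
      (hΦ.comp (continuous_coeff_pairProd (k + 1)).measurable).mul
        (continuous_eigWeight hL (k + 1)).measurable.ennreal_ofReal
    rw [H3 _ hwm, setLIntegral_upperHalf_succ k hFm]
    have e5 : ∀ x : ℂ, ENNReal.ofReal (x.im ^ 2) *
        (ENNReal.ofReal (‖x‖ ^ (4 * L) * (1 + ‖x‖ ^ 2) ^ (-(2 * (n + L + 1)))) *
          (C₁ * ∫⁻ z in upperHalf k, pairFactor Φ k x (pairProd z).coeff *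
            ENNReal.ofReal (eigWeight n L z))) =
        C₁ * ∫⁻ z in upperHalf k, Φ (pairProd (Fin.cons x z : Fin (k + 1) → ℂ)).coeff *
            ENNReal.ofReal (eigWeight n L (Fin.cons x z : Fin (k + 1) → ℂ)) := by
      intro x
      have e6 : ∀ z : Fin k → ℂ, Φ (pairProd (Fin.cons x z : Fin (k + 1) → ℂ)).coeff *
            ENNReal.ofReal (eigWeight n L (Fin.cons x z : Fin (k + 1) → ℂ)) =
          ENNReal.ofReal (eigWeight₁ n L x) * (pairFactor Φ k x (pairProd z).coeff *
            ENNReal.ofReal (eigWeight n L z)) := by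
        intro z
        rw [pairFactor_coeff Φ k x (natDegree_pairProd z), pairProd_cons, eigWeight_cons,
          ENNReal.ofReal_mul (mul_nonneg (eigWeight₁_nonneg n L x) (by positivity)),
          ENNReal.ofReal_mul (eigWeight₁_nonneg n L x)]
        ring
      simp only [e6]
      rw [lintegral_const_mul' _ _ ENNReal.ofReal_ne_top, eigWeight₁,
        ENNReal.ofReal_mul (sq_nonneg x.im)]
      ring
    simp only [e5]
    rw [lintegral_const_mul' _ _ h1']
    ring

end

/-! ## The joint density as a determinant -/

/-- The eigenvalues and their conjugates. -/
def withConj {k : ℕ} (z : Fin k → ℂ) (p : Fin k × Fin 2) : ℂ := ![z p.1, conj (z p.1)] p.2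

/-- The Vandermonde matrix of the eigenvalues and their conjugates. -/
def pairVandermonde {k : ℕ} (z : Fin k → ℂ) : Matrix (Fin k × Fin 2) (Fin k × Fin 2) ℂ :=
  Matrix.of fun p c => withConj z p ^ (finProdFinEquiv c : ℕ)

/-- The product of the interaction factors. -/
def interaction {k : ℕ} (z : Fin k → ℂ) : ℝ :=
  ∏ i, ∏ j ∈ Finset.Ioi i, (‖z i - z j‖ ^ 2 * ‖z i - conj (z j)‖ ^ 2)

lemma eigWeight_eq (n L : ℝ) {k : ℕ} (z : Fin k → ℂ) :
    eigWeight n L z = (∏ i, eigWeight₁ n L (z i)) * interaction z := rfl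

lemma finProdFinEquiv_lt_iff {k : ℕ} (p q : Fin k × Fin 2) :
    finProdFinEquiv p < finProdFinEquiv q ↔ p.1 < q.1 ∨ (p.1 = q.1 ∧ p.2 < q.2) := by
  obtain ⟨i, a⟩ := p
  obtain ⟨j, b⟩ := q
  simp only [Fin.lt_def, finProdFinEquiv_apply_val, Fin.ext_iff]
  have := a.2
  have := b.2
  omega

/-- In the Vandermonde product a point and its own conjugate contribute conj z_i - z_i, while the
four differences between two pairs combine to |z_i - z_j|² |z_i - conj z_j|². The lexicographic
numbering keeps each pair together. -/
lemma det_pairVandermonde {k : ℕ} (z : Fin k → ℂ) :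
    (pairVandermonde z).det = (∏ i, (conj (z i) - z i)) * ((interaction z : ℝ) : ℂ) := by
  have h1 : pairVandermonde z = (Matrix.vandermonde
      (fun a => withConj z (finProdFinEquiv.symm a))).submatrix finProdFinEquiv finProdFinEquiv := by
    ext p c
    simp only [pairVandermonde, Matrix.of_apply, Matrix.submatrix_apply, Matrix.vandermonde_apply,
      Equiv.symm_apply_apply]
  have h2 : ∀ a : Fin (k * 2), ∏ b ∈ Finset.Ioi a,
      (withConj z (finProdFinEquiv.symm b) - withConj z (finProdFinEquiv.symm a)) =
      ∏ b, if a < b then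
        (withConj z (finProdFinEquiv.symm b) - withConj z (finProdFinEquiv.symm a)) else 1 := by
    intro a
    rw [← Finset.prod_filter]
    congr 1
    ext b
    simp
  rw [h1, Matrix.det_submatrix_equiv_self, Matrix.det_vandermonde]
  simp only [h2]
  rw [← Equiv.prod_comp finProdFinEquiv]
  simp only [← Equiv.prod_comp finProdFinEquiv (fun b => if _ < b then _ else _),
    Equiv.symm_apply_apply, finProdFinEquiv_lt_iff]
  simp only [Fintype.prod_prod_type, Fin.prod_univ_two]
  have h3 : ∀ i j : Fin k, ((if i < j ∨ (i = j ∧ (0 : Fin 2) < 0) then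
      withConj z (j, 0) - withConj z (i, 0) else 1) *
      (if i < j ∨ (i = j ∧ (0 : Fin 2) < 1) then withConj z (j, 1) - withConj z (i, 0) else 1)) *
      ((if i < j ∨ (i = j ∧ (1 : Fin 2) < 0) then withConj z (j, 0) - withConj z (i, 1) else 1) *
      (if i < j ∨ (i = j ∧ (1 : Fin 2) < 1) then withConj z (j, 1) - withConj z (i, 1) else 1)) =
      (if i = j then conj (z i) - z i else 1) *
        (if i < j then ((‖z i - z j‖ ^ 2 * ‖z i - conj (z j)‖ ^ 2 : ℝ) : ℂ) else 1) := by
    intro i j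
    have e1 : ((‖z i - z j‖ ^ 2 : ℝ) : ℂ) = (z j - z i) * (conj (z j) - conj (z i)) := by
      rw [norm_sub_rev, ← Complex.normSq_eq_norm_sq, ← Complex.mul_conj, map_sub]
    have e2 : ((‖z i - conj (z j)‖ ^ 2 : ℝ) : ℂ) = (conj (z j) - z i) * (z j - conj (z i)) := by
      rw [norm_sub_rev, ← Complex.normSq_eq_norm_sq, ← Complex.mul_conj, map_sub, Complex.conj_conj]
    rcases lt_trichotomy i j with h | h | h
    · rw [Complex.ofReal_mul, e1, e2]
      simp [h, h.ne, withConj]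
      ring
    · subst h
      simp [withConj]
    · simp [h.not_gt, h.ne', withConj]
  simp only [← Finset.prod_mul_distrib, h3]
  simp only [Finset.prod_mul_distrib, Finset.prod_ite_eq, Finset.mem_univ, if_true]
  congr 1
  rw [interaction]
  push_cast
  refine Finset.prod_congr rfl fun i _ => ?_
  rw [← Finset.prod_filter]
  refine Finset.prod_congr ?_ fun j _ => ?_
  · ext j; simp
  · rfl

lemma interaction_nonneg {k : ℕ} (z : Fin k → ℂ) : 0 ≤ interaction z :=
  Finset.prod_nonneg fun _ _ => Finset.prod_nonneg fun _ _ =>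
    mul_nonneg (sq_nonneg _) (sq_nonneg _)

lemma conj_sub_self_ne_zero {z : ℂ} (hz : 0 < z.im) : conj z - z ≠ 0 := by
  intro h
  have := congrArg Complex.im h
  simp at this
  linarith

/-- A permutation of the points permutes the rows of the Vandermonde matrix, so the determinant
keeps its modulus. The prefactor ∏ (conj z_i - z_i) is symmetric and nonzero in the upper half
plane, and can be cancelled. -/
lemma interaction_comp_perm {k : ℕ} {z : Fin k → ℂ} (hz : z ∈ upperHalf k)
    (σ : Equiv.Perm (Fin k)) : interaction (z ∘ σ) = interaction z := by
  have h1 : pairVandermonde (z ∘ σ) =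
      (pairVandermonde z).submatrix (σ.prodCongr (Equiv.refl (Fin 2))) id := by
    ext p c
    rfl
  have h2 := congrArg (fun A => ‖Matrix.det A‖) h1
  simp only [Matrix.det_permute, norm_mul, det_pairVandermonde] at h2
  have h3 : ‖((Equiv.Perm.sign (σ.prodCongr (Equiv.refl (Fin 2))) : ℤ) : ℂ)‖ = 1 := by
    rcases Int.units_eq_one_or (Equiv.Perm.sign (σ.prodCongr (Equiv.refl (Fin 2)))) with h | h <;>
      simp [h]
  rw [h3, one_mul, show (∏ i, (conj ((z ∘ σ) i) - (z ∘ σ) i)) = ∏ i, (conj (z i) - z i) from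
    Equiv.prod_comp σ fun i => conj (z i) - z i] at h2
  have h4 : ‖∏ i, (conj (z i) - z i)‖ ≠ 0 :=
    norm_ne_zero_iff.2 (Finset.prod_ne_zero_iff.2 fun i _ => conj_sub_self_ne_zero (hz i))
  have h5 := mul_left_cancel₀ h4 h2
  simpa [abs_of_nonneg (interaction_nonneg _)] using h5

lemma eigWeight_comp_perm (n L : ℝ) {k : ℕ} {z : Fin k → ℂ} (hz : z ∈ upperHalf k)
    (σ : Equiv.Perm (Fin k)) : eigWeight n L (z ∘ σ) = eigWeight n L z := by
  rw [eigWeight_eq, eigWeight_eq, interaction_comp_perm hz]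
  congr 1
  exact Equiv.prod_comp σ fun i => eigWeight₁ n L (z i)

/-! ### An integrable bound -/

/-- Each index occurs in k - 1 of the pairs. -/
lemma exists_prod_pairs_eq (k : ℕ) : ∃ K : ℝ, 0 ≤ K ∧ ∀ a : Fin k → ℝ,
    ∏ i, ∏ j ∈ Finset.Ioi i, (4 * (a i * a j)) = K * ∏ i, a i ^ (k - 1) := by
  induction k with
  | zero => exact ⟨1, zero_le_one, fun a => by simp⟩
  | succ k ih =>
    obtain ⟨K, hK, h⟩ := ih
    refine ⟨4 ^ k * K, by positivity, fun a => ?_⟩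
    simp only [Fin.prod_univ_succ, Fin.prod_Ioi_zero, Fin.prod_Ioi_succ]
    rw [h fun i => a i.succ, Finset.prod_mul_distrib, Finset.prod_mul_distrib]
    simp only [Finset.prod_const, Finset.card_univ, Fintype.card_fin, Nat.add_sub_cancel]
    have h1 : (∏ i : Fin k, a i.succ) * ∏ i : Fin k, a i.succ ^ (k - 1) =
        ∏ i : Fin k, a i.succ ^ k := by
      rw [← Finset.prod_mul_distrib]
      refine Finset.prod_congr rfl fun i _ => ?_
      rw [← pow_succ', Nat.sub_add_cancel (Nat.one_le_of_lt i.2)]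
    rw [← h1]
    ring

/-- Each distance squared is at most 2 (1 + |a|²) (1 + |b|²). The two distances of a pair thus give
4 times the squares of these brackets, and counting pairs gives the exponent 2 (k - 1). -/
lemma exists_interaction_le (k : ℕ) : ∃ K : ℝ, 0 ≤ K ∧ ∀ z : Fin k → ℂ,
    interaction z ≤ K * ∏ i, (1 + ‖z i‖ ^ 2) ^ (2 * (k - 1)) := by
  have hb : ∀ a b : ℂ, ‖a - b‖ ^ 2 ≤ 2 * ((1 + ‖a‖ ^ 2) * (1 + ‖b‖ ^ 2)) := by
    intro a b
    have h1 := norm_sub_le a b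
    have h2 : ‖a - b‖ ^ 2 ≤ (‖a‖ + ‖b‖) ^ 2 := pow_le_pow_left₀ (norm_nonneg _) h1 2
    nlinarith [sq_nonneg (‖a‖ - ‖b‖), mul_nonneg (sq_nonneg ‖a‖) (sq_nonneg ‖b‖)]
  obtain ⟨K, hK, h⟩ := exists_prod_pairs_eq k
  refine ⟨K, hK, fun z => ?_⟩
  have h1 := h fun i => (1 + ‖z i‖ ^ 2) ^ 2
  simp only [← pow_mul] at h1
  rw [← h1]
  refine Finset.prod_le_prod (fun _ _ => Finset.prod_nonneg fun _ _ =>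
    mul_nonneg (sq_nonneg _) (sq_nonneg _)) fun i _ => ?_
  refine Finset.prod_le_prod (fun _ _ => mul_nonneg (sq_nonneg _) (sq_nonneg _)) fun j _ => ?_
  have e1 := hb (z i) (z j)
  have e2 := hb (z i) (conj (z j))
  rw [RCLike.norm_conj] at e2
  calc _ ≤ (2 * ((1 + ‖z i‖ ^ 2) * (1 + ‖z j‖ ^ 2))) * (2 * ((1 + ‖z i‖ ^ 2) * (1 + ‖z j‖ ^ 2))) :=
        mul_le_mul e1 e2 (by positivity) (by positivity)
    _ = _ := by ring

/-- An integrable function that bounds the joint density in each variable. -/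
def bracket (z : ℂ) : ℝ := (1 + ‖z‖ ^ 2) ^ (-3 : ℝ)

lemma integrable_bracket : Integrable bracket := by
  have := integrable_rpow_neg_one_add_norm_sq (E := ℂ) (μ := volume) (r := 6)
    (by rw [Complex.finrank_real_complex]; norm_num)
  refine this.congr (Filter.Eventually.of_forall fun z => ?_)
  norm_num [bracket]

/-- Powers of 1 + |z|² are counted: 1 + 2L - 2(n + L + 1) + 2(k - 1) = 2k - 2n - 3, which is at most
-3 because k ≤ n. Integrability of the joint density rests on this inequality. -/
lemma eigWeight₁_mul_le {n L : ℝ} (hL : 0 ≤ L) {k : ℕ} (hk : 1 ≤ k) (hkn : (k : ℝ) ≤ n) (z : ℂ) :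
    eigWeight₁ n L z * (1 + ‖z‖ ^ 2) ^ (2 * (k - 1)) ≤ bracket z := by
  have ht : 1 ≤ 1 + ‖z‖ ^ 2 := by nlinarith [sq_nonneg ‖z‖]
  have ht0 : 0 < 1 + ‖z‖ ^ 2 := by positivity
  have h1 : z.im ^ 2 ≤ (1 + ‖z‖ ^ 2) ^ (1 : ℝ) := by
    rw [Real.rpow_one, ← Complex.normSq_eq_norm_sq, Complex.normSq_apply]
    nlinarith [sq_nonneg z.re]
  have h2 : ‖z‖ ^ (4 * L) ≤ (1 + ‖z‖ ^ 2) ^ (2 * L) := by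
    have : ‖z‖ ^ (4 * L) = (‖z‖ ^ 2) ^ (2 * L) := by
      rw [← Real.rpow_natCast, ← Real.rpow_mul (norm_nonneg _)]
      congr 1; push_cast; ring
    rw [this]
    exact Real.rpow_le_rpow (by positivity) (by linarith) (by positivity)
  have h3 : (1 + ‖z‖ ^ 2) ^ (2 * (k - 1)) = (1 + ‖z‖ ^ 2) ^ (2 * ((k : ℝ) - 1)) := by
    rw [← Real.rpow_natCast]
    congr 1
    push_cast [Nat.cast_sub hk]
    ring
  rw [h3]
  calc eigWeight₁ n L z * (1 + ‖z‖ ^ 2) ^ (2 * ((k : ℝ) - 1)) ≤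
      ((1 + ‖z‖ ^ 2) ^ (1 : ℝ) * ((1 + ‖z‖ ^ 2) ^ (2 * L) *
        (1 + ‖z‖ ^ 2) ^ (-(2 * (n + L + 1))))) * (1 + ‖z‖ ^ 2) ^ (2 * ((k : ℝ) - 1)) := by
        unfold eigWeight₁
        gcongr
    _ = (1 + ‖z‖ ^ 2) ^ (2 * (k : ℝ) - 2 * n - 3) := by
        rw [← Real.rpow_add ht0, ← Real.rpow_add ht0, ← Real.rpow_add ht0]
        congr 1; ring
    _ ≤ bracket z := Real.rpow_le_rpow_of_exponent_le ht (by linarith)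

lemma exists_eigWeight_le {n L : ℝ} (hL : 0 ≤ L) {k : ℕ} (hkn : (k : ℝ) ≤ n) :
    ∃ K : ℝ, 0 ≤ K ∧ ∀ z : Fin k → ℂ, eigWeight n L z ≤ K * ∏ i, bracket (z i) := by
  obtain ⟨K, hK, h⟩ := exists_interaction_le k
  refine ⟨K, hK, fun z => ?_⟩
  calc eigWeight n L z ≤ (∏ i, eigWeight₁ n L (z i)) *
        (K * ∏ i, (1 + ‖z i‖ ^ 2) ^ (2 * (k - 1))) :=
        mul_le_mul_of_nonneg_left (h z) (Finset.prod_nonneg fun _ _ => eigWeight₁_nonneg _ _ _)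
    _ = K * ∏ i, (eigWeight₁ n L (z i) * (1 + ‖z i‖ ^ 2) ^ (2 * (k - 1))) := by
        rw [Finset.prod_mul_distrib]; ring
    _ ≤ _ := by
        refine mul_le_mul_of_nonneg_left (Finset.prod_le_prod (fun i _ =>
          mul_nonneg (eigWeight₁_nonneg _ _ _) (by positivity)) fun i _ => ?_) hK
        exact eigWeight₁_mul_le hL (Nat.one_le_of_lt i.2) hkn _

lemma integrable_prod_bracket (k : ℕ) : Integrable fun z : Fin k → ℂ => ∏ i, bracket (z i) :=
  Integrable.fintype_prod fun _ => integrable_bracket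

lemma integrable_eigWeight {n L : ℝ} (hL : 0 ≤ L) {k : ℕ} (hkn : (k : ℝ) ≤ n) :
    Integrable fun z : Fin k → ℂ => eigWeight n L z := by
  obtain ⟨K, hK, h⟩ := exists_eigWeight_le hL hkn
  refine ((integrable_prod_bracket k).const_mul K).mono'
    (continuous_eigWeight hL k).aestronglyMeasurable (Filter.Eventually.of_forall fun z => ?_)
  rw [Real.norm_eq_abs, abs_of_nonneg (eigWeight_nonneg n L z)]
  exact h z

lemma isOpen_upperHalf (k : ℕ) : IsOpen (upperHalf k) := by
  have : upperHalf k = ⋂ i, {z | 0 < (z i).im} := by ext; simp [upperHalf]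
  rw [this]
  exact isOpen_iInter_of_finite fun i =>
    isOpen_lt continuous_const (Complex.continuous_im.comp (continuous_apply i))

lemma setLIntegral_eigWeight_ne_top {n L : ℝ} (hL : 0 ≤ L) {k : ℕ} (hkn : (k : ℝ) ≤ n) :
    ∫⁻ z in upperHalf k, ENNReal.ofReal (eigWeight n L z) ≠ ⊤ :=
  ((integrable_eigWeight hL hkn).lintegral_lt_top.trans_le' (setLIntegral_le_lintegral _ _)).ne

lemma setLIntegral_eigWeight_ne_zero {n L : ℝ} (hL : 0 ≤ L) (k : ℕ) :
    ∫⁻ z in upperHalf k, ENNReal.ofReal (eigWeight n L z) ≠ 0 := by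
  have hc := continuous_eigWeight (n := n) hL k
  set U := upperHalf k ∩ {z | 0 < eigWeight n L z} with hU
  have hUo : IsOpen U := (isOpen_upperHalf k).inter (isOpen_lt continuous_const hc)
  have hne : U.Nonempty := by
    -- Distinct points on the positive imaginary axis: no factor of the density vanishes there.
    refine ⟨fun i => ⟨0, (i : ℕ) + 1⟩, fun i => ?_, ?_⟩
    · change (0 : ℝ) < (i : ℕ) + 1; positivity
    · rw [Set.mem_ofPred_eq, eigWeight]
      refine mul_pos (Finset.prod_pos fun i _ => ?_) (Finset.prod_pos fun i _ =>
        Finset.prod_pos fun j hj => ?_)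
      · have h0 : (0 : ℝ) < (i : ℕ) + 1 := by positivity
        have h1 : (⟨0, (i : ℕ) + 1⟩ : ℂ) ≠ 0 := fun h => by
          have := congrArg Complex.im h
          simp at this
          linarith
        have := norm_pos_iff.2 h1
        unfold eigWeight₁
        positivity
      · have hij : ((i : ℕ) : ℝ) < (j : ℕ) := by exact_mod_cast Finset.mem_Ioi.1 hj
        refine mul_pos (pow_pos (norm_pos_iff.2 fun h => ?_) 2)
          (pow_pos (norm_pos_iff.2 fun h => ?_) 2)
        · have := congrArg Complex.im h
          simp at this
          linarith
        · have := congrArg Complex.im h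
          simp at this
          have : (0 : ℝ) ≤ (i : ℕ) := Nat.cast_nonneg _
          linarith
  intro h0
  rw [lintegral_eq_zero_iff hc.measurable.ennreal_ofReal] at h0
  have h1 : ∀ᵐ z : Fin k → ℂ, z ∈ upperHalf k → ENNReal.ofReal (eigWeight n L z) = 0 :=
    (ae_restrict_iff' (measurableSet_upperHalf k)).1 h0
  refine (hUo.measure_pos volume hne).ne' (measure_mono_null ?_ h1)
  intro z hz h2
  exact (ENNReal.ofReal_pos.2 hz.2).ne' (h2 hz.1)

/-! ## Existence of the joint density -/

open Classical in
lemma filter_roots_pairProd {k : ℕ} {z : Fin k → ℂ} (hz : z ∈ upperHalf k) :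
    (pairProd z).roots.filter (fun x => 0 < x.im) = (List.ofFn z : Multiset ℂ) := by
  induction k with
  | zero => simp [pairProd]
  | succ k ih =>
    have h1 : (pairProd (Fin.tail z)).Monic :=
      Polynomial.monic_prod_of_monic _ _ fun i _ => monic_pairPoly _
    have h2 : pairProd z = pairPoly (z 0) * pairProd (Fin.tail z) := by
      rw [← pairProd_cons, Fin.cons_self_tail]
    have h3 : (pairPoly (z 0)).roots = {z 0} + {conj (z 0)} := by
      rw [pairPoly, Polynomial.roots_mul, Polynomial.roots_X_sub_C, Polynomial.roots_X_sub_C]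
      exact ((Polynomial.monic_X_sub_C _).mul (Polynomial.monic_X_sub_C _)).ne_zero
    have h4 := hz 0
    rw [h2, Polynomial.roots_mul ((monic_pairPoly _).mul h1).ne_zero, h3, Multiset.filter_add,
      Multiset.filter_add, ih (z := Fin.tail z) (fun i => hz i.succ), List.ofFn_succ]
    simp [Multiset.filter_singleton, h4, h4.le, not_lt.2]
    rfl

/-- Equal multisets mean that the fibres of z and w over each value have the same size; gluing
bijections of the fibres gives the permutation. -/
lemma exists_perm_of_ofFn_eq {k : ℕ} {z w : Fin k → ℂ}
    (h : (List.ofFn z : Multiset ℂ) = List.ofFn w) : ∃ σ : Equiv.Perm (Fin k), w = z ∘ σ := by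
  classical
  have h1 : ∀ x, Nonempty ({i // w i = x} ≃ {i // z i = x}) := by
    intro x
    have h2 := congrArg (Multiset.count x) h
    rw [← Fin.univ_val_map, ← Fin.univ_val_map, Multiset.count_map, Multiset.count_map] at h2
    refine ⟨Fintype.equivOfCardEq ?_⟩
    rw [Fintype.card_subtype, Fintype.card_subtype]
    simp only [eq_comm (b := x)] at *
    simpa [Finset.card, Finset.filter_val, eq_comm] using h2.symm
  have e := fun x => (h1 x).some
  refine ⟨(Equiv.sigmaFiberEquiv w).symm.trans
    ((Equiv.sigmaCongrRight fun x => e x).trans (Equiv.sigmaFiberEquiv z)), ?_⟩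
  ext1 i
  exact ((e (w i)) ⟨i, rfl⟩).2.symm

lemma exists_perm_of_pairProd_eq {k : ℕ} {z w : Fin k → ℂ} (hz : z ∈ upperHalf k)
    (hw : w ∈ upperHalf k) (h : pairProd z = pairProd w) :
    ∃ σ : Equiv.Perm (Fin k), w = z ∘ σ := by
  classical
  refine exists_perm_of_ofFn_eq ?_
  rw [← filter_roots_pairProd hz, ← filter_roots_pairProd hw, h]

lemma exists_perm_eigenvalueList {N : ℕ} {G : Matrix (Fin N) (Fin N) ℍ[ℝ]} {z : Fin N → ℂ}
    (hz : z ∈ upperHalf N) (h : (crep G).charpoly = pairProd z) :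
    ∃ σ : Equiv.Perm (Fin N), eigenvalueList G = z ∘ σ := by
  classical
  refine exists_perm_of_ofFn_eq ?_
  have h1 : upperEigenvalues G = (List.ofFn z : Multiset ℂ) := by
    rw [← filter_roots_pairProd hz, ← h]
    unfold upperEigenvalues
    rw [complexRep_eq_crep]
  have hlen : (upperEigenvalues G).toList.length = N := by
    rw [Multiset.length_toList, h1]
    simp
  have h2 : List.ofFn (eigenvalueList G) = (upperEigenvalues G).toList := by
    refine List.ext_getElem (by simp [hlen]) fun i hi hi' => ?_
    rw [List.getElem_ofFn]
    simp only [eigenvalueList, List.getD_eq_getElem?_getD, List.getElem?_eq_getElem hi',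
      Option.getD_some]
  rw [h2, Multiset.coe_toList, h1]

/-- The coefficients of polynomials with `k` conjugate pairs of roots off the real axis. -/
def pairRange (k : ℕ) : Set (ℕ → ℂ) :=
  Set.range fun z : upperHalf k => (pairProd (z : Fin k → ℂ)).coeff

/-- The open upper half space is locally compact, hence σ-compact here, and so is its continuous
image. -/
lemma measurableSet_pairRange (k : ℕ) : MeasurableSet (pairRange k) := by
  have h1 : LocallyCompactSpace (upperHalf k) := (isOpen_upperHalf k).locallyCompactSpace
  have h2 : Continuous fun z : upperHalf k => (pairProd (z : Fin k → ℂ)).coeff :=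
    (continuous_coeff_pairProd k).comp continuous_subtype_val
  obtain ⟨K, hK, hU⟩ := isSigmaCompact_range h2
  rw [pairRange, ← hU]
  exact MeasurableSet.iUnion fun i => (hK i).measurableSet

/-- A symmetric function of the eigenvalues is a function of the characteristic polynomial. -/
lemma exists_measurable_of_symm {k : ℕ} {F : (Fin k → ℂ) → ℝ≥0∞} (hF : Measurable F)
    (hs : ∀ (σ : Equiv.Perm (Fin k)) (z : Fin k → ℂ), F (z ∘ σ) = F z) :
    ∃ Φ : (ℕ → ℂ) → ℝ≥0∞, Measurable Φ ∧ ∀ z ∈ upperHalf k, Φ (pairProd z).coeff = F z := by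
  set c : upperHalf k → ℕ → ℂ := fun z => (pairProd (z : Fin k → ℂ)).coeff with hc
  have hcm : Measurable c :=
    ((continuous_coeff_pairProd k).comp continuous_subtype_val).measurable
  set Φ : (ℕ → ℂ) → ℝ≥0∞ := Function.extend c (fun z => F z) 0 with hΦ
  have hfac : Function.FactorsThrough (fun z : upperHalf k => F z) c := by
    intro z w h
    obtain ⟨σ, hσ⟩ := exists_perm_of_pairProd_eq z.2 w.2 (Polynomial.ext fun i => congrFun h i)
    simp only [hσ, hs]
  have happ : ∀ z, Φ (c z) = F z := fun z => hfac.extend_apply 0 z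
  refine ⟨Φ, ?_, fun z hz => happ ⟨z, hz⟩⟩
  -- The coefficient map is not injective. Since its domain is standard Borel, measurability of Φ on
  -- the range still follows from that of the composition; off the range Φ is zero by definition.
  have : StandardBorelSpace (upperHalf k) := (measurableSet_upperHalf k).standardBorel
  refine measurable_of_restrict_of_restrict_compl (measurableSet_pairRange k) ?_ ?_
  · refine (Measurable.measurable_comp_iff_restrict hcm).1 ?_
    have : Φ ∘ c = fun z : upperHalf k => F z := funext happ
    rw [this]
    exact hF.comp measurable_subtype_coe
  · have : (pairRange k)ᶜ.domRestrict Φ = fun _ => 0 := by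
      ext1 y
      exact Function.extend_apply' (f := c) (fun z => F z) 0 (y : ℕ → ℂ)
        fun ⟨a, ha⟩ => y.2 ⟨a, ha⟩
    rw [this]
    exact measurable_const

/-- The law of the eigenvalues, before normalisation. -/
theorem exists_lintegral_eigenvalueList {n L : ℝ} (hn : 0 ≤ n) (hL : 0 ≤ L) (N : ℕ) :
    ∃ C : ℝ≥0∞, C ≠ 0 ∧ C ≠ ⊤ ∧ ∀ F : (Fin N → ℂ) → ℝ≥0∞, Measurable F →
      (∀ (σ : Equiv.Perm (Fin N)) (z : Fin N → ℂ), F (z ∘ σ) = F z) →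
      ∫⁻ G : Fin N → Fin N → ℍ[ℝ], F (eigenvalueList (Matrix.of G)) *
          ENNReal.ofReal (wt L (n + N + L) (Matrix.of G)) =
        C * ∫⁻ z in upperHalf N, F z * ENNReal.ofReal (eigWeight n L z) := by
  obtain ⟨C, h1, h2, H⟩ := exists_lintegral_charStat hn hL N
  refine ⟨C, h1, h2, fun F hF hs => ?_⟩
  obtain ⟨Φ, hΦ, hΦF⟩ := exists_measurable_of_symm hF hs
  -- The statistic that detects characteristic polynomials not built from k pairs off the real axis
  -- has integral zero on the right. So the weight vanishes almost everywhere on such matrices, and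
  -- the default values in `eigenvalueList` are harmless.
  have hbad := H ((pairRange N)ᶜ.indicator 1)
    (measurable_one.indicator (measurableSet_pairRange N).compl)
  have hzero : ∫⁻ z in upperHalf N, ((pairRange N)ᶜ.indicator 1 (pairProd z).coeff : ℝ≥0∞) *
      ENNReal.ofReal (eigWeight n L z) = 0 := by
    rw [← lintegral_zero (μ := volume.restrict (upperHalf N))]
    refine setLIntegral_congr_fun (measurableSet_upperHalf N) fun z hz => ?_
    have : (pairProd z).coeff ∉ (pairRange N)ᶜ := fun h => h ⟨⟨z, hz⟩, rfl⟩
    simp only [Set.indicator_of_notMem this, zero_mul]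
  have hG : ∀ i j, Measurable fun G : Fin N → Fin N → ℍ[ℝ] => Matrix.of G i j := fun i j =>
    measurable_pi_iff.1 (measurable_pi_iff.1 measurable_id i) j
  have hm : Measurable fun G : Fin N → Fin N → ℍ[ℝ] =>
      charStat ((pairRange N)ᶜ.indicator 1) (Matrix.of G) *
        ENNReal.ofReal (wt L (n + N + L) (Matrix.of G)) :=
    ((measurable_one.indicator (measurableSet_pairRange N).compl).comp
      (measurable_coeff_charpoly hG)).mul (measurable_wt L _ hG).ennreal_ofReal
  rw [hzero, mul_zero, lintegral_eq_zero_iff hm] at hbad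
  have hcongr : ∫⁻ z in upperHalf N, F z * ENNReal.ofReal (eigWeight n L z) =
      ∫⁻ z in upperHalf N, Φ (pairProd z).coeff * ENNReal.ofReal (eigWeight n L z) :=
    setLIntegral_congr_fun (measurableSet_upperHalf N) fun z hz => by
      simp only [hΦF z hz]
  rw [hcongr, ← H Φ hΦ]
  refine lintegral_congr_ae ?_
  filter_upwards [hbad] with G hGb
  by_cases h : (crep (Matrix.of G)).charpoly.coeff ∈ pairRange N
  · obtain ⟨z, hz⟩ := h
    have hz' : (crep (Matrix.of G)).charpoly = pairProd (z : Fin N → ℂ) :=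
      Polynomial.ext fun i => (congrFun hz i).symm
    obtain ⟨σ, hσ⟩ := exists_perm_eigenvalueList z.2 hz'
    rw [hσ, hs, charStat, hz', hΦF z z.2]
  · have h3 : ENNReal.ofReal (wt L (n + N + L) (Matrix.of G)) = 0 := by
      have h4 : charStat ((pairRange N)ᶜ.indicator 1) (Matrix.of G) = 1 :=
        Set.indicator_of_mem (s := (pairRange N)ᶜ) h 1
      simpa [h4] using hGb
    rw [h3, mul_zero, mul_zero]

/-- The real coordinates of a quaternion matrix. -/
def coordEquiv (N : ℕ) : (Fin N → Fin N → Fin 4 → ℝ) ≃ₗ[ℝ] (Fin N → Fin N → ℍ[ℝ]) where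
  toFun x := fun a b => quat (x a b 0) (x a b 1) (x a b 2) (x a b 3)
  map_add' x y := by ext1 a; ext1 b; rfl
  map_smul' r x := by ext1 a; ext1 b; rfl
  invFun G := fun a b => ![(G a b).re, (G a b).imI, (G a b).imJ, (G a b).imK]
  left_inv x := by ext a b c; fin_cases c <;> rfl
  right_inv G := by ext1 a; ext1 b; rfl

lemma quatMatrix_eq {N : ℕ} (x : Fin N → Fin N → Fin 4 → ℝ) :
    quatMatrix x = Matrix.of (coordEquiv N x) := rfl

instance (N : ℕ) : (volume : Measure (Fin N → Fin N → Fin 4 → ℝ)).IsAddHaarMeasure :=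
  have : (volume : Measure (Fin N → Fin 4 → ℝ)).IsAddHaarMeasure :=
    Measure.pi.isAddHaarMeasure fun _ : Fin N => (volume : Measure (Fin 4 → ℝ))
  Measure.pi.isAddHaarMeasure fun _ : Fin N => (volume : Measure (Fin N → Fin 4 → ℝ))

lemma exists_lintegral_matrixMeasure {n L : ℝ} (hn : 0 ≤ n) (hL : 0 ≤ L) (N : ℕ) :
    ∃ C : ℝ≥0∞, C ≠ 0 ∧ C ≠ ⊤ ∧ ∀ F : (Fin N → ℂ) → ℝ≥0∞, Measurable F →
      (∀ (σ : Equiv.Perm (Fin N)) (z : Fin N → ℂ), F (z ∘ σ) = F z) →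
      ∫⁻ x, F (eigenvalueList (quatMatrix x)) ∂(matrixMeasure N n L) =
        C * ∫⁻ z in upperHalf N, F z * ENNReal.ofReal (eigWeight n L z) := by
  obtain ⟨C₁, h1, h1', H1⟩ := exists_lintegral_comp_linearEquiv
    (volume : Measure (Fin N → Fin N → Fin 4 → ℝ)) (volume : Measure (Fin N → Fin N → ℍ[ℝ]))
    (coordEquiv N)
  obtain ⟨C₂, h2, h2', H2⟩ := exists_lintegral_eigenvalueList hn hL N
  refine ⟨C₁ * C₂, mul_ne_zero h1 h2, ENNReal.mul_ne_top h1' h2', fun F hF hs => ?_⟩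
  have hc : Continuous (coordEquiv N) :=
    LinearMap.continuous_of_finiteDimensional (coordEquiv N).toLinearMap
  have hG : ∀ i j, Measurable fun x : Fin N → Fin N → Fin 4 → ℝ =>
      Matrix.of (coordEquiv N x) i j := fun i j =>
    ((continuous_apply j).comp ((continuous_apply i).comp hc)).measurable
  have hw : Measurable fun x : Fin N → Fin N → Fin 4 → ℝ =>
      ENNReal.ofReal (matrixWeight N n L (quatMatrix x)) := by
    simp only [matrixWeight_eq_wt, quatMatrix_eq]
    exact (measurable_wt L _ hG).ennreal_ofReal
  rw [matrixMeasure, lintegral_withDensity_eq_lintegral_mul_non_measurable _ hw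
    (Filter.Eventually.of_forall fun x => ENNReal.ofReal_lt_top), mul_assoc, ← H2 F hF hs,
    ← H1 fun G => F (eigenvalueList (Matrix.of G)) *
      ENNReal.ofReal (wt L (n + N + L) (Matrix.of G))]
  refine lintegral_congr fun x => ?_
  rw [Pi.mul_apply, matrixWeight_eq_wt, mul_comm]
  rfl

/-- The total mass of the unnormalised joint density. -/
def eigMass (N : ℕ) (n L : ℝ) : ℝ≥0∞ := ∫⁻ z in upperHalf N, ENNReal.ofReal (eigWeight n L z)

/-- The joint density of the eigenvalues. -/
def eigDensity (N : ℕ) (n L : ℝ) (z : Fin N → ℂ) : ℝ := eigWeight n L z / (eigMass N n L).toReal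

/-- The statistic F = 1 identifies the total mass of the matrix measure with the same unknown
constant C times `eigMass`, so C cancels. -/
theorem isEigenvalueJpdf_eigDensity {N : ℕ} {n L : ℝ} (hn : (N : ℝ) ≤ n) (hL : 0 ≤ L) :
    IsEigenvalueJpdf N n L (eigDensity N n L) where
  nonneg z _ := div_nonneg (eigWeight_nonneg n L z) ENNReal.toReal_nonneg
  symm z hz σ := by rw [eigDensity, eigDensity, eigWeight_comp_perm n L hz]
  continuousOn := ((continuous_eigWeight hL N).div_const _).continuousOn
  law F hF hs := by
    obtain ⟨C, h1, h2, H⟩ := exists_lintegral_matrixMeasure ((Nat.cast_nonneg N).trans hn) hL N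
    have hZ0 : eigMass N n L ≠ 0 := setLIntegral_eigWeight_ne_zero hL N
    have hZ : eigMass N n L ≠ ⊤ := setLIntegral_eigWeight_ne_top hL hn
    have hmass : matrixMeasure N n L Set.univ = C * eigMass N n L := by
      have := H (fun _ => 1) measurable_const fun _ _ => rfl
      simpa [eigMass] using this
    have hd : ∀ z : Fin N → ℂ, ENNReal.ofReal (eigDensity N n L z) =
        (eigMass N n L)⁻¹ * ENNReal.ofReal (eigWeight n L z) := by
      intro z
      rw [eigDensity, div_eq_inv_mul, ENNReal.ofReal_mul (by positivity),
        ENNReal.ofReal_inv_of_pos (ENNReal.toReal_pos hZ0 hZ), ENNReal.ofReal_toReal hZ]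
    have hc : ∀ X : ℝ≥0∞, (C * eigMass N n L)⁻¹ * (C * X) = (eigMass N n L)⁻¹ * X := by
      intro X
      rw [ENNReal.mul_inv (Or.inl h1) (Or.inl h2)]
      calc C⁻¹ * (eigMass N n L)⁻¹ * (C * X) = C⁻¹ * C * ((eigMass N n L)⁻¹ * X) := by ring
        _ = _ := by rw [ENNReal.inv_mul_cancel h1 h2, one_mul]
    rw [ensemble, lintegral_smul_measure, H F hF hs, hmass, smul_eq_mul, hc,
      ← lintegral_const_mul' _ _ (ENNReal.inv_ne_top.2 hZ0)]
    refine lintegral_congr fun z => ?_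
    rw [hd]
    ring

/-! ## Uniqueness of the joint density -/

lemma comp_mem_upperHalf {k : ℕ} {z : Fin k → ℂ} (σ : Equiv.Perm (Fin k)) :
    z ∘ σ ∈ upperHalf k ↔ z ∈ upperHalf k :=
  ⟨fun hz i => by simpa using hz (σ.symm i), fun hz i => hz (σ i)⟩

/-- The set where Q₁ < Q₂ is open and permutation invariant, so its indicator is an admissible
statistic and both densities have the same integral over it. If nonempty, it has positive measure,
and with a finite integral of Q₁ the strict inequality contradicts this. -/
lemma IsEigenvalueJpdf.not_lt_of_lintegral_ne_top {N : ℕ} {n L : ℝ} {Q₁ Q₂ : (Fin N → ℂ) → ℝ}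
    (h₁ : IsEigenvalueJpdf N n L Q₁) (h₂ : IsEigenvalueJpdf N n L Q₂)
    (hfin : ∫⁻ z in upperHalf N, ENNReal.ofReal (Q₁ z) ≠ ⊤) {z : Fin N → ℂ}
    (hz : z ∈ upperHalf N) : ¬ Q₁ z < Q₂ z := by
  intro hlt
  set U : Set (Fin N → ℂ) := {z ∈ upperHalf N | Q₁ z < Q₂ z} with hU
  have hUo : IsOpen U := by
    have := (h₁.continuousOn.prodMk h₂.continuousOn).isOpen_inter_preimage (isOpen_upperHalf N)
      isOpen_lt_prod
    exact this
  have hUs : ∀ (σ : Equiv.Perm (Fin N)) (z : Fin N → ℂ), z ∘ σ ∈ U ↔ z ∈ U := by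
    intro σ z
    constructor
    · rintro ⟨ha, hb⟩
      have hz := (comp_mem_upperHalf σ).1 ha
      exact ⟨hz, by simpa only [h₁.symm z hz, h₂.symm z hz] using hb⟩
    · rintro ⟨ha, hb⟩
      exact ⟨(comp_mem_upperHalf σ).2 ha, by simpa only [h₁.symm z ha, h₂.symm z ha] using hb⟩
  have hF : Measurable (U.indicator (1 : (Fin N → ℂ) → ℝ≥0∞)) :=
    measurable_one.indicator hUo.measurableSet
  have hFs : ∀ (σ : Equiv.Perm (Fin N)) (z : Fin N → ℂ),
      (U.indicator 1 (z ∘ σ) : ℝ≥0∞) = U.indicator 1 z := by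
    intro σ z
    by_cases hzU : z ∈ U
    · rw [Set.indicator_of_mem hzU, Set.indicator_of_mem ((hUs σ z).2 hzU)]; rfl
    · rw [Set.indicator_of_notMem hzU, Set.indicator_of_notMem fun h => hzU ((hUs σ z).1 h)]
  have key : ∀ Q : (Fin N → ℂ) → ℝ, ∫⁻ z in upperHalf N,
      (U.indicator 1 z : ℝ≥0∞) * ENNReal.ofReal (Q z) = ∫⁻ z in U, ENNReal.ofReal (Q z) := by
    intro Q
    have : ∀ z, (U.indicator 1 z : ℝ≥0∞) * ENNReal.ofReal (Q z) =
        U.indicator (fun z => ENNReal.ofReal (Q z)) z := by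
      intro z
      by_cases hzU : z ∈ U
      · simp [hzU]
      · simp [hzU]
    simp only [this]
    rw [lintegral_indicator hUo.measurableSet, Measure.restrict_restrict hUo.measurableSet,
      Set.inter_eq_left.2 fun z hz => hz.1]
  have heq : ∫⁻ z in U, ENNReal.ofReal (Q₁ z) = ∫⁻ z in U, ENNReal.ofReal (Q₂ z) := by
    rw [← key, ← key, ← h₁.law _ hF hFs, ← h₂.law _ hF hFs]
  have hm₁ : AEMeasurable (fun z => ENNReal.ofReal (Q₁ z)) (volume.restrict U) :=
    ((h₁.continuousOn.mono fun z hz => hz.1).aemeasurable hUo.measurableSet).ennreal_ofReal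
  have hU0 : volume U ≠ 0 := (hUo.measure_pos volume ⟨z, hz, hlt⟩).ne'
  refine absurd heq (ne_of_lt ?_)
  refine lintegral_strict_mono (μ := volume.restrict U)
    (by rwa [Ne, Measure.restrict_eq_zero]) ?_ ?_ ?_
  · exact ((h₂.continuousOn.mono fun z hz => hz.1).aemeasurable hUo.measurableSet).ennreal_ofReal
  · exact ((lintegral_mono_set fun z hz => hz.1).trans_lt hfin.lt_top).ne
  · refine (ae_restrict_iff' hUo.measurableSet).2 (Filter.Eventually.of_forall fun w hw => ?_)
    exact (ENNReal.ofReal_lt_ofReal_iff_of_nonneg (h₁.nonneg w hw.1)).2 hw.2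

/-- The statistic F = 1 gives every joint density the same total mass as `eigDensity`, which is
known to be finite. -/
lemma IsEigenvalueJpdf.lintegral_ne_top {N : ℕ} {n L : ℝ} {Q : (Fin N → ℂ) → ℝ}
    (h : IsEigenvalueJpdf N n L Q) (hn : (N : ℝ) ≤ n) (hL : 0 ≤ L) :
    ∫⁻ z in upperHalf N, ENNReal.ofReal (Q z) ≠ ⊤ := by
  have h1 := h.law (fun _ => 1) measurable_const fun _ _ => rfl
  have h2 := (isEigenvalueJpdf_eigDensity hn hL).law (fun _ => 1) measurable_const fun _ _ => rfl
  simp only [one_mul] at h1 h2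
  rw [← h1, h2]
  have h3 : ∀ z : Fin N → ℂ, ENNReal.ofReal (eigDensity N n L z) ≤
      ENNReal.ofReal ((eigMass N n L).toReal⁻¹) * ENNReal.ofReal (eigWeight n L z) := by
    intro z
    rw [eigDensity, div_eq_inv_mul, ENNReal.ofReal_mul (by positivity)]
  refine ((lintegral_mono h3).trans_lt ?_).ne
  rw [lintegral_const_mul' _ _ ENNReal.ofReal_ne_top]
  exact ENNReal.mul_lt_top ENNReal.ofReal_lt_top (setLIntegral_eigWeight_ne_top hL hn).lt_top

theorem IsEigenvalueJpdf.eq_eigDensity {N : ℕ} {n L : ℝ} {Q : (Fin N → ℂ) → ℝ}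
    (h : IsEigenvalueJpdf N n L Q) (hn : (N : ℝ) ≤ n) (hL : 0 ≤ L) {z : Fin N → ℂ}
    (hz : z ∈ upperHalf N) : Q z = eigDensity N n L z := by
  have h' := isEigenvalueJpdf_eigDensity hn hL
  exact le_antisymm (not_lt.1 (IsEigenvalueJpdf.not_lt_of_lintegral_ne_top h' h (h'.lintegral_ne_top hn hL) hz))
    (not_lt.1 (IsEigenvalueJpdf.not_lt_of_lintegral_ne_top h h' (h.lintegral_ne_top hn hL) hz))

section

/-! ## Alternating sums over pairs -/

section AltSum

variable {ι X J A B : Type*} [Fintype ι] [DecidableEq ι] [Fintype J] [DecidableEq J]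
  [Fintype A] [DecidableEq A] [Fintype B] [DecidableEq B]

/-- The alternating sum of a product of functions of pairs of indices. -/
def altSum (Y : ι → ι × Fin 2 → ι × Fin 2 → ℂ) : ℂ :=
  ∑ σ : Equiv.Perm (ι × Fin 2), ((Equiv.Perm.sign σ : ℤ) : ℂ) * ∏ l, Y l (σ (l, 0)) (σ (l, 1))

lemma sum_perm_fin_two (f : Equiv.Perm (Fin 2) → ℂ) :
    ∑ π, f π = f 1 + f (Equiv.swap 0 1) := by
  have : (Finset.univ : Finset (Equiv.Perm (Fin 2))) = {1, Equiv.swap 0 1} := by decide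
  rw [this, Finset.sum_pair (by decide)]

/-- Each antisymmetrised factor is a signed sum over the permutations of its two slots. Every choice
of such swaps can be absorbed into σ, so all 2 ^ |ι| terms agree. -/
lemma altSum_sub_swap (Y : ι → ι × Fin 2 → ι × Fin 2 → ℂ) :
    altSum (fun l a b => Y l a b - Y l b a) = 2 ^ Fintype.card ι * altSum Y := by
  have h1 : ∀ (σ : Equiv.Perm (ι × Fin 2)) (l : ι),
      Y l (σ (l, 0)) (σ (l, 1)) - Y l (σ (l, 1)) (σ (l, 0)) =
        ∑ π : Equiv.Perm (Fin 2), ((Equiv.Perm.sign π : ℤ) : ℂ) *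
          Y l (σ (l, π 0)) (σ (l, π 1)) := by
    intro σ l
    rw [sum_perm_fin_two]
    simp [sub_eq_add_neg]
  have h2 : ∀ p : ι → Equiv.Perm (Fin 2),
      ∑ σ : Equiv.Perm (ι × Fin 2), ((Equiv.Perm.sign σ : ℤ) : ℂ) *
        ∏ l, (((Equiv.Perm.sign (p l) : ℤ) : ℂ) * Y l (σ (l, p l 0)) (σ (l, p l 1))) =
      altSum Y := by
    intro p
    unfold altSum
    rw [← Equiv.sum_comp (Equiv.mulRight (Equiv.prodCongrRight p : Equiv.Perm (ι × Fin 2)))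
      fun σ : Equiv.Perm (ι × Fin 2) =>
        ((Equiv.Perm.sign σ : ℤ) : ℂ) * ∏ l, Y l (σ (l, 0)) (σ (l, 1))]
    refine Finset.sum_congr rfl fun σ _ => ?_
    rw [Finset.prod_mul_distrib, ← mul_assoc]
    congr 1
    rw [Equiv.coe_mulRight, Equiv.Perm.sign_mul, Equiv.Perm.sign_prodCongrRight]
    push_cast
    rfl
  calc altSum (fun l a b => Y l a b - Y l b a)
      = ∑ σ : Equiv.Perm (ι × Fin 2), ((Equiv.Perm.sign σ : ℤ) : ℂ) *
          ∑ p : ι → Equiv.Perm (Fin 2), ∏ l, (((Equiv.Perm.sign (p l) : ℤ) : ℂ) *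
            Y l (σ (l, p l 0)) (σ (l, p l 1))) := by
        refine Finset.sum_congr rfl fun σ _ => ?_
        simp only [h1]
        rw [Finset.prod_univ_sum, Fintype.piFinset_univ]
    _ = ∑ _p : ι → Equiv.Perm (Fin 2), altSum Y := by
        simp only [Finset.mul_sum]
        rw [Finset.sum_comm]
        exact Finset.sum_congr rfl fun p _ => h2 p
    _ = _ := by
        rw [Finset.sum_const, Finset.card_univ, Fintype.card_fun, Fintype.card_perm]
        simp

/-- The alternating sum depends only on the antisymmetric parts of its factors. This lets the
pairing of weighted polynomials be replaced by its normal form. -/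
lemma altSum_congr_swap {Y Y' : ι → ι × Fin 2 → ι × Fin 2 → ℂ}
    (h : ∀ l a b, Y l a b - Y l b a = Y' l a b - Y' l b a) : altSum Y = altSum Y' := by
  have h1 : altSum (fun l a b => Y l a b - Y l b a) =
      altSum (fun l a b => Y' l a b - Y' l b a) := by
    congr 1
    ext l a b
    exact h l a b
  rw [altSum_sub_swap, altSum_sub_swap] at h1
  exact mul_left_cancel₀ (by positivity) h1

/-- With rank-one factors the alternating sum is the Leibniz expansion of a determinant. -/
lemma altSum_mul (v : ι → Fin 2 → ι × Fin 2 → ℂ) :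
    altSum (fun l a b => v l 0 a * v l 1 b) =
      (Matrix.of fun (a p : ι × Fin 2) => v p.1 p.2 a).det := by
  rw [Matrix.det_apply']
  refine Finset.sum_congr rfl fun σ _ => ?_
  rw [Fintype.prod_prod_type]
  simp

lemma pfaffian_sub_swap {m : ℕ} (Y : Fin m × Fin 2 → Fin m × Fin 2 → ℂ) :
    pfaffian (Matrix.of fun a b => Y a b - Y b a) = altSum (fun _ => Y) / (m.factorial : ℂ) := by
  have h1 := altSum_sub_swap (fun _ : Fin m => Y)
  unfold pfaffian
  rw [show (∑ σ : Equiv.Perm (Fin m × Fin 2), ((Equiv.Perm.sign σ : ℤ) : ℂ) *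
      ∏ l : Fin m, (Matrix.of fun a b => Y a b - Y b a) (σ (l, 0)) (σ (l, 1))) =
      altSum fun (_ : Fin m) a b => Y a b - Y b a from rfl, h1, Fintype.card_fin]
  rw [mul_div_mul_left _ _ (by positivity)]

lemma altSum_sum_mul (c : J → ℂ) (v : J → Fin 2 → ι × Fin 2 → ℂ) :
    altSum (fun (_ : ι) a b => ∑ j, c j * (v j 0 a * v j 1 b)) =
      ∑ K : ι → J, (∏ l, c (K l)) *
        (Matrix.of fun (a p : ι × Fin 2) => v (K p.1) p.2 a).det := by
  have : ∀ K : ι → J, (Matrix.of fun (a p : ι × Fin 2) => v (K p.1) p.2 a).det =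
    altSum (fun l a b => v (K l) 0 a * v (K l) 1 b) := fun K =>
      (altSum_mul fun l => v (K l)).symm
  simp only [this]
  unfold altSum
  simp only [Finset.mul_sum]
  rw [Finset.sum_comm]
  refine Finset.sum_congr rfl fun σ _ => ?_
  rw [Finset.prod_univ_sum, Fintype.piFinset_univ, Finset.mul_sum]
  refine Finset.sum_congr rfl fun K _ => ?_
  rw [Finset.prod_mul_distrib]
  ring

lemma altSum_sumElim (Y : A → (A ⊕ B) × Fin 2 → (A ⊕ B) × Fin 2 → ℂ) (c : J → ℂ)
    (v : J → Fin 2 → (A ⊕ B) × Fin 2 → ℂ) :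
    altSum (Sum.elim Y fun _ a b => ∑ j, c j * (v j 0 a * v j 1 b)) =
      ∑ K : B → J, (∏ l, c (K l)) *
        altSum (Sum.elim Y fun l a b => v (K l) 0 a * v (K l) 1 b) := by
  unfold altSum
  simp only [Finset.mul_sum]
  rw [Finset.sum_comm]
  refine Finset.sum_congr rfl fun σ _ => ?_
  simp only [Fintype.prod_sum_type, Sum.elim_inl, Sum.elim_inr]
  rw [Finset.prod_univ_sum, Fintype.piFinset_univ, Finset.mul_sum, Finset.mul_sum]
  refine Finset.sum_congr rfl fun K _ => ?_
  rw [Finset.prod_mul_distrib]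
  ring

lemma exists_perm_comp_eq {f K : A → ι} (hf : f.Injective) (hK : K.Injective) :
    ∃ τ : Equiv.Perm ι, ∀ a, τ (f a) = K a := by
  let e : {x // x ∈ Set.range f} ≃ {x // x ∈ Set.range K} :=
    (Equiv.ofInjective f hf).symm.trans (Equiv.ofInjective K hK)
  classical
  refine ⟨e.extendSubtype, fun a => ?_⟩
  rw [Equiv.extendSubtype_apply_of_mem _ _ (Set.mem_range_self a)]
  simp only [e, Equiv.trans_apply]
  have : (⟨f a, Set.mem_range_self a⟩ : {x // x ∈ Set.range f}) = Equiv.ofInjective f hf a := rfl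
  rw [this, Equiv.symm_apply_apply]
  rfl

/-- Composing with a permutation shows that all injective K have equally many extensions, and N!
divided by the number of injections gives (N - |A|)!, with N = |ι|. -/
lemma card_filter_perm_comp {f K : A → ι} (hf : f.Injective) (hK : K.Injective) :
    (Finset.univ.filter fun π : Equiv.Perm ι => π ∘ f = K).card =
      (Fintype.card ι - Fintype.card A).factorial := by
  have h1 : ∀ K' : A → ι, K'.Injective →
      (Finset.univ.filter fun π : Equiv.Perm ι => π ∘ f = K').card =
        (Finset.univ.filter fun π : Equiv.Perm ι => π ∘ f = f).card := by
    intro K' hK'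
    obtain ⟨τ, hτ⟩ := exists_perm_comp_eq hf hK'
    refine Finset.card_equiv (Equiv.mulLeft τ⁻¹) fun π => ?_
    simp only [Finset.mem_filter, Finset.mem_univ, true_and, funext_iff, Function.comp_apply,
      Equiv.coe_mulLeft, Equiv.Perm.mul_apply, Equiv.Perm.inv_eq_iff_eq, hτ]
  have h2 := Finset.card_eq_sum_card_fiberwise (s := (Finset.univ : Finset (Equiv.Perm ι)))
    (t := Finset.univ.filter fun K : A → ι => K.Injective) (f := fun π : Equiv.Perm ι => (π : ι → ι) ∘ f)
    (fun π _ => by simpa using π.injective.comp hf)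
  rw [Finset.sum_congr rfl fun K' hK' => h1 K' (Finset.mem_filter.1 hK').2, Finset.sum_const,
    Finset.card_univ, Fintype.card_perm] at h2
  have h3 : (Finset.univ.filter fun K : A → ι => K.Injective).card =
      (Fintype.card ι).descFactorial (Fintype.card A) := by
    rw [← Fintype.card_embedding_eq, ← Fintype.card_subtype]
    exact Fintype.card_congr (Equiv.subtypeInjectiveEquivEmbedding A ι)
  have h4 := Nat.factorial_mul_descFactorial (Fintype.card_le_of_injective f hf)
  rw [h3, smul_eq_mul, ← h4, mul_comm] at h2
  rw [h1 K hK]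
  exact (Nat.eq_of_mul_eq_mul_left
    (Nat.descFactorial_pos.2 (Fintype.card_le_of_injective f hf)) h2).symm

/-- A sum over index maps whose terms vanish off the injective ones becomes a sum over permutations.
Both expansions below are brought to this common index set. -/
lemma sum_perm_comp {f : A → ι} (hf : f.Injective) {F : (A → ι) → ℂ}
    (hF : ∀ K, ¬ K.Injective → F K = 0) :
    ∑ π : Equiv.Perm ι, F (π ∘ f) =
      ((Fintype.card ι - Fintype.card A).factorial : ℂ) * ∑ K, F K := by
  rw [← Finset.sum_fiberwise (s := (Finset.univ : Finset (Equiv.Perm ι))) (g := fun π => π ∘ f),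
    Finset.mul_sum]
  refine Finset.sum_congr rfl fun K _ => ?_
  by_cases hK : K.Injective
  · rw [← card_filter_perm_comp hf hK, ← nsmul_eq_mul, ← Finset.sum_const]
    exact Finset.sum_congr rfl fun π hπ => by rw [(Finset.mem_filter.1 hπ).2]
  · rw [hF K hK, mul_zero]
    exact Finset.sum_eq_zero fun π hπ => by rw [(Finset.mem_filter.1 hπ).2, hF K hK]

/-- The minor of `u` formed by the pairs of columns `K`. -/
def pairMinor (u : A → Fin 2 → J × Fin 2 → ℂ) (K : A → J) : ℂ :=
  (Matrix.of fun (a p : A × Fin 2) => u a.1 a.2 (K p.1, p.2)).det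

lemma pairMinor_of_not_injective (u : A → Fin 2 → J × Fin 2 → ℂ) {K : A → J}
    (hK : ¬ K.Injective) : pairMinor u K = 0 := by
  obtain ⟨a, b, h, hab⟩ := Function.not_injective_iff.1 hK
  refine Matrix.det_zero_of_column_eq (i := (a, 0)) (j := (b, 0)) (by simp [hab]) fun k => ?_
  simp [h]

/-- The unit row that corresponds to a basis vector. -/
def unitRow (j : J) (β : Fin 2) (c : J × Fin 2) : ℂ := if c = (j, β) then 1 else 0

lemma altSum_unitRow (u : A → Fin 2 → (A ⊕ B) × Fin 2 → ℂ) (K : B → A ⊕ B) :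
    altSum (Sum.elim (fun l a b => u l 0 a * u l 1 b)
      fun l a b => unitRow (K l) 0 a * unitRow (K l) 1 b) =
    (Matrix.of fun (a p : (A ⊕ B) × Fin 2) =>
      Sum.elim (fun l => u l p.2 a) (fun l => unitRow (K l) p.2 a) p.1).det := by
  rw [← altSum_mul fun (l : A ⊕ B) β a => Sum.elim (fun l => u l β a) (fun l => unitRow (K l) β a) l]
  congr 1
  ext l a b
  cases l <;> rfl

lemma altSum_unitRow_of_not_injective (u : A → Fin 2 → (A ⊕ B) × Fin 2 → ℂ) {K : B → A ⊕ B}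
    (hK : ¬ K.Injective) : altSum (Sum.elim (fun l a b => u l 0 a * u l 1 b)
      fun l a b => unitRow (K l) 0 a * unitRow (K l) 1 b) = 0 := by
  obtain ⟨a, b, h, hab⟩ := Function.not_injective_iff.1 hK
  rw [altSum_unitRow]
  refine Matrix.det_zero_of_column_eq (i := (.inr a, 0)) (j := (.inr b, 0)) (by simp [hab])
    fun k => ?_
  simp [h]

/-- A permutation of whole pairs is even, since it acts identically on both slots. After it the
matrix is block triangular: the unit rows give an identity block, and the minor of the other pairs
of columns remains. -/
lemma altSum_unitRow_perm (u : A → Fin 2 → (A ⊕ B) × Fin 2 → ℂ) (π : Equiv.Perm (A ⊕ B)) :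
    altSum (Sum.elim (fun l a b => u l 0 a * u l 1 b)
      fun l a b => unitRow (π (.inr l)) 0 a * unitRow (π (.inr l)) 1 b) =
    pairMinor u (π ∘ Sum.inl) := by
  rw [altSum_unitRow u fun l => π (.inr l)]
  set M := Matrix.of fun (a p : (A ⊕ B) × Fin 2) =>
      Sum.elim (fun l => u l p.2 a) (fun l => unitRow (π (.inr l)) p.2 a) p.1 with hM
  have hsign : Equiv.Perm.sign (Equiv.prodCongrLeft fun _ : Fin 2 => π) = 1 := by
    rw [Equiv.Perm.sign_prodCongrLeft]
    simp
  have h1 := Matrix.det_permute (Equiv.prodCongrLeft fun _ : Fin 2 => π) M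
  rw [hsign, Units.val_one, Int.cast_one, one_mul] at h1
  rw [← h1, ← Matrix.det_submatrix_equiv_self (Equiv.sumProdDistrib A B (Fin 2)).symm]
  have h2 : ((M.submatrix (Equiv.prodCongrLeft fun _ : Fin 2 => π) id).submatrix
      (Equiv.sumProdDistrib A B (Fin 2)).symm (Equiv.sumProdDistrib A B (Fin 2)).symm) =
      Matrix.fromBlocks (Matrix.of fun (a p : A × Fin 2) => u p.1 p.2 (π (.inl a.1), a.2)) 0
        (Matrix.of fun (a : B × Fin 2) (p : A × Fin 2) => u p.1 p.2 (π (.inr a.1), a.2)) 1 := by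
    ext a p
    rcases a with a | a <;> rcases p with p | p
    · rfl
    · simp [hM, unitRow, Matrix.fromBlocks]
    · rfl
    · simp [hM, unitRow, Matrix.fromBlocks, Matrix.one_apply, Prod.ext_iff]
  rw [h2, Matrix.det_fromBlocks_zero₁₂, Matrix.det_one, mul_one, pairMinor,
    ← Matrix.det_transpose]
  rfl

/-- Expansion of an alternating sum in which the last factors are the skew form with the
normal form `γ`. -/
theorem altSum_eq_sum_perm (u : A → Fin 2 → (A ⊕ B) × Fin 2 → ℂ) (γ : A ⊕ B → ℂ)
    (Y : (A ⊕ B) × Fin 2 → (A ⊕ B) × Fin 2 → ℂ)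
    (hY : ∀ c d, Y c d - Y d c = ∑ j, γ j * (unitRow j 0 c * unitRow j 1 d) -
      ∑ j, γ j * (unitRow j 0 d * unitRow j 1 c)) :
    ((Fintype.card A).factorial : ℂ) *
      altSum (Sum.elim (fun l a b => u l 0 a * u l 1 b) fun _ => Y) =
    ∑ π : Equiv.Perm (A ⊕ B), (∏ b, γ (π (.inr b))) * pairMinor u (π ∘ Sum.inl) := by
  rw [altSum_congr_swap (Y' := Sum.elim (fun l a b => u l 0 a * u l 1 b)
    fun _ a b => ∑ j, γ j * (unitRow j 0 a * unitRow j 1 b)), altSum_sumElim]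
  · have h1 := sum_perm_comp (ι := A ⊕ B) (f := (Sum.inr : B → A ⊕ B)) Sum.inr_injective
      (F := fun K => (∏ l, γ (K l)) * altSum (Sum.elim (fun l a b => u l 0 a * u l 1 b)
        fun l a b => unitRow (K l) 0 a * unitRow (K l) 1 b))
      (fun K hK => by rw [altSum_unitRow_of_not_injective u hK, mul_zero])
    rw [Fintype.card_sum, Nat.add_sub_cancel] at h1
    rw [← h1]
    refine Finset.sum_congr rfl fun π _ => ?_
    rw [← altSum_unitRow_perm]
    rfl
  · rintro (l | l) a b
    · rfl
    · exact hY a b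

/-- The counterpart of `altSum_eq_sum_perm` for a kernel that is itself a sum over the basis. The
same minors appear, weighted by the chosen indices instead of the complementary ones. -/
theorem altSum_sum_eq_sum_perm (u : A → Fin 2 → (A ⊕ B) × Fin 2 → ℂ) (c : A ⊕ B → ℂ) :
    ((Fintype.card B).factorial : ℂ) *
      altSum (fun (_ : A) a b => ∑ j, c j * (u a.1 a.2 (j, 0) * u b.1 b.2 (j, 1))) =
    ∑ π : Equiv.Perm (A ⊕ B), (∏ a, c (π (.inl a))) * pairMinor u (π ∘ Sum.inl) := by
  rw [altSum_sum_mul c fun j β a => u a.1 a.2 (j, β)]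
  have h1 := sum_perm_comp (ι := A ⊕ B) (f := (Sum.inl : A → A ⊕ B)) Sum.inl_injective
    (F := fun K => (∏ l, c (K l)) * pairMinor u K)
    (fun K hK => by rw [pairMinor_of_not_injective u hK, mul_zero])
  rw [Fintype.card_sum, Nat.add_sub_cancel_left] at h1
  exact h1.symm

end AltSum

end

/-! ## The skew product -/

/-- The weight `h(z) h(z̄)` on the upper half plane. -/
def skewWeight (n L : ℝ) (z : ℂ) : ℝ :=
  ‖z‖ ^ (4 * L) * (2 * z.im) * (1 + ‖z‖ ^ 2) ^ (-(2 * (n + L + 1)))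

lemma cpow_half_mul_conj {w : ℂ} (hw : w.arg ≠ Real.pi) :
    w ^ (1 / 2 : ℂ) * (conj w) ^ (1 / 2 : ℂ) = (‖w‖ : ℂ) := by
  have h1 : (1 / 2 : ℂ) = ((1 / 2 : ℝ) : ℂ) := by norm_num
  rw [Complex.conj_cpow_eq_ite, if_neg hw, h1, Complex.conj_ofReal, Complex.mul_conj,
    Complex.normSq_eq_norm_sq, Complex.norm_cpow_real, ← Real.rpow_natCast, ← Real.rpow_mul
    (norm_nonneg _)]
  norm_num

lemma sub_conj_eq (z : ℂ) : z - conj z = ((2 * z.im : ℝ) : ℂ) * Complex.I := by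
  rw [Complex.sub_conj]

/-- For im z > 0 the number z - conj z lies on the positive imaginary axis, away from the branch
cut. The two principal roots are therefore conjugate and their product is |z - conj z| = 2 im z. -/
lemma h_mul_h_conj {n L : ℝ} {z : ℂ} (hz : 0 < z.im) :
    h n L z * h n L (conj z) = (skewWeight n L z : ℂ) := by
  have h1 : (z - conj z) ^ (1 / 2 : ℂ) * (conj z - conj (conj z)) ^ (1 / 2 : ℂ) =
      ((2 * z.im : ℝ) : ℂ) := by
    have h2 : conj z - conj (conj z) = conj (z - conj z) := by rw [map_sub]
    have h3 : (z - conj z).arg = Real.pi / 2 := by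
      rw [sub_conj_eq, Complex.arg_real_mul _ (by positivity), Complex.arg_I]
    rw [h2, cpow_half_mul_conj (by rw [h3]; linarith [Real.pi_pos]), sub_conj_eq, norm_mul,
      Complex.norm_I, mul_one, Complex.norm_real, Real.norm_eq_abs, abs_of_pos (by positivity)]
  have h4 : ‖z‖ ^ (4 * L) = ‖z‖ ^ (2 * L) * ‖z‖ ^ (2 * L) := by
    rw [← Real.mul_rpow (norm_nonneg _) (norm_nonneg _), ← sq, ← Real.rpow_natCast,
      ← Real.rpow_mul (norm_nonneg _)]
    congr 1
    push_cast
    ring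
  have hb : (0 : ℝ) < 1 + ‖z‖ ^ 2 := by positivity
  have h5 : (1 + ‖z‖ ^ 2) ^ (-(2 * (n + L + 1))) =
      ((1 + ‖z‖ ^ 2) ^ (n + L + 1))⁻¹ * ((1 + ‖z‖ ^ 2) ^ (n + L + 1))⁻¹ := by
    rw [← Real.rpow_neg hb.le, ← Real.rpow_add hb]
    ring_nf
  unfold h skewWeight
  rw [h4, h5, Complex.norm_conj]
  push_cast at h1 ⊢
  linear_combination (((‖z‖ ^ (2 * L) : ℝ) : ℂ)) ^ 2 *
    ((((1 + ‖z‖ ^ 2) ^ (n + L + 1) : ℝ) : ℂ)⁻¹) ^ 2 * h1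

lemma continuous_skewWeight {n L : ℝ} (hL : 0 ≤ L) : Continuous (skewWeight n L) := by
  refine ((continuous_norm.rpow_const fun z => Or.inr (by positivity)).mul
    (continuous_const.mul Complex.continuous_im)).mul
    ((continuous_const.add (continuous_norm.pow 2)).rpow_const fun z => Or.inl ?_)
  exact (show (0 : ℝ) < 1 + ‖z‖ ^ 2 by positivity).ne'

lemma exists_norm_eval_le (p : Polynomial ℂ) {d : ℕ} (hp : p.natDegree ≤ d) :
    ∃ K : ℝ, 0 ≤ K ∧ ∀ z : ℂ, ‖p.eval z‖ ≤ K * (1 + ‖z‖ ^ 2) ^ (d / 2 : ℝ) := by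
  refine ⟨∑ i ∈ Finset.range (d + 1), ‖p.coeff i‖, by positivity, fun z => ?_⟩
  rw [Polynomial.eval_eq_sum_range' (Nat.lt_succ_of_le hp), Finset.sum_mul]
  refine (norm_sum_le _ _).trans (Finset.sum_le_sum fun i hi => ?_)
  rw [norm_mul, norm_pow]
  refine mul_le_mul_of_nonneg_left ?_ (norm_nonneg _)
  have hb : (1 : ℝ) ≤ 1 + ‖z‖ ^ 2 := by nlinarith [sq_nonneg ‖z‖]
  have h1 : ‖z‖ ≤ (1 + ‖z‖ ^ 2) ^ (1 / 2 : ℝ) := by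
    rw [← Real.sqrt_eq_rpow]
    exact Real.le_sqrt_of_sq_le (by linarith)
  calc ‖z‖ ^ i ≤ ((1 + ‖z‖ ^ 2) ^ (1 / 2 : ℝ)) ^ i := pow_le_pow_left₀ (norm_nonneg _) h1 i
    _ = (1 + ‖z‖ ^ 2) ^ (i / 2 : ℝ) := by
        rw [← Real.rpow_natCast, ← Real.rpow_mul (by positivity)]
        congr 1
        ring
    _ ≤ _ := by
        refine Real.rpow_le_rpow_of_exponent_le hb ?_
        have : (i : ℝ) ≤ d := by exact_mod_cast Nat.lt_succ_iff.1 (Finset.mem_range.1 hi)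
        linarith

lemma integrable_skewWeight_mul {n L : ℝ} (hL : 0 ≤ L) {p q : Polynomial ℂ} {N : ℕ}
    (hn : (N : ℝ) ≤ n) (hp : p.natDegree < 2 * N) (hq : q.natDegree < 2 * N) :
    Integrable fun z : ℂ => (skewWeight n L z : ℂ) * (p.eval z * q.eval (conj z)) := by
  obtain ⟨K₁, hK₁, h₁⟩ := exists_norm_eval_le p (d := 2 * N - 1) (by omega)
  obtain ⟨K₂, hK₂, h₂⟩ := exists_norm_eval_le q (d := 2 * N - 1) (by omega)
  have hcast : ((2 * N - 1 : ℕ) : ℝ) = 2 * N - 1 := by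
    rw [Nat.cast_sub (by omega)]
    push_cast
    ring
  have hint := integrable_rpow_neg_one_add_norm_sq (E := ℂ) (μ := volume) (r := 5)
    (by rw [Complex.finrank_real_complex]; norm_num)
  refine (hint.const_mul (2 * K₁ * K₂)).mono' ?_ (Filter.Eventually.of_forall fun z => ?_)
  · exact ((Complex.continuous_ofReal.comp (continuous_skewWeight hL)).mul
      (p.continuous.mul (q.continuous.comp Complex.continuous_conj))).aestronglyMeasurable
  set b : ℝ := 1 + ‖z‖ ^ 2 with hb
  have hb1 : 1 ≤ b := by nlinarith [sq_nonneg ‖z‖]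
  have hb0 : 0 < b := by positivity
  have e1 : ‖z‖ ≤ b ^ (1 / 2 : ℝ) := by
    rw [← Real.sqrt_eq_rpow]
    exact Real.le_sqrt_of_sq_le (by linarith)
  have e2 : ‖z‖ ^ (4 * L) ≤ b ^ (2 * L) := by
    calc ‖z‖ ^ (4 * L) ≤ (b ^ (1 / 2 : ℝ)) ^ (4 * L) :=
          Real.rpow_le_rpow (norm_nonneg _) e1 (by positivity)
      _ = b ^ (2 * L) := by
          rw [← Real.rpow_mul hb0.le]
          ring_nf
  have e3 : |z.im| ≤ b ^ (1 / 2 : ℝ) := (Complex.abs_im_le_norm z).trans e1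
  have e4 := h₁ z
  have e5 := h₂ (conj z)
  rw [Complex.norm_conj] at e5
  rw [norm_mul, norm_mul, Complex.norm_real, skewWeight, norm_mul, norm_mul, norm_mul,
    Real.norm_of_nonneg (Real.rpow_nonneg (norm_nonneg _) _), Real.norm_eq_abs z.im,
    Real.norm_of_nonneg (Real.rpow_nonneg hb0.le _), Real.norm_ofNat]
  calc ‖z‖ ^ (4 * L) * (2 * |z.im|) * b ^ (-(2 * (n + L + 1))) *
        (‖p.eval z‖ * ‖q.eval (conj z)‖)
      ≤ b ^ (2 * L) * (2 * b ^ (1 / 2 : ℝ)) * b ^ (-(2 * (n + L + 1))) *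
        ((K₁ * b ^ ((2 * N - 1 : ℕ) / 2 : ℝ)) * (K₂ * b ^ ((2 * N - 1 : ℕ) / 2 : ℝ))) := by
        gcongr
    -- The exponent equals 2N - 2n - 5/2 ≤ -5/2, so the decay in |z| has order 5, more than the
    -- dimension 2.
    _ = 2 * K₁ * K₂ * b ^ (2 * L + 1 / 2 + -(2 * (n + L + 1)) +
          (((2 * N - 1 : ℕ) / 2 : ℝ) + ((2 * N - 1 : ℕ) / 2 : ℝ))) := by
        rw [Real.rpow_add hb0, Real.rpow_add hb0, Real.rpow_add hb0, Real.rpow_add hb0]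
        ring
    _ ≤ 2 * K₁ * K₂ * b ^ (-5 / 2 : ℝ) := by
        refine mul_le_mul_of_nonneg_left (Real.rpow_le_rpow_of_exponent_le hb1 ?_) (by positivity)
        rw [hcast]
        linarith

/-- The bilinear form whose antisymmetrisation is the skew product. -/
def pairForm (n L : ℝ) (p q : Polynomial ℂ) : ℂ :=
  ∫ z in {z : ℂ | 0 < z.im}, (h n L z * p.eval z) * (h n L (conj z) * q.eval (conj z))

lemma integrableOn_pairForm {n L : ℝ} (hL : 0 ≤ L) {p q : Polynomial ℂ} {N : ℕ}
    (hn : (N : ℝ) ≤ n) (hp : p.natDegree < 2 * N) (hq : q.natDegree < 2 * N) :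
    IntegrableOn (fun z => (h n L z * p.eval z) * (h n L (conj z) * q.eval (conj z)))
      {z : ℂ | 0 < z.im} := by
  refine (integrable_skewWeight_mul hL hn hp hq).integrableOn.congr_fun (fun z hz => ?_)
    measurableSet_upper
  simp only
  rw [← h_mul_h_conj hz]
  ring

lemma pairForm_sub_swap {n L : ℝ} (hL : 0 ≤ L) {p q : Polynomial ℂ} {N : ℕ}
    (hn : (N : ℝ) ≤ n) (hp : p.natDegree < 2 * N) (hq : q.natDegree < 2 * N) :
    pairForm n L p q - pairForm n L q p = -Complex.I * skewProduct n L p q := by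
  rw [pairForm, pairForm, ← integral_sub (integrableOn_pairForm hL hn hp hq)
    (integrableOn_pairForm hL hn hq hp), skewProduct, ← mul_assoc, neg_mul, Complex.I_mul_I,
    neg_neg, one_mul]
  congr 1
  ext z
  ring

lemma skewProduct_swap (n L : ℝ) (p q : Polynomial ℂ) :
    skewProduct n L p q = -skewProduct n L q p := by
  rw [skewProduct, skewProduct, ← mul_neg, ← integral_neg]
  congr 2
  ext z
  ring

/-! ## The joint density as a determinant -/

/-- The `c`-th weighted polynomial. -/
def basisFn {N : ℕ} (n L : ℝ) (q : ℕ → Polynomial ℂ) (c : Fin N × Fin 2) (x : ℂ) : ℂ :=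
  h n L x * (q (2 * c.1 + c.2)).eval x

/-- Replacing powers by monic polynomials of the same degrees is a unitriangular column operation.
-/
lemma det_eval_withConj {N : ℕ} {q : ℕ → Polynomial ℂ} (hm : ∀ j < 2 * N, (q j).Monic)
    (hd : ∀ j < 2 * N, (q j).natDegree = j) (z : Fin N → ℂ) :
    (Matrix.of fun (p c : Fin N × Fin 2) => (q (2 * c.1 + c.2)).eval (withConj z p)).det =
      (pairVandermonde z).det := by
  have hlt : ∀ i : Fin (N * 2), (i : ℕ) < 2 * N := fun i => by have := i.2; omega
  have h1 := Matrix.det_eval_matrixOfPolynomials_eq_det_vandermonde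
    (fun a : Fin (N * 2) => withConj z (finProdFinEquiv.symm a)) (fun i => q i)
    (fun i => hd i (hlt i)) (fun i => hm i (hlt i))
  rw [← Matrix.det_submatrix_equiv_self finProdFinEquiv,
    ← Matrix.det_submatrix_equiv_self finProdFinEquiv (Matrix.of _)] at h1
  rw [show pairVandermonde z = (Matrix.vandermonde
      (fun a => withConj z (finProdFinEquiv.symm a))).submatrix finProdFinEquiv finProdFinEquiv by
    ext p c
    simp only [pairVandermonde, Matrix.of_apply, Matrix.submatrix_apply, Matrix.vandermonde_apply,
      Equiv.symm_apply_apply], h1]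
  congr 1
  ext p c
  simp only [Matrix.of_apply, Matrix.submatrix_apply, Equiv.symm_apply_apply,
    finProdFinEquiv_apply_val]
  rw [add_comm]

/-- The constant per eigenvalue comes from h(z) h(conj z) (conj z - z), which contains 2 im z · (-2i
im z) = -4i (im z)². -/
lemma eigWeight_eq_det {N : ℕ} {n L : ℝ} {q : ℕ → Polynomial ℂ}
    (hq : IsSkewOrthogonal N n L q) {z : Fin N → ℂ} (hz : z ∈ upperHalf N) :
    (-4 * Complex.I) ^ N * (eigWeight n L z : ℂ) =
      (Matrix.of fun (p c : Fin N × Fin 2) => basisFn n L q c (withConj z p)).det := by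
  have h1 := Matrix.det_mul_column (fun p : Fin N × Fin 2 => h n L (withConj z p))
    (Matrix.of fun (p c : Fin N × Fin 2) => (q (2 * c.1 + c.2)).eval (withConj z p))
  have h2 : (Matrix.of fun (p c : Fin N × Fin 2) => basisFn n L q c (withConj z p)) =
      Matrix.of fun (p c : Fin N × Fin 2) => h n L (withConj z p) *
        (Matrix.of fun (p c : Fin N × Fin 2) => (q (2 * c.1 + c.2)).eval (withConj z p)) p c := rfl
  rw [h2, h1, det_eval_withConj hq.monic hq.natDegree, det_pairVandermonde, eigWeight_eq,
    Fintype.prod_prod_type, ← mul_assoc, ← Finset.prod_mul_distrib]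
  push_cast
  rw [← mul_assoc]
  congr 1
  have h3 : ∀ i, (∏ y : Fin 2, h n L (withConj z (i, y))) * (conj (z i) - z i) =
      -4 * Complex.I * (eigWeight₁ n L (z i) : ℂ) := by
    intro i
    rw [Fin.prod_univ_two]
    have h4 : h n L (withConj z (i, 0)) * h n L (withConj z (i, 1)) = (skewWeight n L (z i) : ℂ) :=
      h_mul_h_conj (hz i)
    have h5 := sub_conj_eq (z i)
    rw [h4, ← neg_sub, h5, skewWeight, eigWeight₁]
    push_cast
    ring
  simp only [h3]
  rw [Finset.prod_mul_distrib, Finset.prod_const, Finset.card_univ, Fintype.card_fin]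

/-! ## The correlation functions -/

/-- The splitting of the `N` indices into the first `m` and the remaining ones. -/
def splitEquiv {N m : ℕ} (hm : m ≤ N) : Fin m ⊕ Fin (N - m) ≃ Fin N :=
  finSumFinEquiv.trans (finCongr (Nat.add_sub_of_le hm))

lemma glue_inl {N m : ℕ} (hm : m ≤ N) (r : Fin m → ℂ) (w : Fin (N - m) → ℂ) (a : Fin m) :
    glue r w (splitEquiv hm (.inl a)) = r a := by
  simp [glue, splitEquiv]

lemma glue_inr {N m : ℕ} (hm : m ≤ N) (r : Fin m → ℂ) (w : Fin (N - m) → ℂ)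
    (b : Fin (N - m)) : glue r w (splitEquiv hm (.inr b)) = w b := by
  simp [glue, splitEquiv]

lemma glue_mem_upperHalf {N m : ℕ} (hm : m ≤ N) {r : Fin m → ℂ} {w : Fin (N - m) → ℂ}
    (hr : r ∈ upperHalf m) (hw : w ∈ upperHalf (N - m)) : glue r w ∈ upperHalf N := by
  intro i
  obtain ⟨s, rfl⟩ := (splitEquiv hm).surjective i
  rcases s with a | b
  · rw [glue_inl]; exact hr a
  · rw [glue_inr]; exact hw b

lemma continuous_glue {N m : ℕ} (hm : m ≤ N) (r : Fin m → ℂ) :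
    Continuous fun w : Fin (N - m) → ℂ => (glue r w : Fin N → ℂ) := by
  refine continuous_pi fun i => ?_
  obtain ⟨s, rfl⟩ := (splitEquiv hm).surjective i
  rcases s with a | b
  · simp only [glue_inl]; exact continuous_const
  · simp only [glue_inr]; exact continuous_apply b

lemma integrable_eigWeight_glue {N m : ℕ} (hm : m ≤ N) {n L : ℝ} (hn : (N : ℝ) ≤ n)
    (hL : 0 ≤ L) (r : Fin m → ℂ) :
    Integrable fun w : Fin (N - m) → ℂ => eigWeight n L (glue r w : Fin N → ℂ) := by
  obtain ⟨K, hK, h⟩ := exists_eigWeight_le hL hn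
  refine ((integrable_prod_bracket (N - m)).const_mul (K * ∏ a, bracket (r a))).mono'
    ((continuous_eigWeight hL N).comp (continuous_glue hm r)).aestronglyMeasurable
    (Filter.Eventually.of_forall fun w => ?_)
  rw [Real.norm_eq_abs, abs_of_nonneg (eigWeight_nonneg n L _)]
  refine (h _).trans_eq ?_
  rw [← Equiv.prod_comp (splitEquiv hm), Fintype.prod_sum_type, mul_assoc]
  simp only [glue_inl, glue_inr]

lemma restrict_upperHalf (k : ℕ) : (volume : Measure (Fin k → ℂ)).restrict (upperHalf k) =
    Measure.pi fun _ => (volume : Measure ℂ).restrict {z : ℂ | 0 < z.im} := by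
  rw [← Measure.restrict_pi_pi]
  congr 1
  ext z
  simp [upperHalf]

/-- The matrix entries of the determinant that belong to the points that are not integrated. -/
def pointRow {N m : ℕ} (hm : m ≤ N) (n L : ℝ) (q : ℕ → Polynomial ℂ) (r : Fin m → ℂ)
    (a : Fin m) (α : Fin 2) (c : (Fin m ⊕ Fin (N - m)) × Fin 2) : ℂ :=
  basisFn n L q (splitEquiv hm c.1, c.2) (withConj r (a, α))

/-- The skew form on the weighted polynomials. -/
def polyForm {N m : ℕ} (hm : m ≤ N) (n L : ℝ) (q : ℕ → Polynomial ℂ)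
    (c d : (Fin m ⊕ Fin (N - m)) × Fin 2) : ℂ :=
  pairForm n L (q (2 * (splitEquiv hm c.1 : Fin N) + c.2))
    (q (2 * (splitEquiv hm d.1 : Fin N) + d.2))

lemma two_mul_add_lt {N : ℕ} (j : Fin N) (β : Fin 2) : 2 * (j : ℕ) + β < 2 * N := by
  have := j.2
  have := β.2
  omega

/-- In the Leibniz expansion each free point w_b occurs in exactly two factors, one at w_b and one
at its conjugate. So each term is a product of functions of single points. -/
lemma eigWeight_glue_eq_sum {N m : ℕ} (hm : m ≤ N) {n L : ℝ} {q : ℕ → Polynomial ℂ}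
    (hq : IsSkewOrthogonal N n L q) {r : Fin m → ℂ} (hr : r ∈ upperHalf m)
    {w : Fin (N - m) → ℂ} (hw : w ∈ upperHalf (N - m)) :
    (-4 * Complex.I) ^ N * (eigWeight n L (glue r w : Fin N → ℂ) : ℂ) =
      ∑ σ : Equiv.Perm ((Fin m ⊕ Fin (N - m)) × Fin 2), (((Equiv.Perm.sign σ : ℤ) : ℂ) *
        ∏ a, (pointRow hm n L q r a 0 (σ (.inl a, 0)) * pointRow hm n L q r a 1 (σ (.inl a, 1)))) *
        ∏ b, (basisFn n L q (splitEquiv hm (σ (.inr b, 0)).1, (σ (.inr b, 0)).2) (w b) *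
          basisFn n L q (splitEquiv hm (σ (.inr b, 1)).1, (σ (.inr b, 1)).2) (conj (w b))) := by
  rw [eigWeight_eq_det hq (glue_mem_upperHalf hm hr hw),
    ← Matrix.det_submatrix_equiv_self ((splitEquiv hm).prodCongr (Equiv.refl (Fin 2))),
    ← Matrix.det_transpose]
  have h1 := altSum_mul fun (l : Fin m ⊕ Fin (N - m)) β c =>
    basisFn n L q (splitEquiv hm c.1, c.2) (withConj (glue r w) (splitEquiv hm l, β))
  refine Eq.trans ?_ (h1.symm.trans ?_)
  · rfl
  · refine Finset.sum_congr rfl fun σ _ => ?_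
    rw [Fintype.prod_sum_type, ← mul_assoc]
    have h2 : ∀ a β, withConj (glue r w : Fin N → ℂ) (splitEquiv hm (.inl a), β) =
        withConj r (a, β) := by
      intro a β
      simp only [withConj, glue_inl]
    have h3 : ∀ b β, withConj (glue r w : Fin N → ℂ) (splitEquiv hm (.inr b), β) =
        ![w b, conj (w b)] β := by
      intro b β
      simp only [withConj, glue_inr]
    simp only [h2, h3, pointRow, Matrix.cons_val_zero, Matrix.cons_val_one]

/-- De Bruijn's integration: every term factorises over the free points, and each factor integrates
to an entry of the bilinear pairing. -/
theorem integral_eigWeight_glue {N m : ℕ} (hm : m ≤ N) {n L : ℝ} (hn : (N : ℝ) ≤ n)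
    (hL : 0 ≤ L) {q : ℕ → Polynomial ℂ} (hq : IsSkewOrthogonal N n L q) {r : Fin m → ℂ}
    (hr : r ∈ upperHalf m) :
    (-4 * Complex.I) ^ N * ((∫ w in upperHalf (N - m), eigWeight n L (glue r w : Fin N → ℂ) : ℝ) : ℂ)
      = altSum (Sum.elim (fun a c d => pointRow hm n L q r a 0 c * pointRow hm n L q r a 1 d)
        fun _ => polyForm hm n L q) := by
  have hdeg : ∀ c : Fin N × Fin 2, (q (2 * c.1 + c.2)).natDegree < 2 * N := by
    intro c
    rw [hq.natDegree _ (two_mul_add_lt _ _)]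
    exact two_mul_add_lt _ _
  rw [← integral_complex_ofReal, ← integral_const_mul]
  rw [setIntegral_congr_fun (measurableSet_upperHalf _) fun w hw =>
    eigWeight_glue_eq_sum hm hq hr hw]
  rw [restrict_upperHalf, integral_finsetSum]
  · refine Finset.sum_congr rfl fun σ _ => ?_
    rw [integral_const_mul, integral_fintype_prod_eq_prod (fun b (x : ℂ) =>
      basisFn n L q (splitEquiv hm (σ (.inr b, 0)).1, (σ (.inr b, 0)).2) x *
          basisFn n L q (splitEquiv hm (σ (.inr b, 1)).1, (σ (.inr b, 1)).2) (conj x)),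
      Fintype.prod_sum_type, mul_assoc]
    rfl
  · intro σ _
    refine Integrable.const_mul ?_ _
    exact Integrable.fintype_prod (f := fun b (x : ℂ) =>
      basisFn n L q (splitEquiv hm (σ (.inr b, 0)).1, (σ (.inr b, 0)).2) x *
          basisFn n L q (splitEquiv hm (σ (.inr b, 1)).1, (σ (.inr b, 1)).2) (conj x))
      fun b => integrableOn_pairForm hL hn (hdeg _) (hdeg _)

lemma skewProduct_eq {N : ℕ} {n L : ℝ} {q : ℕ → Polynomial ℂ}
    (hq : IsSkewOrthogonal N n L q) (c d : Fin N × Fin 2) :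
    skewProduct n L (q (2 * c.1 + c.2)) (q (2 * d.1 + d.2)) =
      ∑ j : Fin N, g n L q j * (unitRow j 0 c * unitRow j 1 d) -
        ∑ j : Fin N, g n L q j * (unitRow j 0 d * unitRow j 1 c) := by
  obtain ⟨a, α⟩ := c
  obtain ⟨b, β⟩ := d
  simp only [unitRow, Prod.mk.injEq]
  fin_cases α <;> fin_cases β
  · simpa using hq.even_even a a.2 b b.2
  · by_cases h : a = b
    · subst h
      simp [g]
    · have h' : (a : ℕ) ≠ b := fun h2 => h (Fin.ext h2)
      have := hq.even_odd a a.2 b b.2 h'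
      simpa [h, ite_and] using this
  · by_cases h : a = b
    · subst h
      rw [skewProduct_swap]
      simp [g]
    · have h' : (b : ℕ) ≠ a := fun h2 => h (Fin.ext h2.symm)
      have := hq.even_odd b b.2 a a.2 h'
      rw [skewProduct_swap]
      simpa [Ne.symm h, ite_and] using this
  · simpa using hq.odd_odd a a.2 b b.2

lemma polyForm_sub_swap {N m : ℕ} (hm : m ≤ N) {n L : ℝ} (hn : (N : ℝ) ≤ n)
    (hL : 0 ≤ L) {q : ℕ → Polynomial ℂ} (hq : IsSkewOrthogonal N n L q)
    (c d : (Fin m ⊕ Fin (N - m)) × Fin 2) :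
    polyForm hm n L q c d - polyForm hm n L q d c =
      ∑ j, (-Complex.I * g n L q (splitEquiv hm j : Fin N)) * (unitRow j 0 c * unitRow j 1 d) -
      ∑ j, (-Complex.I * g n L q (splitEquiv hm j : Fin N)) * (unitRow j 0 d * unitRow j 1 c) := by
  have hdeg : ∀ c : Fin N × Fin 2, (q (2 * c.1 + c.2)).natDegree < 2 * N := by
    intro c
    rw [hq.natDegree _ (two_mul_add_lt _ _)]
    exact two_mul_add_lt _ _
  have hunit : ∀ (j : Fin m ⊕ Fin (N - m)) β (c : (Fin m ⊕ Fin (N - m)) × Fin 2),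
      unitRow (splitEquiv hm j) β ((splitEquiv hm c.1, c.2) : Fin N × Fin 2) = unitRow j β c := by
    intro j β c
    simp only [unitRow, Prod.ext_iff, EmbeddingLike.apply_eq_iff_eq]
  rw [polyForm, polyForm, pairForm_sub_swap hL hn (hdeg (splitEquiv hm c.1, c.2))
    (hdeg (splitEquiv hm d.1, d.2)), skewProduct_eq hq (splitEquiv hm c.1, c.2)
    (splitEquiv hm d.1, d.2), ← Equiv.sum_comp (splitEquiv hm), ← Equiv.sum_comp (splitEquiv hm)]
  simp only [hunit]
  rw [mul_sub, Finset.mul_sum, Finset.mul_sum]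
  simp only [mul_assoc]

theorem factorial_mul_integral_eigWeight {N m : ℕ} (hm : m ≤ N) {n L : ℝ} (hn : (N : ℝ) ≤ n)
    (hL : 0 ≤ L) {q : ℕ → Polynomial ℂ} (hq : IsSkewOrthogonal N n L q) {r : Fin m → ℂ}
    (hr : r ∈ upperHalf m) :
    (m.factorial : ℂ) * ((-4 * Complex.I) ^ N *
      ((∫ w in upperHalf (N - m), eigWeight n L (glue r w : Fin N → ℂ) : ℝ) : ℂ)) =
    ∑ π : Equiv.Perm (Fin m ⊕ Fin (N - m)),
      (∏ b, (-Complex.I * g n L q (splitEquiv hm (π (.inr b)) : Fin N))) *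
        pairMinor (pointRow hm n L q r) (π ∘ Sum.inl) := by
  rw [integral_eigWeight_glue hm hn hL hq hr]
  have := altSum_eq_sum_perm (pointRow hm n L q r)
    (fun j => -Complex.I * g n L q (splitEquiv hm j : Fin N)) (polyForm hm n L q)
    (polyForm_sub_swap hm hn hL hq)
  rwa [Fintype.card_fin] at this

/-- The case m = 0, where all minors are empty determinants and every permutation contributes the
full product. -/
theorem integral_eigWeight_eq {N : ℕ} {n L : ℝ} (hn : (N : ℝ) ≤ n)
    (hL : 0 ≤ L) {q : ℕ → Polynomial ℂ} (hq : IsSkewOrthogonal N n L q) :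
    (-4 * Complex.I) ^ N * ((∫ z in upperHalf N, eigWeight n L z : ℝ) : ℂ) =
      (N.factorial : ℂ) * ∏ j : Fin N, (-Complex.I * g n L q j) := by
  have h1 := factorial_mul_integral_eigWeight (Nat.zero_le N) hn hL hq (r := Fin.elim0)
    (fun i => i.elim0)
  have h2 : ∀ w : Fin (N - 0) → ℂ, (glue (Fin.elim0 : Fin 0 → ℂ) w : Fin N → ℂ) = w := by
    intro w
    ext1 i
    simp [glue]
  simp only [h2] at h1
  rw [Nat.factorial_zero, Nat.cast_one, one_mul] at h1
  refine Eq.trans h1 ?_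
  have h3 : ∀ π : Equiv.Perm (Fin 0 ⊕ Fin (N - 0)),
      (∏ b, (-Complex.I * g n L q (splitEquiv (Nat.zero_le N) (π (.inr b)) : Fin N))) *
        pairMinor (pointRow (Nat.zero_le N) n L q Fin.elim0) (π ∘ Sum.inl) =
      ∏ j : Fin N, (-Complex.I * g n L q j) := by
    intro π
    rw [pairMinor, Matrix.det_isEmpty, mul_one,
      ← Equiv.prod_comp (π.trans (splitEquiv (Nat.zero_le N))), Fintype.prod_sum_type]
    simp
  simp only [h3]
  rw [Finset.sum_const, Finset.card_univ, Fintype.card_perm, nsmul_eq_mul]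
  simp

lemma integral_eigWeight_ne_zero {N : ℕ} {n L : ℝ} (hn : (N : ℝ) ≤ n) (hL : 0 ≤ L) :
    ∫ z in upperHalf N, eigWeight n L z ≠ 0 := by
  rw [integral_eq_lintegral_of_nonneg_ae (Filter.Eventually.of_forall (eigWeight_nonneg n L))
    (continuous_eigWeight hL N).aestronglyMeasurable]
  exact (ENNReal.toReal_pos (setLIntegral_eigWeight_ne_zero hL N)
    (setLIntegral_eigWeight_ne_top hL hn)).ne'

/-- The total integral of the density is nonzero and has each g_j as a factor. Nothing in the
definition of skew-orthogonality says this, yet the kernels divide by g_j. -/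
lemma g_ne_zero {N : ℕ} {n L : ℝ} (hn : (N : ℝ) ≤ n) (hL : 0 ≤ L) {q : ℕ → Polynomial ℂ}
    (hq : IsSkewOrthogonal N n L q) (j : Fin N) : g n L q j ≠ 0 := by
  intro h
  have h1 := integral_eigWeight_eq hn hL hq
  rw [Finset.prod_eq_zero (Finset.mem_univ j) (by rw [h, mul_zero]), mul_zero] at h1
  exact mul_ne_zero (pow_ne_zero _ (by simp)) (by exact_mod_cast integral_eigWeight_ne_zero hn hL) h1

/-- The Pfaffian of the kernel as a sum over permutations. -/
theorem pfaffian_kernelMatrix {N m : ℕ} (hm : m ≤ N) (n L : ℝ) (q : ℕ → Polynomial ℂ)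
    (r : Fin m → ℂ) :
    ((N - m).factorial : ℂ) * ((m.factorial : ℂ) * pfaffian (kernelMatrix N n L q r)) =
    ∑ π : Equiv.Perm (Fin m ⊕ Fin (N - m)),
      (∏ a, (Complex.I / g n L q (splitEquiv hm (π (.inl a)) : Fin N))) *
        pairMinor (pointRow hm n L q r) (π ∘ Sum.inl) := by
  set u := pointRow hm n L q r with hu
  set c : Fin m ⊕ Fin (N - m) → ℂ := fun j => Complex.I / g n L q (splitEquiv hm j : Fin N) with hc
  set Y : Fin m × Fin 2 → Fin m × Fin 2 → ℂ :=
    fun a b => ∑ j, c j * (u a.1 a.2 (j, 0) * u b.1 b.2 (j, 1)) with hY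
  -- All four blocks are the same antisymmetric kernel, evaluated at a point or at its conjugate in
  -- each slot. Only the lower left block needs the antisymmetry.
  have h1 : kernelMatrix N n L q r = Matrix.of fun a b => Y a b - Y b a := by
    ext ⟨a, α⟩ ⟨b, β⟩
    have h2 : Y (a, α) (b, β) - Y (b, β) (a, α) = Complex.I * ∑ j ∈ Finset.range N,
        h n L (withConj r (a, α)) * h n L (withConj r (b, β)) / g n L q j *
        ((q (2 * j)).eval (withConj r (a, α)) * (q (2 * j + 1)).eval (withConj r (b, β)) -
          (q (2 * j + 1)).eval (withConj r (a, α)) * (q (2 * j)).eval (withConj r (b, β))) := by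
      rw [Finset.sum_range, ← Equiv.sum_comp (splitEquiv hm), hY, Finset.mul_sum]
      simp only
      rw [← Finset.sum_sub_distrib]
      refine Finset.sum_congr rfl fun j _ => ?_
      simp only [hu, hc, pointRow, basisFn, Fin.val_zero, Fin.val_one, add_zero]
      ring
    rw [Matrix.of_apply, h2]
    fin_cases α <;> fin_cases β
    · rfl
    · rfl
    · simp only [kernelMatrix, Matrix.of_apply, kerS, withConj]
      simp
      rw [← mul_neg, ← Finset.sum_neg_distrib]
      congr 1
      refine Finset.sum_congr rfl fun j _ => ?_
      ring
    · rfl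
  have h3 := altSum_sum_eq_sum_perm u c
  rw [Fintype.card_fin] at h3
  rw [h1, pfaffian_sub_swap, mul_div_cancel₀ _ (by positivity : (m.factorial : ℂ) ≠ 0)]
  exact h3

/-- The integrated density and the Pfaffian are sums of the same minors, with weights that differ by
the common factor Γ. Dividing by the case m = 0, with (N - m)! times the falling factorial equal to
N!, clears all constants. -/
theorem correlation_eq_pfaffian {N m : ℕ} (hm : m ≤ N) {n L : ℝ} (hn : (N : ℝ) ≤ n)
    (hL : 0 ≤ L) {Q : (Fin N → ℂ) → ℝ} (hQ : IsEigenvalueJpdf N n L Q) {q : ℕ → Polynomial ℂ}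
    (hq : IsSkewOrthogonal N n L q) {r : Fin m → ℂ} (hr : r ∈ upperHalf m) :
    (correlation Q m r : ℂ) = pfaffian (kernelMatrix N n L q r) := by
  have hM : (eigMass N n L).toReal ≠ 0 := (ENNReal.toReal_pos (setLIntegral_eigWeight_ne_zero hL N)
    (setLIntegral_eigWeight_ne_top hL hn)).ne'
  have hZ := integral_eigWeight_ne_zero hn hL (N := N)
  have h1 : ∫ z in upperHalf N, Q z =
      (∫ z in upperHalf N, eigWeight n L z) / (eigMass N n L).toReal := by
    rw [← integral_div]
    exact setIntegral_congr_fun (measurableSet_upperHalf N) fun z hz => hQ.eq_eigDensity hn hL hz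
  have h2 : ∫ w in upperHalf (N - m), Q (glue r w) =
      (∫ w in upperHalf (N - m), eigWeight n L (glue r w : Fin N → ℂ)) /
        (eigMass N n L).toReal := by
    rw [← integral_div]
    exact setIntegral_congr_fun (measurableSet_upperHalf _) fun w hw =>
      hQ.eq_eigDensity hn hL (glue_mem_upperHalf hm hr hw)
  have h3 := factorial_mul_integral_eigWeight hm hn hL hq hr
  have h4 := integral_eigWeight_eq hn hL hq
  have h5 := pfaffian_kernelMatrix hm n L q r
  set Γ := ∏ j : Fin N, (-Complex.I * g n L q j) with hΓ
  have hg : ∀ j : Fin N, g n L q j ≠ 0 := g_ne_zero hn hL hq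
  -- The full product splits into chosen and remaining indices, and (-i g)(i / g) = 1 cancels the
  -- chosen ones.
  have h6 : ∀ π : Equiv.Perm (Fin m ⊕ Fin (N - m)),
      ∏ b, (-Complex.I * g n L q (splitEquiv hm (π (.inr b)) : Fin N)) =
      Γ * ∏ a, (Complex.I / g n L q (splitEquiv hm (π (.inl a)) : Fin N)) := by
    intro π
    rw [hΓ, ← Equiv.prod_comp (π.trans (splitEquiv hm)), Fintype.prod_sum_type, mul_right_comm,
      ← Finset.prod_mul_distrib]
    rw [Finset.prod_eq_one (s := (Finset.univ : Finset (Fin m))), one_mul]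
    · rfl
    · intro a _
      have := hg (splitEquiv hm (π (.inl a)))
      simp only [Equiv.trans_apply]
      field_simp
      rw [Complex.I_sq, neg_neg]
  simp only [h6, mul_assoc] at h3
  rw [← Finset.mul_sum, ← h5] at h3
  have hdf : ((N - m).factorial : ℂ) * (N.descFactorial m : ℂ) = (N.factorial : ℂ) := by
    exact_mod_cast Nat.factorial_mul_descFactorial hm
  have hm0 : (m.factorial : ℂ) ≠ 0 := by positivity
  have hk0 : (-4 * Complex.I) ^ N ≠ 0 := pow_ne_zero _ (by simp)
  set Z := ∫ z in upperHalf N, eigWeight n L z with hZdef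
  set W := ∫ w in upperHalf (N - m), eigWeight n L (glue r w : Fin N → ℂ) with hW
  have hZ' : (Z : ℂ) ≠ 0 := by exact_mod_cast hZ
  have h7 : correlation Q m r = N.descFactorial m * W / Z := by
    rw [correlation, h1, h2]
    field_simp
  rw [h7]
  push_cast
  rw [div_eq_iff hZ']
  have h8 : (-4 * Complex.I) ^ N * (W : ℂ) =
      Γ * (((N - m).factorial : ℂ) * pfaffian (kernelMatrix N n L q r)) := by
    refine mul_left_cancel₀ hm0 ?_
    rw [h3]
    ring
  refine mul_left_cancel₀ hk0 ?_
  calc (-4 * Complex.I) ^ N * ((N.descFactorial m : ℂ) * W)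
      = (N.descFactorial m : ℂ) * ((-4 * Complex.I) ^ N * W) := by ring
    _ = pfaffian (kernelMatrix N n L q r) *
          ((((N - m).factorial : ℂ) * (N.descFactorial m : ℂ)) * Γ) := by rw [h8]; ring
    _ = _ := by rw [hdf, ← h4]; ring

theorem integrableOn_glue {N m : ℕ} (hm : m ≤ N) {n L : ℝ} (hn : (N : ℝ) ≤ n)
    (hL : 0 ≤ L) {Q : (Fin N → ℂ) → ℝ} (hQ : IsEigenvalueJpdf N n L Q) {r : Fin m → ℂ}
    (hr : r ∈ upperHalf m) : IntegrableOn (fun w => Q (glue r w)) (upperHalf (N - m)) :=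
  ((integrable_eigWeight_glue hm hn hL r).div_const (eigMass N n L).toReal).integrableOn.congr_fun
    (fun _ hw => (hQ.eq_eigDensity hn hL (glue_mem_upperHalf hm hr hw)).symm)
    (measurableSet_upperHalf _)

/-! ## The skew products of the monomials -/

/-- A Beta integral. -/
lemma integral_rpow_mul_one_add_sq {s c : ℝ} (hs : -1 < s) (hc : (s + 1) / 2 < c) :
    ∫ r in Set.Ioi (0 : ℝ), r ^ s * (1 + r ^ 2) ^ (-c) =
      Real.Gamma ((s + 1) / 2) * Real.Gamma (c - (s + 1) / 2) / (2 * Real.Gamma c) := by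
  have hs' : 0 < (s + 1) / 2 := by linarith
  have hc0 : 0 < c := hs'.trans hc
  -- The integrand that represents Γ(c) (1 + r²) ^ (-c) as an integral over t. Exchanging the two
  -- integrals leaves a Gaussian moment in r and a Gamma integral in t.
  set f : ℝ × ℝ → ℝ := fun p => p.1 ^ s * (p.2 ^ (c - 1) * Real.exp (-((1 + p.1 ^ 2) * p.2)))
    with hf
  set μ := (volume : Measure ℝ).restrict (Set.Ioi 0) with hμ
  have hfm : AEStronglyMeasurable f (μ.prod μ) := by
    refine Measurable.aestronglyMeasurable ?_
    exact (measurable_fst.pow_const _).mul ((measurable_snd.pow_const _).mul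
      (Real.measurable_exp.comp
        (((measurable_fst.pow_const 2).const_add 1).mul measurable_snd).neg))
  have hfe : ∀ r t, f (r, t) = t ^ (c - 1) * Real.exp (-t) *
      (r ^ s * Real.exp (-t * r ^ (2 : ℝ))) := by
    intro r t
    have h1 : Real.exp (-((1 + r ^ 2) * t)) = Real.exp (-t) * Real.exp (-t * r ^ (2 : ℝ)) := by
      rw [← Real.exp_add, Real.rpow_two]
      ring_nf
    simp only [hf, h1]
    ring
  have hf0 : ∀ r ∈ Set.Ioi (0 : ℝ), ∀ t ∈ Set.Ioi (0 : ℝ), 0 ≤ f (r, t) := by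
    intro r hr t ht
    simp only [hf]
    have := Set.mem_Ioi.1 hr
    have := Set.mem_Ioi.1 ht
    positivity
  have hin : ∀ t ∈ Set.Ioi (0 : ℝ), ∫ r, f (r, t) ∂μ =
      t ^ ((c - (s + 1) / 2) - 1) * Real.exp (-(1 * t)) * (1 / 2 * Real.Gamma ((s + 1) / 2)) := by
    intro t ht
    have ht0 : 0 < t := ht
    simp only [hfe]
    rw [integral_const_mul, integral_rpow_mul_exp_neg_mul_rpow two_pos hs ht0]
    have h1 : t ^ ((c - (s + 1) / 2) - 1) = t ^ (c - 1) * t ^ (-(s + 1) / 2) := by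
      rw [← Real.rpow_add ht0]
      ring_nf
    rw [h1, one_mul]
    ring
  have hgam : IntegrableOn (fun t : ℝ => t ^ ((c - (s + 1) / 2) - 1) * Real.exp (-(1 * t)) *
      (1 / 2 * Real.Gamma ((s + 1) / 2))) (Set.Ioi 0) := by
    have := Real.GammaIntegral_convergent (s := c - (s + 1) / 2) (by linarith)
    refine Integrable.mul_const ?_ _
    refine this.congr (Filter.Eventually.of_forall fun t => ?_)
    simp only [one_mul]
    ring
  have hint : Integrable f (μ.prod μ) := by
    rw [integrable_prod_iff' hfm]
    constructor
    · refine (ae_restrict_iff' measurableSet_Ioi).2 (Filter.Eventually.of_forall fun t ht => ?_)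
      simp only [hfe]
      exact (integrableOn_rpow_mul_exp_neg_mul_rpow hs (by norm_num) ht).const_mul _
    · refine hgam.congr_fun (fun t ht => ?_) measurableSet_Ioi
      simp only
      rw [← hin t ht]
      exact setIntegral_congr_fun measurableSet_Ioi fun r hr =>
        (Real.norm_of_nonneg (hf0 r hr t ht)).symm
  have hswap := integral_integral_swap (f := fun r t => f (r, t)) hint
  have h1 : ∫ r, ∫ t, f (r, t) ∂μ ∂μ =
      (∫ r in Set.Ioi (0 : ℝ), r ^ s * (1 + r ^ 2) ^ (-c)) * Real.Gamma c := by
    rw [← integral_mul_const]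
    refine setIntegral_congr_fun measurableSet_Ioi fun r _ => ?_
    have hb : (0 : ℝ) < 1 + r ^ 2 := by positivity
    simp only [hf]
    rw [integral_const_mul, Real.integral_rpow_mul_exp_neg_mul_Ioi hc0 hb, one_div,
      Real.inv_rpow hb.le, ← Real.rpow_neg hb.le]
    ring
  have h2 : ∫ t, ∫ r, f (r, t) ∂μ ∂μ =
      Real.Gamma (c - (s + 1) / 2) * (1 / 2 * Real.Gamma ((s + 1) / 2)) := by
    rw [setIntegral_congr_fun measurableSet_Ioi hin, integral_mul_const,
      Real.integral_rpow_mul_exp_neg_mul_Ioi (by linarith) one_pos]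
    simp
  rw [h1, h2] at hswap
  have hG : Real.Gamma c ≠ 0 := (Real.Gamma_pos_of_pos hc0).ne'
  rw [eq_div_iff (by positivity)]
  linear_combination 2 * hswap

lemma integral_cos_int_mul (k : ℤ) :
    ∫ θ in (0 : ℝ)..Real.pi, Real.cos (k * θ) = if k = 0 then Real.pi else 0 := by
  split_ifs with hk
  · simp [hk]
  · have hk' : (k : ℝ) ≠ 0 := by exact_mod_cast hk
    rw [intervalIntegral.integral_comp_mul_left (fun x => Real.cos x) hk', integral_cos]
    simp [Real.sin_int_mul_pi]

lemma integral_sin_mul_sin (k : ℤ) :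
    ∫ θ in (0 : ℝ)..Real.pi, 2 * Real.sin θ * Real.sin (k * θ) =
      (if k = 1 then Real.pi else 0) - (if k = -1 then Real.pi else 0) := by
  have h1 : ∀ θ : ℝ, 2 * Real.sin θ * Real.sin (k * θ) =
      Real.cos ((k - 1 : ℤ) * θ) - Real.cos ((k + 1 : ℤ) * θ) := by
    intro θ
    push_cast
    rw [sub_mul, add_mul, one_mul, Real.cos_sub, Real.cos_add]
    ring
  simp only [h1]
  rw [intervalIntegral.integral_sub, integral_cos_int_mul, integral_cos_int_mul]
  · simp only [sub_eq_zero, eq_neg_iff_add_eq_zero]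
  · exact (Real.continuous_cos.comp (continuous_const.mul continuous_id)).intervalIntegrable _ _
  · exact (Real.continuous_cos.comp (continuous_const.mul continuous_id)).intervalIntegrable _ _

/-- The radial part of the skew product of the monomials of degree sum `d`. -/
def radialIntegral (n L : ℝ) (d : ℕ) : ℝ :=
  ∫ r in Set.Ioi (0 : ℝ), r ^ (4 * L + d + 2) * (1 + r ^ 2) ^ (-(2 * (n + L + 1)))

lemma pow_mul_conj_pow_sub (r θ : ℝ) (a b : ℕ) :
    ((r : ℂ) * Complex.exp (θ * Complex.I)) ^ a * conj ((r : ℂ) * Complex.exp (θ * Complex.I)) ^ b -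
      conj ((r : ℂ) * Complex.exp (θ * Complex.I)) ^ a *
        ((r : ℂ) * Complex.exp (θ * Complex.I)) ^ b =
    (r : ℂ) ^ (a + b) * (2 * Complex.I * (Real.sin (((a : ℤ) - b : ℤ) * θ) : ℂ)) := by
  have h1 : conj (Complex.exp (θ * Complex.I)) = Complex.exp (-(θ * Complex.I)) := by
    rw [← Complex.exp_conj]
    simp
  rw [map_mul, Complex.conj_ofReal, h1, mul_pow, mul_pow, mul_pow, mul_pow,
    ← Complex.exp_nat_mul, ← Complex.exp_nat_mul, ← Complex.exp_nat_mul, ← Complex.exp_nat_mul,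
    Complex.ofReal_sin, Complex.sin, pow_add]
  have h2 : Complex.exp (a * (θ * Complex.I)) * Complex.exp (b * -(θ * Complex.I)) =
      Complex.exp (((((a : ℤ) - b : ℤ) * θ : ℝ) : ℂ) * Complex.I) := by
    rw [← Complex.exp_add]
    push_cast
    ring_nf
  have h3 : Complex.exp (a * -(θ * Complex.I)) * Complex.exp (b * (θ * Complex.I)) =
      Complex.exp (-((((a : ℤ) - b : ℤ) * θ : ℝ) : ℂ) * Complex.I) := by
    rw [← Complex.exp_add]
    push_cast
    ring_nf
  linear_combination (r : ℂ) ^ a * (r : ℂ) ^ b * (h2 - h3) +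
    (r : ℂ) ^ a * (r : ℂ) ^ b * (Complex.exp (((((a : ℤ) - b : ℤ) * θ : ℝ) : ℂ) * Complex.I) -
      Complex.exp (-((((a : ℤ) - b : ℤ) * θ : ℝ) : ℂ) * Complex.I)) * Complex.I_sq

/-- In polar coordinates the angular part is 2 sin θ sin ((a - b) θ) on (0, π), one sine coming from
im z in the weight. It vanishes unless |a - b| = 1. -/
lemma integral_monomials (n L : ℝ) (a b : ℕ) :
    ∫ z in {z : ℂ | 0 < z.im}, (skewWeight n L z : ℂ) *
      (z ^ a * conj z ^ b - conj z ^ a * z ^ b) =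
    (radialIntegral n L (a + b) : ℂ) * (2 * Complex.I *
      (((if (a : ℤ) - b = 1 then Real.pi else 0) - (if (a : ℤ) - b = -1 then Real.pi else 0) : ℝ) :
        ℂ)) := by
  rw [← integral_indicator measurableSet_upper, ← Complex.integral_comp_polarCoord_symm]
  set F : ℝ → ℂ := fun r =>
    ((r ^ (4 * L + (a + b : ℕ) + 2) * (1 + r ^ 2) ^ (-(2 * (n + L + 1))) : ℝ) : ℂ) with hF
  set G : ℝ → ℂ := (Set.Ioo 0 Real.pi).indicator fun θ =>
    2 * Complex.I * ((2 * Real.sin θ * Real.sin (((a : ℤ) - b : ℤ) * θ) : ℝ) : ℂ) with hG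
  have key : ∀ p ∈ polarCoord.target, (p.1 • Set.indicator {z : ℂ | 0 < z.im}
      (fun z => (skewWeight n L z : ℂ) * (z ^ a * conj z ^ b - conj z ^ a * z ^ b))
        (Complex.polarCoord.symm p) : ℂ) = F p.1 * G p.2 := by
    rintro ⟨r, θ⟩ ⟨hr, hθ⟩
    have hr0 : 0 < r := hr
    have hz : Complex.polarCoord.symm (r, θ) = (r : ℂ) * Complex.exp (θ * Complex.I) := by
      rw [Complex.polarCoord_symm_apply, Complex.exp_mul_I, Complex.ofReal_cos, Complex.ofReal_sin]
    have him : ((r : ℂ) * Complex.exp (θ * Complex.I)).im = r * Real.sin θ := by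
      rw [Complex.im_ofReal_mul, Complex.exp_ofReal_mul_I_im]
    have hnorm : ‖(r : ℂ) * Complex.exp (θ * Complex.I)‖ = r := by
      rw [norm_mul, Complex.norm_exp_ofReal_mul_I, mul_one, Complex.norm_real,
        Real.norm_of_nonneg hr0.le]
    simp only
    by_cases hpos : θ ∈ Set.Ioo 0 Real.pi
    · have hsin : 0 < Real.sin θ := Real.sin_pos_of_mem_Ioo hpos
      rw [hz, Set.indicator_of_mem (show _ ∈ {z : ℂ | 0 < z.im} from by
        change 0 < ((r : ℂ) * Complex.exp (θ * Complex.I)).im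
        rw [him]
        positivity), hG, Set.indicator_of_mem hpos, pow_mul_conj_pow_sub, skewWeight, hnorm, him,
        hF]
      -- The r² collects one r from im z and one from the polar Jacobian.
      have h1 : r ^ (4 * L + (a + b : ℕ) + 2) = r ^ (4 * L) * r ^ (a + b) * r ^ 2 := by
        rw [Real.rpow_add hr0, Real.rpow_add hr0, Real.rpow_natCast, Real.rpow_two]
      simp only [h1]
      rw [Complex.real_smul]
      push_cast
      ring
    · have hsin : Real.sin θ ≤ 0 := by
        refine Real.sin_nonpos_of_nonpos_of_neg_pi_le ?_ hθ.1.le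
        by_contra h
        exact hpos ⟨not_le.1 h, hθ.2⟩
      rw [hz, Set.indicator_of_notMem (show _ ∉ {z : ℂ | 0 < z.im} from by
        change ¬ 0 < ((r : ℂ) * Complex.exp (θ * Complex.I)).im
        rw [him, not_lt]
        exact mul_nonpos_of_nonneg_of_nonpos hr0.le hsin), hG, Set.indicator_of_notMem hpos]
      simp
  rw [setIntegral_congr_fun polarCoord.open_target.measurableSet key]
  have h2 : polarCoord.target = Set.Ioi (0 : ℝ) ×ˢ Set.Ioo (-Real.pi) Real.pi := rfl
  rw [h2, Measure.volume_eq_prod, setIntegral_prod_mul]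
  congr 1
  · rw [hF, integral_complex_ofReal, radialIntegral]
  · rw [hG, setIntegral_indicator measurableSet_Ioo, Set.inter_eq_right.2
      (Set.Ioo_subset_Ioo_left (by linarith [Real.pi_pos])), integral_const_mul,
      integral_complex_ofReal, ← integral_Ioc_eq_integral_Ioo,
      ← intervalIntegral.integral_of_le Real.pi_pos.le, integral_sin_mul_sin]

lemma skewProduct_X_pow (n L : ℝ) (a b : ℕ) :
    skewProduct n L (Polynomial.X ^ a) (Polynomial.X ^ b) =
      ((2 * radialIntegral n L (a + b) *
        ((if b = a + 1 then Real.pi else 0) - (if a = b + 1 then Real.pi else 0)) : ℝ) : ℂ) := by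
  have h1 := integral_monomials n L a b
  have h2 : skewProduct n L (Polynomial.X ^ a) (Polynomial.X ^ b) =
      Complex.I * ∫ z in {z : ℂ | 0 < z.im}, (skewWeight n L z : ℂ) *
        (z ^ a * conj z ^ b - conj z ^ a * z ^ b) := by
    rw [skewProduct]
    congr 1
    refine setIntegral_congr_fun measurableSet_upper fun z hz => ?_
    simp only [Polynomial.eval_pow, Polynomial.eval_X]
    rw [h_mul_h_conj hz]
  have h3 : ((a : ℤ) - b = 1) ↔ a = b + 1 := by omega
  have h4 : ((a : ℤ) - b = -1) ↔ b = a + 1 := by omega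
  rw [h2, h1]
  simp only [h3, h4]
  generalize (if a = b + 1 then Real.pi else 0) = x
  generalize (if b = a + 1 then Real.pi else 0) = y
  push_cast
  linear_combination (2 * (radialIntegral n L (a + b) : ℂ) * (x - y)) * Complex.I_sq

lemma radialIntegral_eq {n L : ℝ} (hL : 0 ≤ L) {d : ℕ} (hd : (d : ℝ) + 3 < 4 * n + 4) :
    radialIntegral n L d = Real.Gamma (2 * L + (d + 3) / 2) *
      Real.Gamma (2 * n + 2 - (d + 3) / 2) / (2 * Real.Gamma (2 * n + 2 * L + 2)) := by
  have hd0 : (0 : ℝ) ≤ d := Nat.cast_nonneg d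
  rw [radialIntegral, integral_rpow_mul_one_add_sq (by linarith) (by linarith)]
  rw [show (4 * L + d + 2 + 1) / 2 = 2 * L + (d + 3) / 2 by ring,
    show 2 * (n + L + 1) - (2 * L + (d + 3) / 2) = 2 * n + 2 - (d + 3) / 2 by ring,
    show 2 * (n + L + 1) = 2 * n + 2 * L + 2 by ring]

/-! ## The explicit polynomials -/

/-- The coefficient of `z^{2j}` in the explicit polynomial of degree `2k`. -/
def explicitCoeff (n L : ℝ) (k j : ℕ) : ℝ :=
  Real.Gamma (L + k + 1) * Real.Gamma (n - k + 1 / 2) /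
    (Real.Gamma (L + j + 1) * Real.Gamma (n - j + 1 / 2))

lemma explicitPoly_odd (n L : ℝ) (k : ℕ) :
    explicitPoly n L (2 * k + 1) = Polynomial.X ^ (2 * k + 1) := by
  rw [explicitPoly, if_pos (by omega)]

lemma explicitPoly_even (n L : ℝ) (k : ℕ) : explicitPoly n L (2 * k) =
    ∑ j ∈ Finset.range (k + 1), Polynomial.C (explicitCoeff n L k j : ℂ) *
      Polynomial.X ^ (2 * j) := by
  rw [explicitPoly, if_neg (by omega), show 2 * k / 2 = k by omega]
  rfl

lemma explicitCoeff_self {n L : ℝ} (hL : 0 ≤ L) {k : ℕ} (hk : (k : ℝ) < n) :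
    explicitCoeff n L k k = 1 := by
  have h1 : 0 < Real.Gamma (L + k + 1) := Real.Gamma_pos_of_pos (by positivity)
  have h2 : 0 < Real.Gamma (n - k + 1 / 2) := Real.Gamma_pos_of_pos (by linarith)
  exact div_self (by positivity)

lemma explicitPoly_even_eq {n L : ℝ} (hL : 0 ≤ L) {k : ℕ} (hk : (k : ℝ) < n) :
    ∃ p : Polynomial ℂ, p.degree < (2 * k : ℕ) ∧
      explicitPoly n L (2 * k) = Polynomial.X ^ (2 * k) + p := by
  refine ⟨∑ j ∈ Finset.range k, Polynomial.C (explicitCoeff n L k j : ℂ) *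
      Polynomial.X ^ (2 * j), ?_, ?_⟩
  · rw [← Polynomial.mem_degreeLT]
    refine Submodule.sum_mem _ fun j hj => Polynomial.mem_degreeLT.2 ?_
    refine (Polynomial.degree_C_mul_X_pow_le _ _).trans_lt ?_
    have := Finset.mem_range.1 hj
    exact_mod_cast (by omega : 2 * j < 2 * k)
  · rw [explicitPoly_even, Finset.sum_range_succ, explicitCoeff_self hL hk]
    simp [add_comm]

lemma monic_natDegree_explicitPoly {N : ℕ} {n L : ℝ} (hn : (N : ℝ) ≤ n) (hL : 0 ≤ L) {l : ℕ}
    (hl : l < 2 * N) : (explicitPoly n L l).Monic ∧ (explicitPoly n L l).natDegree = l := by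
  obtain ⟨k, rfl | rfl⟩ := Nat.even_or_odd' l
  · have hk : (k : ℝ) < n := lt_of_lt_of_le (by exact_mod_cast (by omega : k < N)) hn
    obtain ⟨p, hp, h⟩ := explicitPoly_even_eq hL hk
    rw [h]
    refine ⟨Polynomial.monic_X_pow_add hp, ?_⟩
    rw [Polynomial.natDegree_add_eq_left_of_degree_lt (by simpa using hp),
      Polynomial.natDegree_X_pow]
  · rw [explicitPoly_odd]
    exact ⟨Polynomial.monic_X_pow _, Polynomial.natDegree_X_pow _⟩

lemma skewProduct_sum_C_mul {N : ℕ} {n L : ℝ} (hn : (N : ℝ) ≤ n) (hL : 0 ≤ L) {s : Finset ℕ}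
    (c : ℕ → ℂ) {p : ℕ → Polynomial ℂ} (hp : ∀ j ∈ s, (p j).natDegree < 2 * N)
    {q : Polynomial ℂ} (hq : q.natDegree < 2 * N) :
    skewProduct n L (∑ j ∈ s, Polynomial.C (c j) * p j) q =
      ∑ j ∈ s, c j * skewProduct n L (p j) q := by
  have hint : ∀ j ∈ s, IntegrableOn (fun z => c j * (h n L z * h n L (conj z) *
      ((p j).eval z * q.eval (conj z) - (p j).eval (conj z) * q.eval z))) {z : ℂ | 0 < z.im} := by
    intro j hj
    refine Integrable.const_mul (((integrableOn_pairForm hL hn (hp j hj) hq).sub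
      (integrableOn_pairForm hL hn hq (hp j hj))).congr (Filter.Eventually.of_forall
        fun z => ?_)) _
    simp only [Pi.sub_apply]
    ring
  simp only [skewProduct]
  rw [show (∑ j ∈ s, c j * (Complex.I * ∫ z in {z : ℂ | 0 < z.im}, h n L z * h n L (conj z) *
      ((p j).eval z * q.eval (conj z) - (p j).eval (conj z) * q.eval z))) =
      Complex.I * ∑ j ∈ s, ∫ z in {z : ℂ | 0 < z.im}, c j * (h n L z * h n L (conj z) *
      ((p j).eval z * q.eval (conj z) - (p j).eval (conj z) * q.eval z)) by
    rw [Finset.mul_sum]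
    refine Finset.sum_congr rfl fun j _ => ?_
    rw [integral_const_mul]
    ring, ← integral_finsetSum _ hint]
  congr 2
  ext z
  simp only [Polynomial.eval_finsetSum, Polynomial.eval_mul, Polynomial.eval_C]
  rw [Finset.sum_mul, Finset.sum_mul, ← Finset.sum_sub_distrib, Finset.mul_sum]
  exact Finset.sum_congr rfl fun j _ => by ring

lemma two_mul_radialIntegral_one {n L : ℝ} (hL : 0 ≤ L) {k : ℕ} (hk : (k : ℝ) < n) :
    2 * radialIntegral n L (2 * k + (2 * k + 1)) * Real.pi = explicitNorm n L k := by
  rw [radialIntegral_eq hL (by push_cast; linarith), explicitNorm]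
  push_cast
  rw [show 2 * L + (2 * (k : ℝ) + (2 * k + 1) + 3) / 2 = 2 * L + 2 * k + 2 by ring,
    show 2 * n + 2 - (2 * (k : ℝ) + (2 * k + 1) + 3) / 2 = 2 * n - 2 * k by ring]
  have h1 : 0 < Real.Gamma (2 * n + 2 * L + 2) :=
    Real.Gamma_pos_of_pos (by have : (0 : ℝ) ≤ k := Nat.cast_nonneg k; linarith)
  field_simp

/-- This is orthogonality of q_{2k} to z^{2l+1} for l < k: only the coefficients at 2l and 2l + 2
pair nontrivially with it, with opposite signs. The ratio of the radial integrals matches that of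
the coefficients by Γ(x + 1) = x Γ(x). -/
lemma explicitCoeff_mul_radialIntegral {n L : ℝ} (hL : 0 ≤ L) {k l : ℕ}
    (hl : (l : ℝ) + 1 ≤ n) :
    explicitCoeff n L k l * radialIntegral n L (2 * l + (2 * l + 1)) =
      explicitCoeff n L k (l + 1) * radialIntegral n L (2 * (l + 1) + (2 * l + 1)) := by
  have hl0 : (0 : ℝ) ≤ l := Nat.cast_nonneg l
  rw [radialIntegral_eq hL (by push_cast; linarith), radialIntegral_eq hL (by push_cast; linarith),
    explicitCoeff, explicitCoeff]
  push_cast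
  rw [show 2 * L + (2 * (l : ℝ) + (2 * l + 1) + 3) / 2 = 2 * L + 2 * l + 2 by ring,
    show 2 * n + 2 - (2 * (l : ℝ) + (2 * l + 1) + 3) / 2 = (2 * n - 2 * l - 1) + 1 by ring,
    show 2 * L + (2 * ((l : ℝ) + 1) + (2 * l + 1) + 3) / 2 = (2 * L + 2 * l + 2) + 1 by ring,
    show 2 * n + 2 - (2 * ((l : ℝ) + 1) + (2 * l + 1) + 3) / 2 = 2 * n - 2 * l - 1 by ring,
    show L + ((l : ℝ) + 1) + 1 = (L + l + 1) + 1 by ring,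
    show n - (l : ℝ) + 1 / 2 = (n - ((l : ℝ) + 1) + 1 / 2) + 1 by ring,
    Real.Gamma_add_one (by linarith : 2 * n - 2 * (l : ℝ) - 1 ≠ 0),
    Real.Gamma_add_one (by positivity : 2 * L + 2 * (l : ℝ) + 2 ≠ 0),
    Real.Gamma_add_one (by positivity : L + (l : ℝ) + 1 ≠ 0),
    Real.Gamma_add_one (by linarith : n - ((l : ℝ) + 1) + 1 / 2 ≠ 0)]
  have h1 : 0 < Real.Gamma (2 * n + 2 * L + 2) := Real.Gamma_pos_of_pos (by linarith)
  have h2 : 0 < Real.Gamma (L + l + 1) := Real.Gamma_pos_of_pos (by positivity)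
  have h3 : 0 < Real.Gamma (n - ((l : ℝ) + 1) + 1 / 2) := Real.Gamma_pos_of_pos (by linarith)
  have h4 : 0 < n - ((l : ℝ) + 1) + 1 / 2 := by linarith
  have h5 : 0 < L + (l : ℝ) + 1 := by positivity
  generalize Real.Gamma (n - ((l : ℝ) + 1) + 1 / 2) = A at *
  generalize Real.Gamma (L + l + 1) = B at *
  generalize Real.Gamma (2 * n + 2 * L + 2) = C at *
  rw [div_mul_div_comm, div_mul_div_comm, div_eq_div_iff (by positivity) (by positivity)]
  ring

lemma skewProduct_explicitPoly_even_odd {N : ℕ} {n L : ℝ} (hn : (N : ℝ) ≤ n) (hL : 0 ≤ L)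
    {k l : ℕ} (hk : k < N) (hl : l < N) :
    skewProduct n L (explicitPoly n L (2 * k)) (explicitPoly n L (2 * l + 1)) =
      if k = l then (explicitNorm n L k : ℂ) else 0 := by
  have hkn : (k : ℝ) < n := lt_of_lt_of_le (by exact_mod_cast hk) hn
  rw [explicitPoly_even, explicitPoly_odd, skewProduct_sum_C_mul hn hL
    (fun j => (explicitCoeff n L k j : ℂ)) (fun j hj => by
      have := Finset.mem_range.1 hj
      rw [Polynomial.natDegree_X_pow]
      omega) (by rw [Polynomial.natDegree_X_pow]; omega)]
  have h1 : ∀ j, (explicitCoeff n L k j : ℂ) *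
      skewProduct n L (Polynomial.X ^ (2 * j)) (Polynomial.X ^ (2 * l + 1)) =
      ((((if l = j then explicitCoeff n L k j * (2 * radialIntegral n L (2 * j + (2 * l + 1)) *
        Real.pi) else 0) - (if l + 1 = j then explicitCoeff n L k j *
        (2 * radialIntegral n L (2 * j + (2 * l + 1)) * Real.pi) else 0)) : ℝ) : ℂ) := by
    intro j
    have e1 : 2 * l + 1 = 2 * j + 1 ↔ l = j := by omega
    have e2 : 2 * j = 2 * l + 1 + 1 ↔ l + 1 = j := by omega
    rw [skewProduct_X_pow, ← Complex.ofReal_mul]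
    simp only [e1, e2]
    congr 1
    split_ifs <;> ring
  rw [Finset.sum_congr rfl fun j _ => h1 j, ← Complex.ofReal_sum, Finset.sum_sub_distrib,
    Finset.sum_ite_eq, Finset.sum_ite_eq]
  simp only [Finset.mem_range]
  -- For k < l neither degree next to 2l + 1 occurs, for k = l only the leading term pairs, and for
  -- k > l two terms cancel by the recursion.
  rcases lt_trichotomy k l with hkl | hkl | hkl
  · rw [if_neg (by omega), if_neg (by omega), if_neg (by omega)]
    simp
  · subst hkl
    rw [if_pos (by omega), if_neg (by omega), if_pos rfl, explicitCoeff_self hL hkn,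
      two_mul_radialIntegral_one hL hkn]
    simp
  · have hln : (l : ℝ) + 1 ≤ n := le_trans (by exact_mod_cast (by omega : l + 1 ≤ N)) hn
    rw [if_pos (by omega), if_pos (by omega), if_neg (by omega)]
    have := explicitCoeff_mul_radialIntegral hL hln (k := k)
    rw [Complex.ofReal_eq_zero]
    linear_combination 2 * Real.pi * this

/-- Only even powers occur, and two even degrees never differ by one. -/
lemma skewProduct_explicitPoly_even_even {N : ℕ} {n L : ℝ} (hn : (N : ℝ) ≤ n) (hL : 0 ≤ L)
    {k l : ℕ} (hk : k < N) (hl : l < N) :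
    skewProduct n L (explicitPoly n L (2 * k)) (explicitPoly n L (2 * l)) = 0 := by
  rw [explicitPoly_even n L k, skewProduct_sum_C_mul hn hL
    (fun j => (explicitCoeff n L k j : ℂ)) (fun j hj => by
      have := Finset.mem_range.1 hj
      rw [Polynomial.natDegree_X_pow]
      omega) (by rw [(monic_natDegree_explicitPoly hn hL (by omega)).2]; omega)]
  refine Finset.sum_eq_zero fun i hi => ?_
  have hi' := Finset.mem_range.1 hi
  rw [skewProduct_swap, explicitPoly_even n L l, skewProduct_sum_C_mul hn hL
    (fun j => (explicitCoeff n L l j : ℂ)) (fun j hj => by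
      have := Finset.mem_range.1 hj
      rw [Polynomial.natDegree_X_pow]
      omega) (by rw [Polynomial.natDegree_X_pow]; omega), Finset.sum_eq_zero, neg_zero, mul_zero]
  intro j _
  rw [skewProduct_X_pow, if_neg (by omega), if_neg (by omega)]
  simp

theorem isSkewOrthogonal_explicitPoly {N : ℕ} {n L : ℝ} (hn : (N : ℝ) ≤ n) (hL : 0 ≤ L) :
    IsSkewOrthogonal N n L (explicitPoly n L) where
  monic _ hj := (monic_natDegree_explicitPoly hn hL hj).1
  natDegree _ hj := (monic_natDegree_explicitPoly hn hL hj).2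
  even_even _ hj _ hk := skewProduct_explicitPoly_even_even hn hL hj hk
  odd_odd j _ k _ := by
    rw [explicitPoly_odd, explicitPoly_odd, skewProduct_X_pow, if_neg (by omega),
      if_neg (by omega)]
    simp
  even_odd _ hj _ hk h := by rw [skewProduct_explicitPoly_even_odd hn hL hj hk, if_neg h]

theorem g_explicitPoly {N : ℕ} {n L : ℝ} (hn : (N : ℝ) ≤ n) (hL : 0 ≤ L) {k : ℕ} (hk : k < N) :
    g n L (explicitPoly n L) k = (explicitNorm n L k : ℂ) := by
  rw [g, skewProduct_explicitPoly_even_odd hn hL hk hk, if_pos rfl]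

/-! ## The kernel and the density -/

lemma kerD_eq_kerS {N : ℕ} (n L : ℝ) (q : ℕ → Polynomial ℂ) (x y : ℂ) :
    kerD N n L q x y = kerS N n L q x (conj y) := by
  simp only [kerD, kerS, Complex.conj_conj]

lemma kerD_eq_kerI {N : ℕ} (n L : ℝ) (q : ℕ → Polynomial ℂ) (x y : ℂ) :
    kerD N n L q x y = kerI N n L q (conj x) (conj y) := by
  simp only [kerD, kerI, Complex.conj_conj]

lemma pfaffian_kernelMatrix_one {N : ℕ} (n L : ℝ) (q : ℕ → Polynomial ℂ) (z : ℂ) :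
    pfaffian (kernelMatrix N n L q fun _ : Fin 1 => z) = kerS N n L q z z := by
  have h1 : (Finset.univ : Finset (Equiv.Perm (Fin 1 × Fin 2))) =
      {1, Equiv.swap (0, 0) (0, 1)} := by decide
  rw [pfaffian, h1, Finset.sum_pair (by decide), Equiv.Perm.sign_swap (by decide)]
  simp [kernelMatrix]

/-- The duplication formula is applied twice, to the pairs at L + k + 1 and n - k. It turns the
double-argument Gammas of the norm into half-integer shifts and yields the power of 2. The leading 2
is that of 2 im z in the weight. -/
lemma two_mul_explicitCoeff_div {n L : ℝ} (hL : 0 ≤ L) {k j : ℕ} (hk : (k : ℝ) < n)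
    (hj : j ≤ k) :
    2 * explicitCoeff n L k j / explicitNorm n L k =
      Real.Gamma (2 * n + 2 * L + 2) / 2 ^ (2 * (L + n) - 1) /
        (Real.Gamma (L + j + 1) * Real.Gamma (L + k + 3 / 2) * Real.Gamma (n - j + 1 / 2) *
          Real.Gamma (n - k)) := by
  have hk0 : (0 : ℝ) ≤ k := Nat.cast_nonneg k
  have hjk : (j : ℝ) ≤ k := by exact_mod_cast hj
  have d1 := Real.Gamma_mul_Gamma_add_half (L + k + 1)
  have d2 := Real.Gamma_mul_Gamma_add_half (n - k)
  rw [show L + (k : ℝ) + 1 + 1 / 2 = L + k + 3 / 2 by ring,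
    show 2 * (L + (k : ℝ) + 1) = 2 * L + 2 * k + 2 by ring] at d1
  rw [show 2 * (n - (k : ℝ)) = 2 * n - 2 * k by ring] at d2
  have hp : (2 : ℝ) ^ (1 - (2 * L + 2 * k + 2)) * (2 : ℝ) ^ (1 - (2 * n - 2 * k)) *
      2 ^ (2 * (L + n) - 1) = 1 / 2 := by
    rw [← Real.rpow_add two_pos, ← Real.rpow_add two_pos]
    rw [show 1 - (2 * L + 2 * (k : ℝ) + 2) + (1 - (2 * n - 2 * k)) + (2 * (L + n) - 1) = -1 by ring,
      Real.rpow_neg_one]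
    norm_num
  have hpi := Real.mul_self_sqrt Real.pi_pos.le
  have g1 : 0 < Real.Gamma (2 * n + 2 * L + 2) := Real.Gamma_pos_of_pos (by linarith)
  have g2 : 0 < Real.Gamma (2 * n - 2 * k) := Real.Gamma_pos_of_pos (by linarith)
  have g3 : 0 < Real.Gamma (2 * L + 2 * k + 2) := Real.Gamma_pos_of_pos (by linarith)
  have g4 : 0 < Real.Gamma (L + j + 1) := Real.Gamma_pos_of_pos (by positivity)
  have g5 : 0 < Real.Gamma (n - j + 1 / 2) := Real.Gamma_pos_of_pos (by linarith)
  have g6 : 0 < Real.Gamma (L + k + 3 / 2) := Real.Gamma_pos_of_pos (by positivity)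
  have g7 : 0 < Real.Gamma (n - k) := Real.Gamma_pos_of_pos (by linarith)
  have g8 : (0 : ℝ) < 2 ^ (2 * (L + n) - 1) := by positivity
  rw [explicitCoeff, explicitNorm]
  generalize (2 : ℝ) ^ (2 * (L + n) - 1) = P at *
  generalize (2 : ℝ) ^ (1 - (2 * L + 2 * (k : ℝ) + 2)) = P₁ at *
  generalize (2 : ℝ) ^ (1 - (2 * n - 2 * (k : ℝ))) = P₂ at *
  generalize Real.Gamma (2 * n + 2 * L + 2) = G₁ at *
  generalize Real.Gamma (2 * n - 2 * k) = G₂ at *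
  generalize Real.Gamma (2 * L + 2 * k + 2) = G₃ at *
  generalize Real.Gamma (L + j + 1) = G₄ at *
  generalize Real.Gamma (n - j + 1 / 2) = G₅ at *
  generalize Real.Gamma (L + k + 3 / 2) = G₆ at *
  generalize Real.Gamma (n - k) = G₇ at *
  generalize Real.Gamma (L + k + 1) = G₈ at *
  generalize Real.Gamma (n - k + 1 / 2) = G₉ at *
  have hπ := Real.pi_pos
  have key : 2 * (G₈ * G₉) * (P * (G₆ * G₇)) = Real.pi * G₂ * G₃ := by
    calc 2 * (G₈ * G₉) * (P * (G₆ * G₇)) = 2 * P * ((G₈ * G₆) * (G₇ * G₉)) := by ring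
      _ = 2 * (P₁ * P₂ * P) * (√Real.pi * √Real.pi) * G₂ * G₃ := by rw [d1, d2]; ring
      _ = Real.pi * G₂ * G₃ := by rw [hp, hpi]; ring
  field_simp
  linear_combination key

/-- The common factor |z|^{4j} is taken out of the antisymmetrised product of z^{2j} and z^{2k+1}.
The Gamma factors are handled by `two_mul_explicitCoeff_div`. -/
theorem kerS_explicitPoly {N : ℕ} {n L : ℝ} (hn : (N : ℝ) ≤ n) (hL : 0 ≤ L) {z : ℂ}
    (hz : 0 < z.im) : kerS N n L (explicitPoly n L) z z = explicitDensity N n L z := by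
  rw [kerS, explicitDensity, mul_assoc]
  congr 1
  rw [Finset.mul_sum]
  refine Finset.sum_congr rfl fun k hk => ?_
  have hkN := Finset.mem_range.1 hk
  have hkn : (k : ℝ) < n := lt_of_lt_of_le (by exact_mod_cast hkN) hn
  rw [h_mul_h_conj hz, g_explicitPoly hn hL hkN, explicitPoly_even, explicitPoly_odd]
  simp only [Polynomial.eval_finsetSum, Polynomial.eval_mul, Polynomial.eval_C,
    Polynomial.eval_pow, Polynomial.eval_X]
  rw [Finset.sum_mul, Finset.mul_sum, ← Finset.sum_sub_distrib, Finset.mul_sum, Finset.mul_sum]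
  refine Finset.sum_congr rfl fun j hj => ?_
  have hjk : j ≤ k := Nat.lt_succ_iff.1 (Finset.mem_range.1 hj)
  have h1 := two_mul_explicitCoeff_div hL hkn hjk
  have h2 : z ^ (2 * j) * conj z ^ (2 * k + 1) - z ^ (2 * k + 1) * conj z ^ (2 * j) =
      ((‖z‖ ^ (4 * j) : ℝ) : ℂ) * (conj z ^ (2 * k - 2 * j + 1) - z ^ (2 * k - 2 * j + 1)) := by
    have h3 : ((‖z‖ ^ (4 * j) : ℝ) : ℂ) = z ^ (2 * j) * conj z ^ (2 * j) := by
      rw [← mul_pow, Complex.mul_conj, Complex.normSq_eq_norm_sq]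
      push_cast
      rw [← pow_mul]
      congr 1
      ring
    obtain ⟨d, rfl⟩ := Nat.exists_eq_add_of_le hjk
    rw [h3, show 2 * (j + d) - 2 * j + 1 = 2 * d + 1 by omega]
    ring
  have hb : (0 : ℝ) < 1 + ‖z‖ ^ 2 := by positivity
  have h5 : skewWeight n L z * explicitCoeff n L k j / explicitNorm n L k =
      Real.Gamma (2 * n + 2 * L + 2) * z.im * ‖z‖ ^ (4 * L) /
      (2 ^ (2 * (L + n) - 1) * (1 + ‖z‖ ^ 2) ^ (2 * n + 2 * L + 2)) /
        (Real.Gamma (L + j + 1) * Real.Gamma (L + k + 3 / 2) * Real.Gamma (n - j + 1 / 2) *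
          Real.Gamma (n - k)) := by
    have h6 : skewWeight n L z * explicitCoeff n L k j / explicitNorm n L k =
      z.im * ‖z‖ ^ (4 * L) * ((1 + ‖z‖ ^ 2) ^ (2 * n + 2 * L + 2))⁻¹ *
        (2 * explicitCoeff n L k j / explicitNorm n L k) := by
      rw [skewWeight, Real.rpow_neg hb.le, show 2 * (n + L + 1) = 2 * n + 2 * L + 2 by ring]
      ring
    rw [h6, h1]
    simp only [div_eq_mul_inv, mul_inv]
    ring
  have h7 := congrArg (fun x : ℝ => (x : ℂ)) h5
  simp only [Complex.ofReal_mul (skewWeight n L z), Complex.ofReal_div _ (explicitNorm n L k)] at h7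
  calc _ = ((skewWeight n L z : ℂ) * (explicitCoeff n L k j : ℂ) / (explicitNorm n L k : ℂ)) *
        (z ^ (2 * j) * conj z ^ (2 * k + 1) - z ^ (2 * k + 1) * conj z ^ (2 * j)) := by ring
    _ = _ := by
      rw [h7, h2, Complex.ofReal_div _ (Real.Gamma (L + j + 1) * Real.Gamma (L + k + 3 / 2) *
        Real.Gamma (n - j + 1 / 2) * Real.Gamma (n - k))]
      ring

end InducedSpherical

end

/-! ### Assembly of the statement -/

theorem mainTheorem2 (N : ℕ) (hN : 0 < N) (n L : ℝ) (hn : (N : ℝ) ≤ n) (hL : 0 ≤ L) :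
    -- the eigenvalue jpdf exists
    (∃ Q, InducedSpherical.IsEigenvalueJpdf N n L Q) ∧
    -- the explicit polynomials are skew-orthogonal, with the explicit normalisations
    InducedSpherical.IsSkewOrthogonal N n L (InducedSpherical.explicitPoly n L) ∧
    (∀ k < N, InducedSpherical.g n L (InducedSpherical.explicitPoly n L) k =
      (InducedSpherical.explicitNorm n L k : ℂ)) ∧
    -- the Pfaffian formula, for every skew-orthogonal family
    (∀ Q, InducedSpherical.IsEigenvalueJpdf N n L Q →
      ∀ q, InducedSpherical.IsSkewOrthogonal N n L q →
        ∀ m ≤ N, ∀ z ∈ InducedSpherical.upperHalf m,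
          IntegrableOn (fun w => Q (InducedSpherical.glue z w))
            (InducedSpherical.upperHalf (N - m)) ∧
          (InducedSpherical.correlation Q m z : ℂ) =
            InducedSpherical.pfaffian (InducedSpherical.kernelMatrix N n L q z)) ∧
    -- the relations between the kernel elements
    (∀ q, InducedSpherical.IsSkewOrthogonal N n L q → ∀ x y : ℂ,
      InducedSpherical.kerD N n L q x y =
        InducedSpherical.kerS N n L q x ((starRingEnd ℂ) y) ∧
      InducedSpherical.kerD N n L q x y =
        InducedSpherical.kerI N n L q ((starRingEnd ℂ) x) ((starRingEnd ℂ) y)) ∧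
    -- the density
    (∀ Q, InducedSpherical.IsEigenvalueJpdf N n L Q → ∀ z : ℂ, 0 < z.im →
      (InducedSpherical.correlation Q 1 (fun _ => z) : ℂ) =
        InducedSpherical.kerS N n L (InducedSpherical.explicitPoly n L) z z ∧
      InducedSpherical.kerS N n L (InducedSpherical.explicitPoly n L) z z =
        InducedSpherical.explicitDensity N n L z) := by
  have hS := InducedSpherical.isSkewOrthogonal_explicitPoly hn hL
  refine ⟨⟨_, InducedSpherical.isEigenvalueJpdf_eigDensity hn hL⟩, hS,
    fun k hk => InducedSpherical.g_explicitPoly hn hL hk, fun Q hQ q hq m hm z hz =>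
      ⟨InducedSpherical.integrableOn_glue hm hn hL hQ hz,
        InducedSpherical.correlation_eq_pfaffian hm hn hL hQ hq hz⟩,
    fun q _ x y => ⟨InducedSpherical.kerD_eq_kerS n L q x y,
      InducedSpherical.kerD_eq_kerI n L q x y⟩, fun Q hQ z hz => ⟨?_, ?_⟩⟩
  · rw [InducedSpherical.correlation_eq_pfaffian hN hn hL hQ hS fun _ => hz,
      InducedSpherical.pfaffian_kernelMatrix_one]
  · exact InducedSpherical.kerS_explicitPoly hn hL hz
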